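/- Throughout, $\lambda$ is the security parameter, QPT means (uniform) quantum polynomial time, and $f$ is negligible if for every constant $c$, $f(\lambda)<\lambda^{-c}$ for all large $\lambda$. **Encryption.** A secret key encryption scheme with certified everlasting deletion is a tuple of QPT algorithms $\Sigma=(\mathsf{KeyGen},\mathsf{Enc},\mathsf{Dec},\mathsf{Del},\mathsf{Vrfy})$, all of which also receive $1^\lambda$: $\mathsf{KeyGen}(1^\lambda)\to sk\in\{0,1\}^{k(\lambda)}$; $\mathsf{Enc}(sk,m)\to(vk,ct)$ with a classical verification key $vk\in\{0,1\}^{r(\lambda)}$ and a quantum ciphertext $ct$ of $p(\lambda)$ qubits; $\mathsf{Dec}(sk,ct)\to m'$ or $\bot$; $\mathsf{Del}(ct)\to cert$, a certificate of $s(\lambda)$ qubits (in particular, possibly classical); $\mathsf{Vrfy}(vk,cert)\to\top$ or $\bot$. Here $k,r,p,s$ are polynomials, and the plaintext space equals the key space $\mathcal K=\{0,1\}^{k(\lambda)}$. It is *certified everlasting IND-CPA secure* if for every QPT $\mathcal A_1$ and every unbounded quantum $\mathcal A_2$ the difference $|\Pr[\mathrm{Exp}(\lambda,0)=1]-\Pr[\mathrm{Exp}(\lambda,1)=1]|$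 is negligible, where in $\mathrm{Exp}(\lambda,b)$: $sk\leftarrow\mathsf{KeyGen}(1^\lambda)$; $\mathcal A_1$, which at any time may query $m\mapsto(vk,ct)\leftarrow\mathsf{Enc}(sk,m)$, chooses $m_0,m_1$, receives the ciphertext $ct$ of $(vk,ct)\leftarrow\mathsf{Enc}(sk,m_b)$, and finally outputs $cert$ and passes its internal state to $\mathcal A_2$; if $\mathsf{Vrfy}(vk,cert)=\top$, then $\mathcal A_2$ is also given $sk$, and the bit that it outputs is the output of the experiment; otherwise the output is $\bot$. **Circuits.** Circuits are Boolean circuits with input wires $1,\dots,n$, two-input gates $\mathsf{gate}_i=(g,w_a,w_b,w_c)$, $1\le i\le q$, with outgoing wire $c=n+i$ (of arbitrary fan-out), listed so that $a,b<n+i$ (for instance, leveled circuits with the gates in ascending order of level), and output wires $\mathsf{out}_1,\dots,\mathsf{out}_m$, none of which is an incoming wire of a gate. The topology of a circuit is this data without the functions $g$. **Garbling.** From $\Sigma$ define the following garbling scheme. - $\mathsf{Setup}(1^\lambda)$: independent keys $L_{i,\sigma}=sk_i^\sigma\leftarrow\mathsf{KeyGen}(1^\lambda)$ for every input wire $i$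 and $\sigma\in\{0,1\}$. - $\mathsf{Garble}(1^\lambda,C,\{L_{i,\sigma}\})$: generate independent keys $sk_i^\sigma\leftarrow\mathsf{KeyGen}(1^\lambda)$ for all other wires $i$. For each gate $(g,w_a,w_b,w_c)$ and all $\sigma_a,\sigma_b\in\{0,1\}$ sample $P\leftarrow\mathcal K$ uniformly and independently and compute $\mathsf{Enc}(sk_a^{\sigma_a},P)$ and $\mathsf{Enc}(sk_b^{\sigma_b},P\oplus sk_c^{g(\sigma_a,\sigma_b)})$; the garbled gate consists of the resulting four pairs of ciphertexts in a uniformly random order, and its verification key consists of the verification keys in the same order. Output $\widetilde C$, consisting of the topology of $C$, all garbled gates and the tables $[(sk_{\mathsf{out}_i}^0,0),(sk_{\mathsf{out}_i}^1,1)]$ for $i\le m$, and $vk$, consisting of the verification keys of all gates. - $\mathsf{Eval}(\widetilde C,\{L_{i,x_i}\})$: gate by gate, decrypt the four pairs with the keys held for $w_a$ and $w_b$; if both decryptions succeed for exactly one pair, the XOR of the two plaintexts is the key for $w_c$, otherwise the result is $\bot$; finally look up the keys of the output wires in the tables. - $\mathsf{Del}(\widetilde C)$ applies the deletion algorithm of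 $\Sigma$ to all ciphertexts; $\mathsf{Vrfy}(vk,cert)$ outputs $\top$ if and only if all the certificates are accepted by the verification algorithm of $\Sigma$. **Theorem.** If $\Sigma$ is certified everlasting IND-CPA secure, then this garbling scheme is selectively certified everlasting secure for all polynomial-size circuits, that is: there is a QPT simulator $\mathsf{Sim}$ such that for every QPT $\mathcal A_1$ and every unbounded quantum $\mathcal A_2$, $|\Pr[\mathrm{Exp}'(\lambda,0)=1]-\Pr[\mathrm{Exp}'(\lambda,1)=1]|$ is negligible, where in $\mathrm{Exp}'(\lambda,b)$: $\mathcal A_1$ chooses a circuit $C$ with $n$ inputs and $x\in\{0,1\}^n$; $\{L_{i,\sigma}\}\leftarrow\mathsf{Setup}(1^\lambda)$; if $b=0$, then $(\widetilde C,vk)\leftarrow\mathsf{Garble}(1^\lambda,C,\{L_{i,\sigma}\})$, and if $b=1$, then $(\widetilde C,vk)\leftarrow\mathsf{Sim}(1^\lambda,\text{topology of }C,C(x),\{L_{i,x_i}\}_i)$; $\mathcal A_1$ receives $\widetilde C$ and $\{L_{i,x_i}\}_i$, outputs $cert$, and passes its internal state to $\mathcal A_2$; if $\mathsf{Vrfy}(vk,cert)=\top$,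 the output is the bit that $\mathcal A_2$ outputs; otherwise it is $\bot$. -/

import Mathlib

noncomputable section

/-! ### Classical-quantum states -/

/-- Bit strings; also the computational basis states of a quantum memory: a list of length `n`
is a basis state of `n` qubits. -/
abbrev Bits : Type := List Bool

/-- A classical-quantum state `∑ₐ |a⟩⟨a| ⊗ ρₐ` with classical part in `α`: the coefficient at
`(a, s, t)` is the matrix entry `⟨s|ρₐ|t⟩`. -/
def CQ (α : Type) : Type := (α × Bits × Bits) →₀ ℂ

namespace CQ

instance (α : Type) : AddCommGroup (CQ α) :=
  inferInstanceAs (AddCommGroup ((α × Bits × Bits) →₀ ℂ))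

instance (α : Type) : Module ℂ (CQ α) :=
  inferInstanceAs (Module ℂ ((α × Bits × Bits) →₀ ℂ))

/-- `|a⟩⟨a| ⊗ |s⟩⟨t|`. -/
def ket {α : Type} (a : α) (s t : Bits) : CQ α := Finsupp.single (a, s, t) 1

/-- Apply an operation, given by its values on the basis `|a⟩⟨a| ⊗ |s⟩⟨t|`, to the classical part
and to the whole quantum memory; this is the linear extension of `f`. -/
def apply {α β : Type} (ρ : CQ α) (f : α → Bits → Bits → CQ β) : CQ β :=
  Finsupp.sum ρ fun x c => c • f x.1 x.2.1 x.2.2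

/-- Prepare new qubits with `τ` and put them behind the existing ones `|s⟩⟨t|`. -/
def appendTo {α : Type} (s t : Bits) (τ : CQ α) : CQ α :=
  τ.apply fun b s' t' => ket b (s ++ s') (t ++ t')

/-- Sequential preparation: `ρ >>= f` first prepares `ρ`, then, depending on its classical part
`a`, prepares `f a` on new qubits, which are put behind those of `ρ`. -/
instance : Monad CQ where
  pure a := ket a [] []
  bind ρ f := ρ.apply fun a s t => appendTo s t (f a)

/-- The uniform distribution on a finite type. -/
def uniform (α : Type) [Fintype α] : CQ α := ∑ a : α, ((Fintype.card α : ℂ)⁻¹) • ket a [] []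

/-- Trace out the whole quantum memory. -/
def traceOut {α : Type} (ρ : CQ α) : CQ α :=
  ρ.apply fun a s t => if s = t then ket a [] [] else 0

/-- Weight of the outcome "the flag is `true` and the measurement of the quantum memory with the
effect `E a`, which may depend on the classical part `a`, accepts", that is
`∑ₐ tr (ρ₍true,a₎ E a)`. -/
def acceptProb {α : Type} (ρ : CQ (Bool × α)) (E : α → Matrix Bits Bits ℂ) : ℝ :=
  (Finsupp.sum ρ fun x c => if x.1.1 then c * E x.1.2 x.2.2 x.2.1 else 0).re

end CQ

open scoped ComplexOrder in
/-- `0 ≤ E ≤ 1`: the "output 1" element of an arbitrary two-outcome measurement of a quantum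
memory of any number of qubits. -/
def IsEffect (E : Matrix Bits Bits ℂ) : Prop := E.PosSemidef ∧ (1 - E).PosSemidef

/-! ### Classical data -/

/-- Binary trees, the classical data of the machine model. -/
inductive Val : Type
  | nil : Val
  | cons : Val → Val → Val

namespace Val

def size : Val → ℕ
  | nil => 1
  | cons a b => 1 + a.size + b.size

def hd : Val → Val
  | nil => nil
  | cons a _ => a

def tl : Val → Val
  | nil => nil
  | cons _ b => b

def isNil : Val → Bool
  | nil => true
  | cons _ _ => false

def toList : Val → List Val
  | nil => []
  | cons a b => a :: b.toList

def ofList : List Val → Val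
  | [] => nil
  | a :: l => cons a (ofList l)

/-- Natural numbers are written in unary. -/
def unary (n : ℕ) : Val := ofList (List.replicate n nil)

def toNat (v : Val) : ℕ := v.toList.length

def ofBool : Bool → Val
  | false => nil
  | true => cons nil nil

def toBool (v : Val) : Bool := !v.isNil

def ofBits (w : Bits) : Val := ofList (w.map ofBool)

def toBits (v : Val) : Bits := v.toList.map toBool

end Val

/-- Read a string as an element of `{0,1}^k`, by padding with zeros or cutting off. -/
def fitBits (k : ℕ) (w : Bits) : Bits := (w ++ List.replicate k false).take k

/-! ### Quantum polynomial time

A program has a classical value (a tree) and a quantum memory consisting of a sequence of qubits,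
addressed by their positions `0, 1, 2, …`, written in unary. The classical control is a structured
programming language with trees as data and loops over lists; the quantum instructions are
preparation of a qubit in the state `|0⟩`, the gates `H`, `T`, `CNOT` (a universal gate set),
measurement in the computational basis, discarding, and rearranging qubits. Instructions that refer
to a position outside of the memory have no effect. -/

inductive Prog : Type
  /-- return the input -/
  | skip : Prog
  /-- return the empty tree -/
  | nil : Prog
  /-- left subtree -/
  | hd : Prog
  /-- right subtree -/
  | tl : Prog
  /-- `seq p q`: run `p`, then run `q` on the value that `p` returns -/
  | seq : Prog → Prog → Prog
  /-- `pair p q`: run `p` and then `q` on the same classical input, return both values -/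
  | pair : Prog → Prog → Prog
  /-- `cond p q`: run `p` on the right subtree if the left one is not empty, and `q` otherwise -/
  | cond : Prog → Prog → Prog
  /-- `fold p`: on input `(l, u)` replace `u` successively, for each entry `x` of the list `l`,
  by the result of `p` on `(x, u)` -/
  | fold : Prog → Prog
  /-- return a uniformly random entry of the input list -/
  | rand : Prog
  /-- put a new qubit in the state `|0⟩` at the end of the memory -/
  | new : Prog
  /-- Hadamard gate on the qubit whose position is the input -/
  | gateH : Prog
  /-- `π/8` gate on the qubit whose position is the input -/
  | gateT : Prog
  /-- on input `(i, j)`: controlled NOT with control `i` and target `j` -/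
  | gateCNOT : Prog
  /-- measure the qubit whose position is the input and return the outcome -/
  | meas : Prog
  /-- remove (trace out) the qubit whose position is the input -/
  | discard : Prog
  /-- move the qubit whose position is the input to the end of the memory -/
  | move : Prog
  /-- on input `(k, v)`: run `p` on `v` and on the memory without its first `k` qubits -/
  | frame : Prog → Prog
  /-- send the input to the oracle and return its classical answer; the quantum part of the answer
  is put at the end of the memory -/
  | query : Prog

/-- Apply the one-qubit gate with matrix `U` to the qubit at position `i`. -/
def applyGate (U : Bool → Bool → ℂ) (i : ℕ) (v : Val) (s t : Bits) : CQ Val :=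
  match s[i]?, t[i]? with
  | some x, some y =>
      ∑ a : Bool, ∑ b : Bool, (U a x * star (U b y)) • CQ.ket v (s.set i a) (t.set i b)
  | _, _ => CQ.ket v s t

def hadamard (a x : Bool) : ℂ := (if a && x then -1 else 1) / (Real.sqrt 2 : ℂ)

def tGate (a x : Bool) : ℂ :=
  if a = x then (if x then Complex.exp (Complex.I * (Real.pi / 4 : ℝ)) else 1) else 0

/-- The effect of `CNOT` with control `i` and target `j` on a basis state. -/
def flipIf (i j : ℕ) (s : Bits) : Bits :=
  match s[i]?, s[j]? with
  | some x, some y => if i = j then s else s.set j (xor x y)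
  | _, _ => s

namespace Prog

/-- The operation that a program performs with an oracle `O`: its effect on the classical input
`v` and on the (possibly off-diagonal) memory content `|s⟩⟨t|`. -/
def den (O : Val → CQ Val) : Prog → Val → Bits → Bits → CQ Val
  | skip, v, s, t => CQ.ket v s t
  | nil, _, s, t => CQ.ket Val.nil s t
  | hd, v, s, t => CQ.ket v.hd s t
  | tl, v, s, t => CQ.ket v.tl s t
  | seq p q, v, s, t => (p.den O v s t).apply fun u s' t' => q.den O u s' t'
  | pair p q, v, s, t => (p.den O v s t).apply fun a s' t' =>
      (q.den O v s' t').apply fun b s'' t'' => CQ.ket (Val.cons a b) s'' t''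
  | cond p q, v, s, t => if v.hd.isNil then q.den O v.tl s t else p.den O v.tl s t
  | fold p, v, s, t => v.hd.toList.foldl
      (fun ρ x => ρ.apply fun u s' t' => p.den O (Val.cons x u) s' t') (CQ.ket v.tl s t)
  | rand, v, s, t =>
      if v.isNil then CQ.ket Val.nil s t
      else (v.toList.map fun x => ((v.toList.length : ℂ)⁻¹) • CQ.ket x s t).sum
  | new, v, s, t => CQ.ket v (s ++ [false]) (t ++ [false])
  | gateH, v, s, t => applyGate hadamard v.toNat v s t
  | gateT, v, s, t => applyGate tGate v.toNat v s t
  | gateCNOT, v, s, t =>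
      CQ.ket v (flipIf v.hd.toNat v.tl.toNat s) (flipIf v.hd.toNat v.tl.toNat t)
  | meas, v, s, t =>
      match s[v.toNat]?, t[v.toNat]? with
      | some x, some y => if x = y then CQ.ket (Val.ofBool x) s t else 0
      | _, _ => CQ.ket Val.nil s t
  | discard, v, s, t =>
      match s[v.toNat]?, t[v.toNat]? with
      | some x, some y =>
          if x = y then CQ.ket v (s.eraseIdx v.toNat) (t.eraseIdx v.toNat) else 0
      | _, _ => CQ.ket v s t
  | move, v, s, t =>
      CQ.ket v (s.eraseIdx v.toNat ++ s[v.toNat]?.toList) (t.eraseIdx v.toNat ++ t[v.toNat]?.toList)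
  | frame p, v, s, t =>
      CQ.appendTo (s.take v.hd.toNat) (t.take v.hd.toNat)
        (p.den O v.tl (s.drop v.hd.toNat) (t.drop v.hd.toNat))
  | query, v, s, t => CQ.appendTo s t (O v)

/-- The possible classical outcomes of a program on a classical input, over all outcomes of the
random choices and measurements and over all oracle answers of size at most `L`, each with the
number of steps that it takes. An elementary step is charged with the size of its input, and a
query in addition with the maximal size of the answer. -/
def traces (L : ℕ) : Prog → Val → Set (Val × ℕ)
  | skip, v => {(v, v.size + 2)}
  | nil, v => {(Val.nil, v.size + 2)}
  | hd, v => {(v.hd, v.size + 2)}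
  | tl, v => {(v.tl, v.size + 2)}
  | seq p q, v => {z | ∃ x ∈ p.traces L v, ∃ y ∈ q.traces L x.1,
      z = (y.1, x.2 + y.2 + (v.size + 2))}
  | pair p q, v => {z | ∃ x ∈ p.traces L v, ∃ y ∈ q.traces L v,
      z = (Val.cons x.1 y.1, x.2 + y.2 + (v.size + 2))}
  | cond p q, v => {z | ∃ x ∈ (if v.hd.isNil then q.traces L v.tl else p.traces L v.tl),
      z = (x.1, x.2 + (v.size + 2))}
  | fold p, v => v.hd.toList.foldl
      (fun T x => {z | ∃ u ∈ T, ∃ w ∈ p.traces L (Val.cons x u.1), z = (w.1, u.2 + w.2)})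
      {(v.tl, v.size + 2)}
  | rand, v => {z | (v.isNil = true ∧ z.1 = Val.nil ∨ z.1 ∈ v.toList) ∧ z.2 = v.size + 2}
  | new, v => {(v, v.size + 2)}
  | gateH, v => {(v, v.size + 2)}
  | gateT, v => {(v, v.size + 2)}
  | gateCNOT, v => {(v, v.size + 2)}
  | meas, v => {z | (∃ b, z.1 = Val.ofBool b) ∧ z.2 = v.size + 2}
  | discard, v => {(v, v.size + 2)}
  | move, v => {(v, v.size + 2)}
  | frame p, v => {z | ∃ x ∈ p.traces L v.tl, z = (x.1, x.2 + (v.size + 2))}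
  | query, v => {z | z.1.size ≤ L ∧ z.2 = v.size + 2 + L}

/-- Polynomial running time: in the worst case the number of steps is bounded by a polynomial in
the size of the input and of the largest oracle answer. -/
def PolyTime (p : Prog) : Prop :=
  ∃ P : Polynomial ℕ, ∀ (L : ℕ) (v : Val), ∀ z ∈ p.traces L v, z.2 ≤ P.eval (v.size + L)

/-- The program makes no oracle queries. -/
def QueryFree : Prog → Prop
  | query => False
  | seq p q => p.QueryFree ∧ q.QueryFree
  | pair p q => p.QueryFree ∧ q.QueryFree
  | cond p q => p.QueryFree ∧ q.QueryFree
  | fold p => p.QueryFree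
  | frame p => p.QueryFree
  | _ => True

/-- Quantum polynomial-time algorithms (without oracle). -/
def QPT (p : Prog) : Prop := p.QueryFree ∧ p.PolyTime

/-- The operation performed by a program without oracle. -/
def run (p : Prog) (v : Val) (s t : Bits) : CQ Val := p.den (fun _ => pure Val.nil) v s t

end Prog

/-- Negligible functions. -/
def Negligible (f : ℕ → ℝ) : Prop :=
  ∀ c : ℕ, ∃ n₀ : ℕ, ∀ n > n₀, f n < ((n : ℝ) ^ c)⁻¹

/-! ### Secret key encryption with certified everlasting deletion -/

/-- Syntax of secret key encryption with certified everlasting deletion, for security parameter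
`n`: secret keys and plaintexts in `{0,1}^keyLen(n)`, ciphertexts of `ctLen(n)` qubits, verification
keys in `{0,1}^vkLen(n)` and deletion certificates of `certLen(n)` qubits. Classical inputs and
outputs of the algorithms are the classical values of the programs, and ciphertexts and certificates
are the content of the quantum memory. -/
structure CertSKE where
  keyLen : Polynomial ℕ
  ctLen : Polynomial ℕ
  vkLen : Polynomial ℕ
  certLen : Polynomial ℕ
  KeyGen : Prog
  Enc : Prog
  Dec : Prog
  Del : Prog
  Vrfy : Prog
  keyGen_qpt : KeyGen.QPT
  enc_qpt : Enc.QPT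
  dec_qpt : Dec.QPT
  del_qpt : Del.QPT
  vrfy_qpt : Vrfy.QPT
  /-- `KeyGen(1ⁿ)` returns a secret key. -/
  keyGen_range : ∀ (n : ℕ), ∀ x ∈ Finsupp.support (KeyGen.run (Val.unary n) [] []),
    ∃ w : Bits, w.length = keyLen.eval n ∧ x.1 = Val.ofBits w
  /-- `Enc(1ⁿ, sk, m)` returns a verification key and a ciphertext. -/
  enc_range : ∀ (n : ℕ) (sk m : Bits), sk.length = keyLen.eval n → m.length = keyLen.eval n →
    ∀ x ∈ Finsupp.support
      (Enc.run (Val.cons (Val.unary n) (Val.cons (Val.ofBits sk) (Val.ofBits m))) [] []),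
    (∃ w : Bits, w.length = vkLen.eval n ∧ x.1 = Val.ofBits w) ∧
      x.2.1.length = ctLen.eval n ∧ x.2.2.length = ctLen.eval n
  /-- `Dec(1ⁿ, sk, ct)` returns `⊥` (written as `nil`) or a plaintext `m` (written as
  `cons nil m`). -/
  dec_range : ∀ (n : ℕ) (sk s t : Bits), sk.length = keyLen.eval n →
    s.length = ctLen.eval n → t.length = ctLen.eval n →
    ∀ x ∈ Finsupp.support (Dec.run (Val.cons (Val.unary n) (Val.ofBits sk)) s t),
    x.1 = Val.nil ∨
      ∃ w : Bits, w.length = keyLen.eval n ∧ x.1 = Val.cons Val.nil (Val.ofBits w)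
  /-- `Del(1ⁿ, ct)` returns a certificate. -/
  del_range : ∀ (n : ℕ) (s t : Bits), s.length = ctLen.eval n → t.length = ctLen.eval n →
    ∀ x ∈ Finsupp.support (Del.run (Val.unary n) s t),
    x.2.1.length = certLen.eval n ∧ x.2.2.length = certLen.eval n

namespace CertSKE

variable (S : CertSKE)

/-- The distribution of the secret key. -/
def keyGen (n : ℕ) : CQ Bits := Val.toBits <$> (S.KeyGen.run (Val.unary n) [] []).traceOut

/-- The joint state of the (classical) verification key and the ciphertext. -/
def enc (n : ℕ) (sk m : Bits) : CQ Bits :=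
  Val.toBits <$>
    S.Enc.run (Val.cons (Val.unary n) (Val.cons (Val.ofBits sk) (Val.ofBits m))) [] []

/-- Decryption of the ciphertext `|s⟩⟨t|`; `none` stands for `⊥`. -/
def dec (n : ℕ) (sk s t : Bits) : CQ (Option Bits) :=
  (fun v => if v.isNil then none else some v.tl.toBits) <$>
    (S.Dec.run (Val.cons (Val.unary n) (Val.ofBits sk)) s t).traceOut

/-- Deletion of the ciphertext `|s⟩⟨t|`; the certificate is the resulting memory. -/
def del (n : ℕ) (s t : Bits) : CQ Unit := (fun _ => ()) <$> S.Del.run (Val.unary n) s t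

/-- Verification of the certificate `|s⟩⟨t|`; `true` stands for `⊤` (a value other than `nil`) and
`false` for `⊥`. -/
def vrfy (n : ℕ) (vk s t : Bits) : CQ Bool :=
  Val.toBool <$> (S.Vrfy.run (Val.cons (Val.unary n) (Val.ofBits vk)) s t).traceOut

/-- The encryption oracle `m ↦ (vk, ct)`. -/
def encOracle (n : ℕ) (sk : Bits) (v : Val) : CQ Val :=
  Val.ofBits <$> S.enc n sk (fitBits (S.keyLen.eval n) v.toBits)

/-- The certified everlasting IND-CPA experiment up to the point where the unbounded adversary
starts. The first adversary consists of two stages `A` and `B` with access to the encryption oracle: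
`A(1ⁿ)` returns `((m₀, m₁), st)`; then the ciphertext of `m_b` is appended to its quantum memory;
`B(1ⁿ, st)` returns the certificate in the first qubits of its memory, and its classical
value `st'` and the other qubits are the internal state that is handed over. The result consists of
the outcome of the verification, `(sk, st')` and the quantum part of the internal state. The
experiment is aborted (with output `⊥`) if the memory is too short to contain a certificate. -/
def experiment (A B : Prog) (n : ℕ) (b : Bool) : CQ (Bool × Bits × Val) :=
  CQ.apply
    (do
      let sk ← S.keyGen n
      let v ← A.den (S.encOracle n sk) (Val.unary n) [] []
      let m := fitBits (S.keyLen.eval n) (if b then v.hd.tl.toBits else v.hd.hd.toBits)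
      let vk ← S.enc n sk m
      return (sk, v.tl, vk))
    fun r s t =>
      (B.den (S.encOracle n r.1) (Val.cons (Val.unary n) r.2.1) s t).apply fun st' s t =>
        let c := S.certLen.eval n
        if c ≤ s.length ∧ c ≤ t.length then
          (S.vrfy n r.2.2 (s.take c) (t.take c)).apply fun ok _ _ =>
            CQ.ket (ok, r.1, st') (s.drop c) (t.drop c)
        else 0

/-- Certified everlasting IND-CPA security. The unbounded adversary obtains the secret key and the
internal state if the verification succeeds, and outputs a bit by an arbitrary measurement; the
experiment outputs `1` if the verification succeeds and this bit is `1`. -/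
def CertEverlastingINDCPA : Prop :=
  ∀ A B : Prog, A.PolyTime → B.PolyTime →
    ∀ A₂ : ℕ → Bits × Val → Matrix Bits Bits ℂ, (∀ n z, IsEffect (A₂ n z)) →
      Negligible fun n =>
        |(S.experiment A B n false).acceptProb (A₂ n) - (S.experiment A B n true).acceptProb (A₂ n)|

end CertSKE

/-! ### Boolean circuits -/

/-- A gate: its truth table and its two incoming wires. -/
structure Gate where
  fn : Bool → Bool → Bool
  inA : ℕ
  inB : ℕ

/-- A Boolean circuit. The wires are `0, …, inputs - 1` (input wires) and `inputs + i`, the outgoing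
wire, with arbitrary fan-out, of the `i`-th gate. -/
structure Circuit where
  inputs : ℕ
  gates : List Gate
  outs : List ℕ

/-- The topology of a circuit: how its wires are connected, without the functions of the gates. -/
structure Topology where
  inputs : ℕ
  wires : List (ℕ × ℕ)
  outs : List ℕ

namespace Topology

def toVal (T : Topology) : Val :=
  Val.cons (Val.unary T.inputs)
    (Val.cons (Val.ofList (T.wires.map fun w => Val.cons (Val.unary w.1) (Val.unary w.2)))
      (Val.ofList (T.outs.map Val.unary)))

def ofVal (v : Val) : Topology where
  inputs := v.hd.toNat
  wires := v.tl.hd.toList.map fun w => (w.hd.toNat, w.tl.toNat)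
  outs := v.tl.tl.toList.map Val.toNat

end Topology

namespace Circuit

/-- The gates are listed in an order in which each gate comes after those that it depends on, the
output wires exist, and no output wire is an incoming wire of a gate. -/
def Valid (C : Circuit) : Prop :=
  (∀ (i : ℕ) (G : Gate), C.gates[i]? = some G → G.inA < C.inputs + i ∧ G.inB < C.inputs + i) ∧
  ∀ o ∈ C.outs, o < C.inputs + C.gates.length ∧ ∀ G ∈ C.gates, G.inA ≠ o ∧ G.inB ≠ o

/-- The values of all wires. -/
def wireValues (C : Circuit) (x : Bits) : Bits :=
  C.gates.foldl (fun w G => w ++ [G.fn (w.getD G.inA false) (w.getD G.inB false)]) x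

/-- `C(x)`. -/
def output (C : Circuit) (x : Bits) : Bits :=
  C.outs.map fun o => (C.wireValues x).getD o false

def topology (C : Circuit) : Topology where
  inputs := C.inputs
  wires := C.gates.map fun G => (G.inA, G.inB)
  outs := C.outs

/-- A gate is written as its truth table `[g(0,0), g(0,1), g(1,0), g(1,1)]` and its two wires. -/
def gateOfVal (v : Val) : Gate where
  fn a b := v.hd.toBits.getD ((if a then 2 else 0) + (if b then 1 else 0)) false
  inA := v.tl.hd.toNat
  inB := v.tl.tl.toNat

def ofVal (v : Val) : Circuit where
  inputs := v.hd.toNat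
  gates := v.tl.hd.toList.map gateOfVal
  outs := v.tl.tl.toList.map Val.toNat

end Circuit

/-! ### Garbling schemes with certified everlasting deletion -/

/-- The key for the bit `σ` in a pair of keys (or the label for `σ` in a pair of labels). -/
def sel (k : Bits × Bits) (σ : Bool) : Bits := if σ then k.2 else k.1

/-- Syntax of garbling schemes with certified everlasting deletion, for security parameter `n`. A
garbled circuit consists of a classical part and of the content of the quantum memory. -/
structure GarblingScheme where
  /-- the number of qubits of a deletion certificate for a garbling of `C` -/
  certLen : ℕ → Circuit → ℕ
  /-- `Setup(1ⁿ)`, for the given number of input wires; returns a pair of labels for each of them -/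
  setup : ℕ → ℕ → CQ (List (Bits × Bits))
  /-- `Garble(1ⁿ, C, labels)`; returns the garbled circuit, with classical part in the first
  component, and the verification key in the second component -/
  garble : ℕ → Circuit → List (Bits × Bits) → CQ (Val × Val)
  /-- `Eval`, on the classical part of a garbled circuit, one label for each input wire, and
  the quantum part `|s⟩⟨t|` of the garbled circuit; `none` stands for `⊥` -/
  eval : ℕ → Val → List Bits → Bits → Bits → CQ (Option Bits)
  /-- `Del`; the certificate is the resulting memory -/
  del : ℕ → Val → Bits → Bits → CQ Unit
  /-- `Vrfy`, on the verification key and the certificate `|s⟩⟨t|` -/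
  vrfy : ℕ → Val → Bits → Bits → CQ Bool

namespace GarblingScheme

/-- The labels `L_{i,x_i}`. -/
def activeLabels (labels : List (Bits × Bits)) (x : Bits) : List Bits :=
  List.zipWith sel labels x

/-- The joint output of the simulator, as for `garble`. It is given `1ⁿ`, the topology of the
circuit (and with it its size), the output `y = C(x)`, and the labels that belong to `x`. -/
def simulate (Sim : Prog) (n : ℕ) (T : Topology) (y : Bits) (labels : List Bits) :
    CQ (Val × Val) :=
  (fun v => (v.hd, v.tl)) <$>
    Sim.run (Val.cons (Val.unary n) (Val.cons T.toVal
      (Val.cons (Val.ofBits y) (Val.ofList (labels.map Val.ofBits))))) [] []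

variable (Γ : GarblingScheme)

open Classical in
/-- The selective certified everlasting security experiment up to the point where the unbounded
adversary starts. The first adversary consists of two stages: `A(1ⁿ)` returns `((C, x), st)`; then
the quantum part of the garbled circuit is appended to its quantum memory;
`B(1ⁿ, st, classical part of the garbled circuit, labels)` returns the certificate in the
first qubits of its memory, and its classical value and the other qubits are the internal state that
is handed over. The experiment is aborted (with output `⊥`) if `C` is not a circuit or if the memory
is too short to contain a certificate. -/
def experiment (Sim A B : Prog) (n : ℕ) (b : Bool) : CQ (Bool × Val) :=
  CQ.apply
    (do
      let v ← A.run (Val.unary n) [] []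
      let C := Circuit.ofVal v.hd.hd
      let x := fitBits C.inputs v.hd.tl.toBits
      let labels ← Γ.setup n C.inputs
      let active := activeLabels labels x
      let g ← if b then simulate Sim n C.topology (C.output x) active else Γ.garble n C labels
      return (C, v.tl, active, g))
    fun r s t =>
      if r.1.Valid then
        (B.run (Val.cons (Val.unary n) (Val.cons r.2.1 (Val.cons r.2.2.2.1
          (Val.ofList (r.2.2.1.map Val.ofBits))))) s t).apply fun st' s t =>
            let c := Γ.certLen n r.1
            if c ≤ s.length ∧ c ≤ t.length then
              (Γ.vrfy n r.2.2.2.2 (s.take c) (t.take c)).traceOut.apply fun ok _ _ =>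
                CQ.ket (ok, st') (s.drop c) (t.drop c)
            else 0
      else 0

/-- Selective certified everlasting security. The unbounded adversary obtains the internal state and
outputs a bit by an arbitrary measurement; the experiment outputs `1` if the verification succeeds
and this bit is `1`. -/
def SelectiveCertEverlasting : Prop :=
  ∃ Sim : Prog, Sim.QPT ∧
    ∀ A B : Prog, A.QPT → B.QPT →
      ∀ A₂ : ℕ → Val → Matrix Bits Bits ℂ, (∀ n z, IsEffect (A₂ n z)) →
        Negligible fun n =>
          |(Γ.experiment Sim A B n false).acceptProb (A₂ n) -
            (Γ.experiment Sim A B n true).acceptProb (A₂ n)|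

end GarblingScheme

/-! ### The garbling scheme from secret key encryption -/

namespace CertSKE

variable (S : CertSKE)

def xorBits (v w : Bits) : Bits := List.zipWith xor v w

/-- A uniformly random element of the key space. -/
def randomKey (n : ℕ) : CQ Bits := List.ofFn <$> CQ.uniform (Fin (S.keyLen.eval n) → Bool)

/-- `N` independent pairs of secret keys. -/
def keyPairs (n N : ℕ) : CQ (List (Bits × Bits)) :=
  (List.range N).mapM fun _ => do
    let k₀ ← S.keyGen n
    let k₁ ← S.keyGen n
    return (k₀, k₁)

/-- The four entries of a gate. -/
def entries : List (Bool × Bool) := [(false, false), (false, true), (true, false), (true, true)]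

/-- Gate garbling with the key pairs `ka`, `kb` of the incoming wires and `kc` of the outgoing wire.
The quantum memory contains the ciphertexts `ct_a`, `ct_b` for each of the four entries, in a
uniformly random order of the entries, and the classical part contains the verification keys in the
same order. -/
def gateGarble (n : ℕ) (g : Bool → Bool → Bool) (ka kb kc : Bits × Bits) : CQ (List Bits) := do
  let γ ← CQ.uniform (Equiv.Perm (Bool × Bool))
  let vks ← entries.mapM fun e => do
    let σ := γ e
    let p ← S.randomKey n
    let vka ← S.enc n (sel ka σ.1) p
    let vkb ← S.enc n (sel kb σ.2) (xorBits p (sel kc (g σ.1 σ.2)))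
    return [vka, vkb]
  return vks.flatten

/-- Garbling. The classical part of the garbled circuit consists of the topology and of the
output tables `[(sk⁰, 0), (sk¹, 1)]`. -/
def garble (n : ℕ) (C : Circuit) (labels : List (Bits × Bits)) : CQ (Val × Val) := do
  let inner ← S.keyPairs n C.gates.length
  let keys := labels ++ inner
  let vks ← C.gates.zipIdx.mapM fun Gi =>
    S.gateGarble n Gi.1.fn (keys.getD Gi.1.inA ([], [])) (keys.getD Gi.1.inB ([], []))
      (keys.getD (C.inputs + Gi.2) ([], []))
  let tables := C.outs.map fun o =>
    let k := keys.getD o ([], [])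
    Val.ofList [Val.cons (Val.ofBits k.1) (Val.ofBool false),
      Val.cons (Val.ofBits k.2) (Val.ofBool true)]
  return (Val.cons C.topology.toVal (Val.ofList tables), Val.ofList (vks.flatten.map Val.ofBits))

/-- Decryption of `N` pairs of ciphertexts `(ct_a, ct_b)` with keys `ka`, `kb`. -/
def decryptPairs (n : ℕ) (ka kb : Bits) : ℕ → Bits → Bits → CQ (List (Option Bits × Option Bits))
  | 0, _, _ => pure []
  | N + 1, s, t => do
      let p := S.ctLen.eval n
      let qa ← S.dec n ka (s.take p) (t.take p)
      let qb ← S.dec n kb ((s.drop p).take p) ((t.drop p).take p)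
      let rest ← decryptPairs n ka kb N (s.drop (2 * p)) (t.drop (2 * p))
      return (qa, qb) :: rest

/-- Gate evaluation: the key of the outgoing wire is obtained if both decryptions succeed for exactly
one of the four entries. -/
def gateEval (n : ℕ) (ka kb s t : Bits) : CQ (Option Bits) := do
  let qs ← S.decryptPairs n ka kb 4 s t
  let found := qs.filterMap fun q => match q with
    | (some a, some b) => some (xorBits a b)
    | _ => none
  return (match found with
    | [k] => some k
    | _ => none)

/-- Evaluation of all gates in order, from the keys of the wires known so far. -/
def gatesEval (n : ℕ) : List (ℕ × ℕ) → List Bits → Bits → Bits → CQ (Option (List Bits))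
  | [], keys, s, t => if s = t then CQ.ket (some keys) [] [] else 0
  | w :: ws, keys, s, t =>
      let p := 8 * S.ctLen.eval n
      (S.gateEval n (keys.getD w.1 []) (keys.getD w.2 []) (s.take p) (t.take p)).apply fun k _ _ =>
        match k with
        | none => if s.drop p = t.drop p then CQ.ket none [] [] else 0
        | some k => gatesEval n ws (keys ++ [k]) (s.drop p) (t.drop p)

/-- Look up a key in an output table. -/
def lookup (table : Val) (k : Bits) : Option Bool :=
  (table.toList.find? fun e => e.hd.toBits == k).map fun e => e.tl.toBool

def evalGarbled (n : ℕ) (c : Val) (labels : List Bits) (s t : Bits) : CQ (Option Bits) :=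
  let T := Topology.ofVal c.hd
  (fun r => r.bind fun keys =>
      (List.zipWith (fun o table => lookup table (keys.getD o [])) T.outs c.tl.toList).mapM
        (fun y => y)) <$>
    S.gatesEval n T.wires labels s t

/-- Deletion of `N` ciphertexts; the result is the sequence of their certificates. -/
def delAll (n : ℕ) : ℕ → Bits → Bits → CQ Unit
  | 0, _, _ => pure ()
  | N + 1, s, t => do
      let p := S.ctLen.eval n
      S.del n (s.take p) (t.take p)
      delAll n N (s.drop p) (t.drop p)

/-- Verification of a sequence of certificates; all have to be valid. -/
def vrfyAll (n : ℕ) : List Bits → Bits → Bits → CQ Bool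
  | [], _, _ => pure true
  | vk :: vks, s, t => do
      let c := S.certLen.eval n
      let ok ← S.vrfy n vk (s.take c) (t.take c)
      let rest ← vrfyAll n vks (s.drop c) (t.drop c)
      return (ok && rest)

/-- The garbling scheme. A garbled circuit contains eight ciphertexts for each gate. A verification
key and a certificate that do not fit together are rejected. -/
def garblingScheme : GarblingScheme where
  certLen n C := 8 * C.gates.length * S.certLen.eval n
  setup n N := S.keyPairs n N
  garble n C labels := S.garble n C labels
  eval n c labels s t := S.evalGarbled n c labels s t
  del n c s t := S.delAll n (8 * (Topology.ofVal c.hd).wires.length) s t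
  vrfy n vk s t :=
    let vks := vk.toList.map Val.toBits
    if s.length = vks.length * S.certLen.eval n ∧ t.length = vks.length * S.certLen.eval n then
      S.vrfyAll n vks s t
    else (CQ.ket false s t).traceOut

end CertSKE

end

/-! On input `x` every wire has one active key, the key for the value that the wire takes. Rename
the two keys of each wire so that the active one has index 0. The two keys are independent and
identically distributed, so the distribution does not change (`ev_keyPairs_swap`), and a uniformly
random order of the entries absorbs the corresponding shift of the truth tables (`ev_gateGarble`).
Relative to the new names every gate maps `(0,0)` to `0`, and the active labels are the input keys
with index 0. A garbling of `C` differs from a garbling of the constant function `0` with the same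
topology only in those ciphertexts that hide a key with index 1.

The entry `(a,b)` of a gate consists of two encryptions of additive shares of an output key. The pad
is uniform, so either share may be regarded as the one that carries the key (`ev_encPair`). Let it
be the share on the first wire if `a = 1`, and the share on the second wire otherwise. If the
carried key has index 1, then `(a,b)` is not `(0,0)`, and in both cases the carrying share is
encrypted under a key with index 1.

Replace the carried keys by keys with index 0, one ciphertext at a time in the order of the gates
(`hybrid`). Suppose that the next ciphertext is encrypted under the key with index 1 of a wire `w`.
Plaintexts that contain this key belong to the gate with outgoing wire `w`, which is earlier and
already replaced. The output tables do not contain it, because an incoming wire of a gate is not an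
output wire. So the key is used for encryption only (`gap_eq`), and the step is an instance of
certified everlasting IND-CPA security with this key as the unknown one: the reduction makes the
other ciphertexts under it with the oracle, verifies all certificates except that of the challenge
itself, and passes the state of the adversary on (`redRun_eq`). The index of the ciphertext is
guessed, which costs a factor equal to a polynomial bound for the number of ciphertexts
(`acceptProb_sub`).

In the last hybrid the functions of the gates no longer matter (`hybrid_eq_of_le`). The simulator
completes the given labels to pairs and produces exactly this hybrid (`ev_simulate_keyPairs`).

All comparisons are identities between linear functionals of unnormalized states, so they hold for
every measurement of the second adversary. The rest of the work is to show that simulator and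
reduction are polynomial-time programs; deterministic functions and samplers are treated by closure
properties (`FP`, `FR`), and the quantum parts by explicit loops. -/

noncomputable section

/-! ### Linear functionals on classical-quantum states -/

namespace CQ

variable {α β γ : Type}

/-- Linear extension of a functional on the basis `|a⟩⟨a| ⊗ |s⟩⟨t|`. -/
def ev (ρ : CQ α) (φ : α → Bits → Bits → ℂ) : ℂ :=
  Finsupp.linearCombination ℂ (fun x : α × Bits × Bits => φ x.1 x.2.1 x.2.2) ρ

theorem ev_eq_sum (ρ : CQ α) (φ : α → Bits → Bits → ℂ) :
    ev ρ φ = Finsupp.sum ρ fun x c => c * φ x.1 x.2.1 x.2.2 := rfl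

theorem apply_eq (ρ : CQ α) (f : α → Bits → Bits → CQ β) :
    ρ.apply f =
      Finsupp.linearCombination ℂ (fun x : α × Bits × Bits => f x.1 x.2.1 x.2.2) ρ := rfl

@[simp] theorem ev_ket (a : α) (s t : Bits) (φ : α → Bits → Bits → ℂ) :
    ev (ket a s t) φ = φ a s t := by
  simp [ev, ket]

@[simp] theorem ev_zero (φ : α → Bits → Bits → ℂ) : ev 0 φ = 0 :=
  map_zero (Finsupp.linearCombination ℂ (fun x : α × Bits × Bits => φ x.1 x.2.1 x.2.2))

@[simp] theorem ev_add (ρ τ : CQ α) (φ : α → Bits → Bits → ℂ) :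
    ev (ρ + τ) φ = ev ρ φ + ev τ φ :=
  map_add (Finsupp.linearCombination ℂ (fun x : α × Bits × Bits => φ x.1 x.2.1 x.2.2)) ρ τ

@[simp] theorem ev_smul (c : ℂ) (ρ : CQ α) (φ : α → Bits → Bits → ℂ) :
    ev (c • ρ) φ = c * ev ρ φ :=
  map_smul (Finsupp.linearCombination ℂ (fun x : α × Bits × Bits => φ x.1 x.2.1 x.2.2)) c ρ

@[simp] theorem ev_sum {ι : Type*} (u : Finset ι) (f : ι → CQ α) (φ : α → Bits → Bits → ℂ) :
    ev (∑ i ∈ u, f i) φ = ∑ i ∈ u, ev (f i) φ :=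
  map_sum (Finsupp.linearCombination ℂ (fun x : α × Bits × Bits => φ x.1 x.2.1 x.2.2)) f u

@[simp] theorem ev_listSum (l : List (CQ α)) (φ : α → Bits → Bits → ℂ) :
    ev l.sum φ = (l.map fun ρ => ev ρ φ).sum := by
  induction l <;> simp_all

theorem induction {P : CQ α → Prop} (ρ : CQ α) (h0 : P 0)
    (hadd : ∀ (c : ℂ) (a : α) (s t : Bits) (τ : CQ α), P τ → P (c • ket a s t + τ)) : P ρ := by
  refine Finsupp.induction (motive := P) ρ h0 fun x c f _ _ hf => ?_
  have : (c • ket x.1 x.2.1 x.2.2 : CQ α) = Finsupp.single x c := by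
    simp [ket]
    erw [Finsupp.smul_single]; simp only [smul_eq_mul, mul_one]; rfl
  have h := hadd c x.1 x.2.1 x.2.2 f hf
  rw [this] at h
  exact h

@[simp] theorem zero_apply (f : α → Bits → Bits → CQ β) : (0 : CQ α).apply f = 0 :=
  map_zero (Finsupp.linearCombination ℂ (fun x : α × Bits × Bits => f x.1 x.2.1 x.2.2))

@[simp] theorem add_apply (ρ τ : CQ α) (f : α → Bits → Bits → CQ β) :
    (ρ + τ).apply f = ρ.apply f + τ.apply f :=
  map_add (Finsupp.linearCombination ℂ (fun x : α × Bits × Bits => f x.1 x.2.1 x.2.2)) ρ τ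

@[simp] theorem smul_apply (c : ℂ) (ρ : CQ α) (f : α → Bits → Bits → CQ β) :
    (c • ρ).apply f = c • ρ.apply f :=
  map_smul (Finsupp.linearCombination ℂ (fun x : α × Bits × Bits => f x.1 x.2.1 x.2.2)) c ρ

@[simp] theorem ket_apply (a : α) (s t : Bits) (f : α → Bits → Bits → CQ β) :
    (ket a s t).apply f = f a s t := by
  rw [apply_eq, ket]
  erw [Finsupp.linearCombination_single]
  simp

@[simp] theorem ev_apply (ρ : CQ α) (f : α → Bits → Bits → CQ β) (φ : β → Bits → Bits → ℂ) :
    ev (ρ.apply f) φ = ev ρ fun a s t => ev (f a s t) φ := by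
  induction ρ using induction with
  | h0 => simp
  | hadd c a s t τ h => simp [h]

/-- States are determined by the linear functionals. -/
theorem ext_ev {ρ τ : CQ α} (h : ∀ φ, ev ρ φ = ev τ φ) : ρ = τ := by
  classical
  refine Finsupp.ext fun x => ?_
  have := h fun a s t => if (a, s, t) = x then 1 else 0
  have key : ∀ ρ : CQ α, ev ρ (fun a s t => if (a, s, t) = x then 1 else 0)
      = DFunLike.coe (F := (α × Bits × Bits) →₀ ℂ) ρ x := by
    intro ρ
    rw [ev_eq_sum]
    simp [Finsupp.sum]
    exact fun h => (Finsupp.notMem_support_iff.1 h).symm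
  rw [key, key] at this
  exact this

@[simp] theorem ev_appendTo (s t : Bits) (τ : CQ α) (φ : α → Bits → Bits → ℂ) :
    ev (appendTo s t τ) φ = ev τ fun a s' t' => φ a (s ++ s') (t ++ t') := by
  simp [appendTo]

@[simp] theorem ev_pure (a : α) (φ : α → Bits → Bits → ℂ) :
    ev (pure a : CQ α) φ = φ a [] [] := ev_ket a [] [] φ

@[simp] theorem ev_bind (ρ : CQ α) (f : α → CQ β) (φ : β → Bits → Bits → ℂ) :
    ev (ρ >>= f) φ =
      ev ρ fun a s t => ev (f a) fun b s' t' => φ b (s ++ s') (t ++ t') := by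
  show ev (ρ.apply fun a s t => appendTo s t (f a)) φ = _
  simp

@[simp] theorem ev_map (ρ : CQ α) (f : α → β) (φ : β → Bits → Bits → ℂ) :
    ev (f <$> ρ) φ = ev ρ fun a s t => φ (f a) s t := by
  show ev (ρ >>= fun a => pure (f a)) φ = _
  simp

/-- Preparations are appended to the memory, so the monad laws reduce to the monoid laws for
concatenation of bit strings. They make the general facts on `mapM` available. -/
instance : LawfulMonad CQ := LawfulMonad.mk' CQ
  (id_map := fun x => ext_ev fun φ => by simp)
  (pure_bind := fun x f => ext_ev fun φ => by simp)
  (bind_assoc := fun x f g => ext_ev fun φ => by simp)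
  (bind_pure_comp := fun f x => ext_ev fun φ => by simp)

@[simp] theorem ev_traceOut (ρ : CQ α) (φ : α → Bits → Bits → ℂ) :
    ev ρ.traceOut φ = ev ρ fun a s t => if s = t then φ a [] [] else 0 := by
  simp only [traceOut, ev_apply]
  congr 1; funext a s t; split <;> simp

theorem ev_uniform [Fintype α] (φ : α → Bits → Bits → ℂ) :
    ev (uniform α) φ = (Fintype.card α : ℂ)⁻¹ * ∑ a, φ a [] [] := by
  simp [uniform, Finset.mul_sum]

/-- Both sides are the same finite double sum. This is what allows independent choices to be made in
any order; the positions of qubits are taken care of by the functional. -/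
theorem ev_comm (ρ : CQ α) (τ : CQ β) (φ : α → Bits → Bits → β → Bits → Bits → ℂ) :
    (ev ρ fun a s t => ev τ fun b s' t' => φ a s t b s' t') =
      ev τ fun b s' t' => ev ρ fun a s t => φ a s t b s' t' := by
  simp only [ev_eq_sum, Finsupp.sum, Finset.mul_sum]
  rw [Finset.sum_comm]
  refine Finset.sum_congr rfl fun _ _ => Finset.sum_congr rfl fun _ _ => by ring

theorem ev_mul_left (c : ℂ) (ρ : CQ α) (φ : α → Bits → Bits → ℂ) :
    (ev ρ fun a s t => c * φ a s t) = c * ev ρ φ := by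
  simp only [ev_eq_sum, Finsupp.sum, Finset.mul_sum]
  exact Finset.sum_congr rfl fun _ _ => by ring

theorem ev_mul_right (c : ℂ) (ρ : CQ α) (φ : α → Bits → Bits → ℂ) :
    (ev ρ fun a s t => φ a s t * c) = ev ρ φ * c := by
  simp only [mul_comm _ c, ev_mul_left]

theorem ev_fun_sub (ρ : CQ α) (φ ψ : α → Bits → Bits → ℂ) :
    (ev ρ fun a s t => φ a s t - ψ a s t) = ev ρ φ - ev ρ ψ := by
  simp only [ev_eq_sum, Finsupp.sum, mul_sub, Finset.sum_sub_distrib]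

theorem ev_fun_zero (ρ : CQ α) : (ev ρ fun _ _ _ => 0) = 0 := by
  simp [ev_eq_sum, Finsupp.sum]

theorem ev_fun_sum {ι : Type*} (u : Finset ι) (ρ : CQ α) (φ : ι → α → Bits → Bits → ℂ) :
    (ev ρ fun a s t => ∑ i ∈ u, φ i a s t) = ∑ i ∈ u, ev ρ (φ i) := by
  simp only [ev_eq_sum, Finsupp.sum, Finset.mul_sum]
  exact Finset.sum_comm

theorem acceptProb_eq (ρ : CQ (Bool × α)) (E : α → Matrix Bits Bits ℂ) :
    ρ.acceptProb E = (ev ρ fun x s t => if x.1 then E x.2 t s else 0).re := by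
  simp only [acceptProb, ev_eq_sum, mul_ite, mul_zero]

/-! ### Support -/

/-- All basis elements that occur in a state have the property `Q`. -/
def Supp (ρ : CQ α) (Q : α → Bits → Bits → Prop) : Prop :=
  ∀ x ∈ Finsupp.support ρ, Q x.1 x.2.1 x.2.2

/-- The coefficients are complex numbers, and cancellations occur, so "almost surely" is replaced by
a condition on all basis elements that occur. Facts on lengths of keys and registers enter through
this lemma. -/
theorem ev_congr {ρ : CQ α} {Q : α → Bits → Bits → Prop} (h : Supp ρ Q)
    {φ ψ : α → Bits → Bits → ℂ} (hφ : ∀ a s t, Q a s t → φ a s t = ψ a s t) :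
    ev ρ φ = ev ρ ψ :=
  Finset.sum_congr rfl fun x hx => by
    simp only [hφ _ _ _ (h x hx)]

theorem ev_fun_congr {ρ : CQ α} {φ ψ : α → Bits → Bits → ℂ}
    (h : ∀ a s t, φ a s t = ψ a s t) : ev ρ φ = ev ρ ψ := by
  rw [show φ = ψ from funext fun a => funext fun s => funext fun t => h a s t]

/-- Testing with the indicator of a single basis element recovers its coefficient. Closure
properties of `Supp` can thus be read off from the rules for `ev`. -/
theorem supp_of_ev {ρ : CQ α} {Q : α → Bits → Bits → Prop}
    (h : ∀ φ : α → Bits → Bits → ℂ, (∀ a s t, Q a s t → φ a s t = 0) → ev ρ φ = 0) :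
    Supp ρ Q := by
  classical
  intro x hx
  by_contra hQ
  have := h (fun a s t => if (a, s, t) = x then 1 else 0) (by
    intro a s t hq
    rw [if_neg]
    rintro rfl
    exact hQ hq)
  simp [ev_eq_sum, Finsupp.sum] at this
  exact (Finsupp.mem_support_iff.1 hx) (this hx)

theorem Supp.mono {ρ : CQ α} {Q R : α → Bits → Bits → Prop} (h : Supp ρ Q)
    (hQ : ∀ a s t, Q a s t → R a s t) : Supp ρ R := fun x hx => hQ _ _ _ (h x hx)

theorem Supp.ev_eq_zero {ρ : CQ α} {Q : α → Bits → Bits → Prop} (h : Supp ρ Q)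
    {φ : α → Bits → Bits → ℂ} (hφ : ∀ a s t, Q a s t → φ a s t = 0) : ev ρ φ = 0 := by
  rw [ev_congr h hφ, ev_fun_zero]

theorem supp_ket {Q : α → Bits → Bits → Prop} {a : α} {s t : Bits} (h : Q a s t) :
    Supp (ket a s t) Q := supp_of_ev fun φ hφ => by simp [hφ _ _ _ h]

theorem supp_pure {Q : α → Bits → Bits → Prop} {a : α} (h : Q a [] []) :
    Supp (pure a : CQ α) Q := supp_ket h

theorem supp_zero {Q : α → Bits → Bits → Prop} : Supp (0 : CQ α) Q :=
  supp_of_ev fun φ _ => by simp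

theorem supp_sum {ι : Type*} {u : Finset ι} {f : ι → CQ α} {Q : α → Bits → Bits → Prop}
    (h : ∀ i ∈ u, Supp (f i) Q) : Supp (∑ i ∈ u, f i) Q :=
  supp_of_ev fun φ hφ => by
    rw [ev_sum]; exact Finset.sum_eq_zero fun i hi => (h i hi).ev_eq_zero hφ

theorem supp_smul {c : ℂ} {ρ : CQ α} {Q : α → Bits → Bits → Prop} (h : Supp ρ Q) :
    Supp (c • ρ) Q :=
  supp_of_ev fun φ hφ => by rw [ev_smul, h.ev_eq_zero hφ, mul_zero]

theorem supp_listSum {l : List (CQ α)} {Q : α → Bits → Bits → Prop}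
    (h : ∀ ρ ∈ l, Supp ρ Q) : Supp l.sum Q :=
  supp_of_ev fun φ hφ => by
    rw [ev_listSum]
    refine List.sum_eq_zero fun x hx => ?_
    obtain ⟨ρ, hρ, rfl⟩ := List.mem_map.1 hx
    exact (h ρ hρ).ev_eq_zero hφ

theorem supp_apply {ρ : CQ α} {f : α → Bits → Bits → CQ β} {Q : α → Bits → Bits → Prop}
    {R : β → Bits → Bits → Prop} (h : Supp ρ Q) (hf : ∀ a s t, Q a s t → Supp (f a s t) R) :
    Supp (ρ.apply f) R :=
  supp_of_ev fun φ hφ => by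
    rw [ev_apply]; exact h.ev_eq_zero fun a s t hq => (hf a s t hq).ev_eq_zero hφ

theorem supp_appendTo {s t : Bits} {τ : CQ α} {Q : α → Bits → Bits → Prop}
    (h : Supp τ fun a s' t' => Q a (s ++ s') (t ++ t')) : Supp (appendTo s t τ) Q :=
  supp_of_ev fun φ hφ => by
    rw [ev_appendTo]; exact h.ev_eq_zero fun a s' t' hq => hφ _ _ _ hq

theorem supp_bind {ρ : CQ α} {f : α → CQ β} {Q : α → Bits → Bits → Prop}
    {R : β → Bits → Bits → Prop} (h : Supp ρ Q)
    (hf : ∀ a s t, Q a s t → Supp (f a) fun b s' t' => R b (s ++ s') (t ++ t')) :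
    Supp (ρ >>= f) R :=
  supp_of_ev fun φ hφ => by
    rw [ev_bind]
    exact h.ev_eq_zero fun a s t hq => (hf a s t hq).ev_eq_zero fun _ _ _ h => hφ _ _ _ h

theorem supp_map {ρ : CQ α} {f : α → β} {R : β → Bits → Bits → Prop}
    (h : Supp ρ fun a s t => R (f a) s t) : Supp (f <$> ρ) R :=
  supp_of_ev fun φ hφ => by
    rw [ev_map]; exact h.ev_eq_zero fun a s t hq => hφ _ _ _ hq

theorem supp_traceOut {ρ : CQ α} {Q : α → Bits → Bits → Prop}
    (h : Supp ρ fun a s t => s = t → Q a [] []) : Supp ρ.traceOut Q :=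
  supp_of_ev fun φ hφ => by
    rw [ev_traceOut]
    refine h.ev_eq_zero fun a s t hq => ?_
    split
    · exact hφ _ _ _ (hq ‹_›)
    · rfl

theorem supp_true (ρ : CQ α) : Supp ρ fun _ _ _ => True := fun _ _ => trivial

/-- States without quantum memory, that is, distributions. -/
def Memoryless (ρ : CQ α) : Prop := Supp ρ fun _ s t => s = [] ∧ t = []

theorem Memoryless.ev {ρ : CQ α} (h : Memoryless ρ) (φ : α → Bits → Bits → ℂ) :
    ρ.ev φ = ρ.ev fun a _ _ => φ a [] [] :=
  ev_congr h fun a s t hst => by rw [hst.1, hst.2]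

theorem Memoryless.ev_congr {ρ : CQ α} (h : Memoryless ρ) {φ ψ : α → Bits → Bits → ℂ}
    (hφ : ∀ a, φ a [] [] = ψ a [] []) : ρ.ev φ = ρ.ev ψ :=
  CQ.ev_congr h fun a s t hst => by rw [hst.1, hst.2]; exact hφ a

theorem memoryless_pure (a : α) : Memoryless (pure a : CQ α) := supp_pure ⟨rfl, rfl⟩

theorem Memoryless.bind {ρ : CQ α} {f : α → CQ β} (h : Memoryless ρ)
    (hf : ∀ a, Memoryless (f a)) : Memoryless (ρ >>= f) :=
  supp_bind h fun a s t hst => (hf a).mono fun b s' t' h' => by simp [hst, h']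

theorem Memoryless.map {ρ : CQ α} (h : Memoryless ρ) (f : α → β) : Memoryless (f <$> ρ) :=
  supp_map h

theorem memoryless_uniform [Fintype α] : Memoryless (uniform α) :=
  supp_sum fun _ _ => supp_smul (supp_ket ⟨rfl, rfl⟩)

theorem memoryless_traceOut (ρ : CQ α) : Memoryless ρ.traceOut :=
  supp_traceOut fun _ _ _ => ⟨rfl, rfl⟩

theorem ev_mapM_nil (f : α → CQ β) (φ : List β → Bits → Bits → ℂ) :
    ev (([] : List α).mapM f) φ = φ [] [] [] := by
  simp

theorem ev_mapM_cons (f : α → CQ β) (a : α) (l : List α) (φ : List β → Bits → Bits → ℂ) :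
    ev ((a :: l).mapM f) φ =
      ev (f a) fun b s t => ev (l.mapM f) fun bs s' t' => φ (b :: bs) (s ++ s') (t ++ t') := by
  simp

theorem ev_mapM_append (f : α → CQ β) (l l' : List α) (φ : List β → Bits → Bits → ℂ) :
    ev ((l ++ l').mapM f) φ =
      ev (l.mapM f) fun bs s t => ev (l'.mapM f) fun bs' s' t' =>
        φ (bs ++ bs') (s ++ s') (t ++ t') := by
  simp

theorem memoryless_mapM {f : α → CQ β} (hf : ∀ a, Memoryless (f a)) (l : List α) :
    Memoryless (l.mapM f) := by
  induction l with
  | nil => simpa using memoryless_pure _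
  | cons a l ih =>
    rw [List.mapM_cons]
    exact (hf a).bind fun b => ih.bind fun bs => memoryless_pure _

/-- Elementwise property of the results of `mapM`. -/
theorem supp_mapM {f : α → CQ β} {Q : β → Prop} {l : List α}
    (hf : ∀ a ∈ l, Supp (f a) fun b _ _ => Q b) :
    Supp (l.mapM f) fun bs _ _ => bs.length = l.length ∧ ∀ b ∈ bs, Q b := by
  induction l with
  | nil => simpa using supp_pure (by simp)
  | cons a l ih =>
    rw [List.mapM_cons]
    refine supp_bind (hf a (by simp)) fun b s t hb =>
      supp_bind (ih fun x hx => hf x (by simp [hx])) fun bs s' t' hbs => supp_pure ?_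
    simp only [List.length_cons, hbs.1, List.mem_cons, forall_eq_or_imp]
    exact ⟨trivial, hb, hbs.2⟩

/-- A list of computations that are each a random choice of a list of tasks followed by running `e`
on these tasks. -/
theorem ev_mapM_flatten {f : α → CQ (List β)} {g : α → CQ (List γ)} {e : γ → CQ β}
    {l : List α} (hg : ∀ a ∈ l, Memoryless (g a))
    (hf : ∀ a ∈ l, ∀ φ, ev (f a) φ = ev (g a) fun c _ _ => ev (c.mapM e) φ)
    (φ : List β → Bits → Bits → ℂ) :
    (ev (l.mapM f) fun bs => φ bs.flatten) =
      ev (l.mapM g) fun cs _ _ => ev (cs.flatten.mapM e) φ := by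
  induction l generalizing φ with
  | nil => simp
  | cons a l ih =>
    rw [ev_mapM_cons, ev_mapM_cons, hf a (by simp)]
    rw [(hg a (by simp)).ev, (hg a (by simp)).ev]
    refine ev_fun_congr fun c _ _ => ?_
    simp only [List.flatten_cons, ev_mapM_append]
    refine (ev_fun_congr fun bs s t => ?_).trans (ev_comm _ _ _)
    exact ih (fun x hx => hg x (by simp [hx])) (fun x hx => hf x (by simp [hx]))
      fun bs' s' t' => φ (bs ++ bs') (s ++ s') (t ++ t')

end CQ

/-! ### Elementary facts on trees -/

namespace Val

@[simp] theorem hd_cons (a b : Val) : (cons a b).hd = a := rfl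

@[simp] theorem tl_cons (a b : Val) : (cons a b).tl = b := rfl

@[simp] theorem hd_nil : nil.hd = nil := rfl

@[simp] theorem tl_nil : nil.tl = nil := rfl

@[simp] theorem toList_cons (a b : Val) : (cons a b).toList = a :: b.toList := rfl

@[simp] theorem toList_nil : nil.toList = [] := rfl

theorem one_le_size (v : Val) : 1 ≤ v.size := by cases v <;> simp only [size] <;> omega

theorem size_hd_le (v : Val) : v.hd.size ≤ v.size := by cases v <;> simp only [size, hd] <;> omega

theorem size_tl_le (v : Val) : v.tl.size ≤ v.size := by cases v <;> simp [size, tl]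

theorem size_le_of_mem {x v : Val} (h : x ∈ v.toList) : x.size ≤ v.size := by
  induction v with
  | nil => simp [toList] at h
  | cons a b _ ihb =>
    rcases List.mem_cons.1 h with rfl | h
    · simp [size]; omega
    · have := ihb h; simp [size]; omega

@[simp] theorem toBool_nil : nil.toBool = false := rfl

@[simp] theorem toList_ofList (l : List Val) : (ofList l).toList = l := by
  induction l <;> simp_all [ofList]

@[simp] theorem ofList_toList (v : Val) : ofList v.toList = v := by
  induction v <;> simp_all [ofList, toList]

end Val

/-! ### Outcomes, memory size and trace preservation of programs -/

namespace Prog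

open CQ

variable {O : Val → CQ Val}

theorem den_fold_nil (p : Prog) {v : Val} (s t : Bits) (h : v.hd.toList = []) :
    (fold p).den O v s t = ket v.tl s t := by
  simp [den, h]

/-- A composition of linear maps is determined by its values on basis states; this allows the first
iteration of a loop to be split off. -/
theorem foldl_apply (f : Val → Val → Bits → Bits → CQ Val) (l : List Val) (ρ : CQ Val) :
    l.foldl (fun ρ x => ρ.apply (f x)) ρ =
      ρ.apply fun u s t => l.foldl (fun ρ x => ρ.apply (f x)) (ket u s t) := by
  refine ext_ev fun φ => ?_
  induction l generalizing ρ φ with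
  | nil => simp
  | cons x l ih =>
    simp only [List.foldl_cons, ket_apply, ev_apply]
    rw [ih, ev_apply, ev_apply]
    refine ev_fun_congr fun u s t => ?_
    rw [ih, ev_apply]

theorem den_fold_cons (p : Prog) (x l u : Val) (s t : Bits) :
    (fold p).den O (Val.cons (Val.cons x l) u) s t =
      (p.den O (Val.cons x u) s t).apply fun u' s' t' => (fold p).den O (Val.cons l u') s' t' := by
  simp only [den, Val.hd, Val.tl, Val.toList, List.foldl_cons, ket_apply]
  exact foldl_apply (fun x u => p.den O (Val.cons x u)) _ _

theorem den_fold_eq (p : Prog) (v : Val) (s t : Bits) :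
    (fold p).den O v s t = (fold p).den O (Val.cons v.hd v.tl) s t := by
  cases v <;> rfl

/-- Outcomes and costs of a loop over a list. -/
def foldTraces (L : ℕ) (p : Prog) : List Val → Val → Set (Val × ℕ)
  | [], u => {(u, 0)}
  | x :: l, u => {z | ∃ y ∈ p.traces L (Val.cons x u), ∃ w ∈ foldTraces L p l y.1,
      z = (w.1, y.2 + w.2)}

theorem traces_fold (L : ℕ) (p : Prog) (v : Val) :
    (fold p).traces L v =
      {z | ∃ w ∈ foldTraces L p v.hd.toList v.tl, z = (w.1, w.2 + (v.size + 2))} := by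
  have key : ∀ (l : List Val) (T : Set (Val × ℕ)),
      l.foldl (fun T x => {z | ∃ u ∈ T, ∃ w ∈ p.traces L (Val.cons x u.1),
        z = (w.1, u.2 + w.2)}) T =
      {z | ∃ u ∈ T, ∃ w ∈ foldTraces L p l u.1, z = (w.1, u.2 + w.2)} := by
    intro l
    induction l with
    | nil => intro T; ext z; simp [foldTraces]
    | cons x l ih =>
      intro T
      rw [List.foldl_cons, ih]
      ext z
      simp only [foldTraces, Set.mem_ofPred_eq]
      constructor
      · rintro ⟨_, ⟨u, hu, w, hw, rfl⟩, w', hw', rfl⟩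
        exact ⟨u, hu, _, ⟨w, hw, w', hw', rfl⟩, by simp [add_assoc]⟩
      · rintro ⟨u, hu, _, ⟨w, hw, w', hw', rfl⟩, rfl⟩
        exact ⟨_, ⟨u, hu, w, hw, rfl⟩, w', hw', by simp [add_assoc]⟩
  simp only [traces]
  rw [key]
  ext z
  simp only [Set.mem_singleton_iff, Set.mem_ofPred_eq, exists_eq_left]
  constructor <;> rintro ⟨w, hw, rfl⟩ <;> exact ⟨w, hw, by simp [add_comm]⟩

/-- Every elementary step is charged at least for the size of its result. Hence bounds for the
running time are at the same time bounds for the size of all intermediate values. -/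
theorem size_le_cost {L : ℕ} (p : Prog) {v : Val} {z : Val × ℕ} (h : z ∈ p.traces L v) :
    z.1.size ≤ z.2 := by
  induction p generalizing v z with
  | skip | new | gateH | gateT | gateCNOT | discard | move => 
    simp only [traces, Set.mem_singleton_iff] at h; subst h; simp
  | nil => simp only [traces, Set.mem_singleton_iff] at h; subst h; simp [Val.size]
  | hd => 
    simp only [traces, Set.mem_singleton_iff] at h; subst h; have := v.size_hd_le; simp; omega
  | tl => 
    simp only [traces, Set.mem_singleton_iff] at h; subst h; have := v.size_tl_le; simp; omega
  | seq p q ihp ihq =>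
    obtain ⟨x, hx, y, hy, rfl⟩ := h
    have := ihq hy; simp; omega
  | pair p q ihp ihq =>
    obtain ⟨x, hx, y, hy, rfl⟩ := h
    have := ihp hx; have := ihq hy; simp [Val.size]; omega
  | cond p q ihp ihq =>
    obtain ⟨x, hx, rfl⟩ := h
    split at hx
    · have := ihq hx; simp; omega
    · have := ihp hx; simp; omega
  | frame p ih =>
    obtain ⟨x, hx, rfl⟩ := h
    have := ih hx; simp; omega
  | rand =>
    obtain ⟨h1, h2⟩ := h
    rw [h2]
    rcases h1 with ⟨_, h1⟩ | h1
    · rw [h1]; simp [Val.size]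
    · have := Val.size_le_of_mem h1; omega
  | meas =>
    obtain ⟨⟨b, h1⟩, h2⟩ := h
    rw [h1, h2]
    -- The outcome 1 has size 3, which the charge `v.size + 2` covers even for an empty input.
    have := v.one_le_size
    cases b <;> simp only [Val.ofBool, Val.size] <;> omega
  | query =>
    obtain ⟨h1, h2⟩ := h
    omega
  | fold p ih =>
    rw [traces_fold] at h
    obtain ⟨w, hw, rfl⟩ := h
    have key : ∀ (l : List Val) (u : Val) (w : Val × ℕ), w ∈ foldTraces L p l u →
        w.1.size ≤ w.2 + u.size := by
      intro l
      induction l with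
      | nil => intro u w hw; simp only [foldTraces, Set.mem_singleton_iff] at hw; simp [hw]
      | cons x l ihl =>
        rintro u w ⟨y, hy, w', hw', rfl⟩
        have := ihl _ _ hw'; have := ih hy; simp; omega
    have := key _ _ _ hw
    have := v.size_tl_le
    simp; omega

theorem den_congr_oracle {p : Prog} (hp : p.QueryFree) (O O' : Val → CQ Val) :
    p.den O = p.den O' := by
  induction p with
  | query => exact hp.elim
  | seq p q ihp ihq | pair p q ihp ihq | cond p q ihp ihq => 
    funext v s t; simp [den, ihp hp.1, ihq hp.2]
  | fold p ih | frame p ih => funext v s t; simp [den, ih hp]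
  | _ => rfl

theorem run_eq_den {p : Prog} (hp : p.QueryFree) (O : Val → CQ Val) : p.run = p.den O :=
  den_congr_oracle hp _ _

theorem length_flipIf (i j : ℕ) (s : Bits) : (flipIf i j s).length = s.length := by
  unfold flipIf
  split
  · split <;> simp
  · rfl

theorem length_moveIdx (i : ℕ) (s : Bits) :
    (s.eraseIdx i).length + s[i]?.toList.length = s.length := by
  by_cases h : i < s.length
  · simp [List.length_eraseIdx, h]; omega
  · simp [List.length_eraseIdx, h]

theorem supp_applyGate {U : Bool → Bool → ℂ} {i : ℕ} {v : Val} {s t : Bits}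
    (hst : s.length = t.length) :
    Supp (applyGate U i v s t) fun u s' t' =>
      u = v ∧ s'.length = t'.length ∧ s'.length = s.length := by
  unfold applyGate
  split
  · exact supp_sum fun _ _ => supp_sum fun _ _ => supp_smul (supp_ket (by simp [hst]))
  · exact supp_ket (by simp [hst])

/-- The outcomes of a program without queries are among its traces, and each step adds at most one
qubit to the memory. -/
theorem supp_den {p : Prog} (hp : p.QueryFree) (L : ℕ) (v : Val) {s t : Bits}
    (hst : s.length = t.length) :
    Supp (p.den O v s t) fun u s' t' => s'.length = t'.length ∧
      ∃ k, (u, k) ∈ p.traces L v ∧ s'.length ≤ s.length + k := by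
  induction p generalizing v s t with
  | query => exact hp.elim
  | skip | nil | hd | tl => exact supp_ket ⟨hst, _, rfl, by simp⟩
  | gateCNOT =>
    exact supp_ket ⟨by simp [length_flipIf, hst], _, rfl, by simp [length_flipIf]⟩
  | new => exact supp_ket ⟨by simp [hst], _, rfl, by simp⟩
  | gateH | gateT => 
    exact (supp_applyGate hst).mono fun u _ _ h =>
      ⟨h.2.1, v.size + 2, by rw [h.1]; rfl, by omega⟩
  | meas =>
    simp only [den]
    split
    · split
      · exact supp_ket ⟨hst, _, ⟨⟨_, rfl⟩, rfl⟩, by simp⟩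
      · exact supp_zero
    · exact supp_ket ⟨hst, _, ⟨⟨false, rfl⟩, rfl⟩, by simp⟩
  | discard => 
    simp only [den]
    split
    · split
      · exact supp_ket ⟨by simp [List.length_eraseIdx, hst], _, rfl,
          by have := List.length_eraseIdx_le s v.toNat; simp; omega⟩
      · exact supp_zero
    · exact supp_ket ⟨hst, _, rfl, by simp⟩
  | move =>
    refine supp_ket ⟨by simp [length_moveIdx, hst], _, rfl, by simp [length_moveIdx]⟩
  | rand =>
    simp only [den]
    split
    · exact supp_ket ⟨hst, _, ⟨Or.inl ⟨‹_›, rfl⟩, rfl⟩, by simp⟩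
    · refine supp_listSum fun ρ hρ => ?_
      obtain ⟨x, hx, rfl⟩ := List.mem_map.1 hρ
      exact supp_smul (supp_ket ⟨hst, _, ⟨Or.inr hx, rfl⟩, by simp⟩)
  | seq p q ihp ihq =>
    refine supp_apply (ihp hp.1 v hst) fun a s' t' ⟨h1, k, h2, h3⟩ =>
      (ihq hp.2 a h1).mono fun b s'' t'' ⟨h4, k', h5, h6⟩ => ⟨h4, _, ⟨_, h2, _, h5, rfl⟩, ?_⟩
    simp; omega
  | pair p q ihp ihq =>
    refine supp_apply (ihp hp.1 v hst) fun a s' t' ⟨h1, k, h2, h3⟩ =>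
      supp_apply (ihq hp.2 v h1) fun b s'' t'' ⟨h4, k', h5, h6⟩ =>
        supp_ket ⟨h4, _, ⟨_, h2, _, h5, rfl⟩, ?_⟩
    simp; omega
  | cond p q ihp ihq =>
    simp only [den]
    split
    · exact (ihq hp.2 _ hst).mono fun a s' t' ⟨h1, k, h2, h3⟩ =>
        ⟨h1, _, ⟨_, by rwa [if_pos ‹_›], rfl⟩, by simp; omega⟩
    · exact (ihp hp.1 _ hst).mono fun a s' t' ⟨h1, k, h2, h3⟩ =>
        ⟨h1, _, ⟨_, by rwa [if_neg ‹_›], rfl⟩, by simp; omega⟩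
  | frame p ih =>
    refine supp_appendTo ((ih hp v.tl (by simp [hst])).mono fun a s' t' ⟨h1, k, h2, h3⟩ =>
        ⟨by simp [h1, hst], _, ⟨_, h2, rfl⟩, ?_⟩)
    simp at h3 ⊢; omega
  | fold p ih =>
    have key : ∀ (l u : Val) (s t : Bits), s.length = t.length →
        Supp ((fold p).den O (Val.cons l u) s t) fun u' s' t' => s'.length = t'.length ∧
          ∃ k, (u', k) ∈ foldTraces L p l.toList u ∧ s'.length ≤ s.length + k := by
      intro l
      induction l with
      | nil =>
        intro u s t hst
        rw [den_fold_nil _ _ _ rfl]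
        exact supp_ket ⟨hst, 0, rfl, by simp⟩
      | cons x l _ ihl =>
        intro u s t hst
        rw [den_fold_cons]
        refine supp_apply (ih hp _ hst) fun a s' t' ⟨h1, k, h2, h3⟩ =>
          (ihl a s' t' h1).mono fun b s'' t'' ⟨h4, k', h5, h6⟩ =>
            ⟨h4, _, ⟨_, h2, _, h5, rfl⟩, ?_⟩
        simp; omega
    rw [den_fold_eq, traces_fold]
    exact (key _ _ _ _ hst).mono fun a s' t' ⟨h1, k, h2, h3⟩ =>
      ⟨h1, _, ⟨_, h2, rfl⟩, by simp; omega⟩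

/-- Separates equality of two basis states into a condition on the qubit `i` and a condition on the
other qubits, so that the trace factorizes when a gate acts on the qubit `i`. -/
theorem set_injective_of_getElem? {s t : Bits} {i : ℕ} {x y : Bool} (hs : s[i]? = some x)
    (ht : t[i]? = some y) (a b : Bool) :
    s.set i a = t.set i b ↔ a = b ∧ s.set i false = t.set i false := by
  constructor
  · intro h
    have h1 := congrArg (·[i]?) h
    obtain ⟨h2, _⟩ := List.getElem?_eq_some_iff.1 hs
    obtain ⟨h3, _⟩ := List.getElem?_eq_some_iff.1 ht
    simp [h2, h3] at h1
    have h4 := congrArg (·.set i false) h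
    simp at h4
    exact ⟨h1, h4⟩
  · rintro ⟨rfl, h⟩
    have := congrArg (·.set i a) h
    simpa using this

theorem eq_iff_set {s t : Bits} {i : ℕ} {x y : Bool} (hs : s[i]? = some x)
    (ht : t[i]? = some y) : s = t ↔ x = y ∧ s.set i false = t.set i false := by
  rw [← set_injective_of_getElem? hs ht]
  obtain ⟨h2, h2'⟩ := List.getElem?_eq_some_iff.1 hs
  obtain ⟨h3, h3'⟩ := List.getElem?_eq_some_iff.1 ht
  subst h2' h3'
  simp

/-- The other qubits contribute the same condition on both sides, and what remains for the qubit `i`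
is the orthonormality of the columns of `U`. -/
theorem ev_applyGate_trace {U : Bool → Bool → ℂ}
    (hU : ∀ x y, ∑ a, U a x * star (U a y) = if x = y then 1 else 0) (i : ℕ) (v : Val)
    (s t : Bits) :
    ev (applyGate U i v s t) (fun _ s t => if s = t then 1 else 0) = if s = t then 1 else 0 := by
  unfold applyGate
  split
  next x y hs ht =>
    have hU' := hU x y
    obtain ⟨Q, hQ, hQ'⟩ : ∃ Q : Prop, (∀ a b, s.set i a = t.set i b ↔ a = b ∧ Q) ∧
        (s = t ↔ x = y ∧ Q) := ⟨_, set_injective_of_getElem? hs ht, eq_iff_set hs ht⟩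
    have h1 (a b : Bool) : (if s.set i a = t.set i b then (1 : ℂ) else 0) =
        open Classical in if a = b ∧ Q then 1 else 0 := by simp only [← hQ]
    have h2 : (if s = t then (1 : ℂ) else 0) =
        open Classical in if x = y ∧ Q then 1 else 0 := by simp only [← hQ']
    simp only [ev_sum, ev_smul, ev_ket]
    simp only [Fintype.sum_bool] at hU' ⊢
    erw [h1, h1, h1, h1, h2]
    by_cases h : Q
    · simpa [h] using hU'
    · simp [h]
  · simp

theorem hadamard_unitary (x y : Bool) :
    ∑ a, hadamard a x * star (hadamard a y) = if x = y then 1 else 0 := by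
  have h : ((Real.sqrt 2 : ℝ) : ℂ) * (Real.sqrt 2 : ℝ) = 2 := by
    rw [← Complex.ofReal_mul, Real.mul_self_sqrt (by norm_num)]; simp
  have h0 : ((Real.sqrt 2 : ℝ) : ℂ) ≠ 0 := by simp
  cases x <;> cases y <;>
    simp only [hadamard, Fintype.sum_bool, Bool.and_true, Bool.and_false, Complex.star_def,
      Complex.conj_ofReal, map_div₀, map_one, map_neg, if_true, if_false, div_mul_div_comm, h,
      Bool.false_eq_true, reduceCtorEq] <;> norm_num

theorem tGate_unitary (x y : Bool) :
    ∑ a, tGate a x * star (tGate a y) = if x = y then 1 else 0 := by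
  cases x <;> cases y <;> simp [tGate]
  rw [← Complex.exp_conj, ← Complex.exp_add, map_mul, map_div₀, Complex.conj_I, Complex.conj_ofReal,
    map_ofNat]
  simp

theorem flipIf_flipIf (i j : ℕ) (s : Bits) : flipIf i j (flipIf i j s) = s := by
  unfold flipIf
  cases hi : s[i]? with
  | none => simp [hi]
  | some x =>
    cases hj : s[j]? with
    | none => simp [hi, hj]
    | some y =>
      by_cases h : i = j
      · simp [h]
        cases hj2 : s[j]? <;> simp
      · obtain ⟨h2, h3⟩ := List.getElem?_eq_some_iff.1 hj
        simp only [h, if_false]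
        rw [List.getElem?_set_ne (Ne.symm h), hi, List.getElem?_set_self h2]
        simp
        subst h3
        simp

/-- Equal lengths are essential: they guarantee that the two concatenations split at the same place,
and that the position is valid in both strings or in neither. -/
theorem moveIdx_injective (i : ℕ) {s t : Bits} (hst : s.length = t.length)
    (h : s.eraseIdx i ++ s[i]?.toList = t.eraseIdx i ++ t[i]?.toList) : s = t := by
  obtain ⟨h1, h2⟩ := List.append_inj h (by simp [List.length_eraseIdx, hst])
  by_cases hi : i < s.length
  · have hi' : i < t.length := hst ▸ hi
    simp [hi, hi'] at h2
    refine List.ext_getElem hst fun k hk hk' => ?_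
    rcases lt_trichotomy k i with h | h | h
    · have := congrArg (·[k]?) h1
      simp only [List.getElem?_eraseIdx, h, if_true] at this
      simpa [hk, hk'] using this
    · subst h; exact h2
    · have := congrArg (·[k - 1]?) h1
      rw [List.getElem?_eraseIdx, List.getElem?_eraseIdx, if_neg (by omega), if_neg (by omega),
        show k - 1 + 1 = k by omega] at this
      simpa [hk, hk'] using this
  · rwa [List.eraseIdx_of_length_le (by omega), List.eraseIdx_of_length_le (by omega)] at h1

/-- Programs without queries preserve the trace. -/
theorem ev_den_trace {p : Prog} (hp : p.QueryFree) (v : Val) {s t : Bits}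
    (hst : s.length = t.length) :
    ev (p.den O v s t) (fun _ s t => if s = t then 1 else 0) = if s = t then 1 else 0 := by
  induction p generalizing v s t with
  | query => exact hp.elim
  | skip | nil | hd | tl | new => simp [den]
  | gateH => exact ev_applyGate_trace hadamard_unitary _ _ _ _
  | gateT => exact ev_applyGate_trace tGate_unitary _ _ _ _
  | gateCNOT => 
    simp only [den, ev_ket]
    congr 1
    exact propext (Function.LeftInverse.injective (flipIf_flipIf _ _)).eq_iff
  | meas =>
    simp only [den]
    split
    next x y hs ht =>
      split
      · simp
      next h => rw [if_neg fun h' => h (by subst h'; simpa [hs] using ht)]; simp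
    · simp
  | discard => 
    simp only [den]
    split
    next x y hs ht =>
      split
      next h =>
        rw [ev_ket]
        congr 1
        -- The removed bits agree in this case, so equality of the remaining strings is equality of
        -- the whole strings.
        refine propext ⟨fun h' => moveIdx_injective v.toNat hst ?_, fun h' => h' ▸ rfl⟩
        rw [h', hs, ht, h]
      next h => rw [if_neg fun h' => h (by subst h'; simpa [hs] using ht)]; simp
    · simp
  | move =>
    simp only [den, ev_ket]
    congr 1
    exact propext ⟨fun h' => moveIdx_injective v.toNat hst h', fun h' => h' ▸ rfl⟩
  | rand =>
    simp only [den]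
    split
    · simp
    next h =>
      simp only [ev_listSum, List.map_map, Function.comp_def, ev_smul, ev_ket]
      have : v.toList ≠ [] := by cases v <;> simp_all [Val.isNil, Val.toList]
      simp only [List.map_const', List.sum_replicate, nsmul_eq_mul]
      have : (v.toList.length : ℂ) ≠ 0 := by simpa using this
      field_simp
  | seq p q ihp ihq =>
    simp only [den, ev_apply]
    rw [← ihp hp.1 v hst]
    exact ev_congr (supp_den hp.1 0 v hst) fun a s' t' h => ihq hp.2 a h.1
  | pair p q ihp ihq =>
    simp only [den, ev_apply, ev_ket]
    rw [← ihp hp.1 v hst]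
    exact ev_congr (supp_den hp.1 0 v hst) fun a s' t' h => ihq hp.2 v h.1
  | cond p q ihp ihq =>
    simp only [den]
    split
    · exact ihq hp.2 _ hst
    · exact ihp hp.1 _ hst
  | frame p ih =>
    simp only [den, ev_appendTo]
    -- The part of the memory outside of the frame is untouched: if it differs, both traces vanish,
    -- and otherwise it can be cancelled.
    by_cases h : s.take v.hd.toNat = t.take v.hd.toNat
    · simp only [h, List.append_cancel_left_eq]
      rw [ih hp _ (by simp [hst])]
      congr 1
      refine propext ⟨fun h' => ?_, fun h' => h' ▸ rfl⟩
      rw [← List.take_append_drop v.hd.toNat s, h, h', List.take_append_drop]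
    · rw [if_neg fun h' => h (by rw [h'])]
      refine Eq.trans ?_ (ev_fun_zero (p.den O v.tl (s.drop v.hd.toNat) (t.drop v.hd.toNat)))
      refine ev_fun_congr fun a s' t' => if_neg fun h' => h ?_
      exact (List.append_inj h' (by simp [hst])).1
  | fold p ih =>
    have key : ∀ (l u : Val) (s t : Bits), s.length = t.length →
        ev ((fold p).den O (Val.cons l u) s t) (fun _ s t => if s = t then 1 else 0) =
          if s = t then 1 else 0 := by
      intro l
      induction l with
      | nil => intro u s t hst; rw [den_fold_nil _ _ _ rfl, ev_ket]
      | cons x l _ ihl =>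
        intro u s t hst
        rw [den_fold_cons, ev_apply, ← ih hp (Val.cons x u) hst]
        exact ev_congr (supp_den (p := p) hp 0 (Val.cons x u) hst) fun a s' t' h => ihl a s' t' h.1
    rw [den_fold_eq]
    exact key _ _ _ _ hst

end Prog

/-! ### Polynomial running time of composed programs -/

theorem Polynomial.eval_nat_mono (P : Polynomial ℕ) {m n : ℕ} (h : m ≤ n) :
    P.eval m ≤ P.eval n := by
  rw [Polynomial.eval_eq_sum_range, Polynomial.eval_eq_sum_range]
  exact Finset.sum_le_sum fun i _ => Nat.mul_le_mul_left _ (Nat.pow_le_pow_left h i)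

namespace Val

theorem length_toList_le (v : Val) : v.toList.length ≤ v.size := by
  induction v with
  | nil => simp [toList]
  | cons a b _ ih => simp only [toList, size, List.length_cons]; omega

theorem hd_add_tl_le (v : Val) : v.hd.size + v.tl.size ≤ v.size + 1 := by
  cases v <;> simp only [hd, tl, size] <;> omega

end Val

namespace Prog

open CQ Polynomial

variable {O : Val → CQ Val} {p q : Prog}

theorem polyTime_of_le_size (h : ∀ (L : ℕ) (v : Val), ∀ z ∈ p.traces L v, z.2 ≤ v.size + 2 + L) :
    p.PolyTime :=
  ⟨X + 2, fun L v z hz => by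
    have := h L v z hz
    simp; omega⟩

theorem polyTime_skip : skip.PolyTime :=
  polyTime_of_le_size fun L v z hz => by rw [Set.mem_singleton_iff.1 hz]; simp

theorem polyTime_nil : nil.PolyTime :=
  polyTime_of_le_size fun L v z hz => by rw [Set.mem_singleton_iff.1 hz]; simp

theorem polyTime_hd : hd.PolyTime :=
  polyTime_of_le_size fun L v z hz => by rw [Set.mem_singleton_iff.1 hz]; simp

theorem polyTime_tl : tl.PolyTime :=
  polyTime_of_le_size fun L v z hz => by rw [Set.mem_singleton_iff.1 hz]; simp

theorem polyTime_new : new.PolyTime :=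
  polyTime_of_le_size fun L v z hz => by rw [Set.mem_singleton_iff.1 hz]; simp

theorem polyTime_gateH : gateH.PolyTime :=
  polyTime_of_le_size fun L v z hz => by rw [Set.mem_singleton_iff.1 hz]; simp

theorem polyTime_gateT : gateT.PolyTime :=
  polyTime_of_le_size fun L v z hz => by rw [Set.mem_singleton_iff.1 hz]; simp

theorem polyTime_discard : discard.PolyTime :=
  polyTime_of_le_size fun L v z hz => by rw [Set.mem_singleton_iff.1 hz]; simp

theorem polyTime_move : move.PolyTime :=
  polyTime_of_le_size fun L v z hz => by rw [Set.mem_singleton_iff.1 hz]; simp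

theorem polyTime_meas : meas.PolyTime := polyTime_of_le_size fun L v z hz => by rw [hz.2]; simp

theorem polyTime_rand : rand.PolyTime := polyTime_of_le_size fun L v z hz => by rw [hz.2]; simp

theorem polyTime_query : query.PolyTime := polyTime_of_le_size fun L v z hz => by rw [hz.2]

/-- The input of the second program is at most as large as the cost of the first, so the bounds are
composed. -/
theorem PolyTime.seq (hp : p.PolyTime) (hq : q.PolyTime) : (seq p q).PolyTime := by
  obtain ⟨P, hP⟩ := hp
  obtain ⟨Q, hQ⟩ := hq
  refine ⟨P + Q.comp (P + X) + (X + 2), fun L v z hz => ?_⟩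
  obtain ⟨x, hx, y, hy, rfl⟩ := hz
  have h1 := hP L v x hx
  have h2 := hQ L _ y hy
  have h3 := size_le_cost p hx
  have h4 := Q.eval_nat_mono (show x.1.size + L ≤ P.eval (v.size + L) + (v.size + L) by omega)
  simp only [eval_add, eval_comp, eval_X, eval_ofNat]
  omega

theorem PolyTime.pair (hp : p.PolyTime) (hq : q.PolyTime) : (pair p q).PolyTime := by
  obtain ⟨P, hP⟩ := hp
  obtain ⟨Q, hQ⟩ := hq
  refine ⟨P + Q + (X + 2), fun L v z hz => ?_⟩
  obtain ⟨x, hx, y, hy, rfl⟩ := hz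
  have h1 := hP L v x hx
  have h2 := hQ L _ y hy
  simp only [eval_add, eval_X, eval_ofNat]
  omega

theorem PolyTime.cond (hp : p.PolyTime) (hq : q.PolyTime) : (cond p q).PolyTime := by
  obtain ⟨P, hP⟩ := hp
  obtain ⟨Q, hQ⟩ := hq
  refine ⟨P + Q + (X + 2), fun L v z hz => ?_⟩
  obtain ⟨x, hx, rfl⟩ := hz
  have h0 := v.size_tl_le
  have h1 := P.eval_nat_mono (show v.tl.size + L ≤ v.size + L by omega)
  have h2 := Q.eval_nat_mono (show v.tl.size + L ≤ v.size + L by omega)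
  simp only [eval_add, eval_X, eval_ofNat]
  split at hx
  · have := hQ L _ x hx; omega
  · have := hP L _ x hx; omega

theorem PolyTime.frame (hp : p.PolyTime) : (frame p).PolyTime := by
  obtain ⟨P, hP⟩ := hp
  refine ⟨P + (X + 2), fun L v z hz => ?_⟩
  obtain ⟨x, hx, rfl⟩ := hz
  have h0 := v.size_tl_le
  have h1 := P.eval_nat_mono (show v.tl.size + L ≤ v.size + L by omega)
  have := hP L _ x hx
  simp only [eval_add, eval_X, eval_ofNat]
  omega

theorem mem_foldTraces_concat {L : ℕ} {l : List Val} {x u : Val} {w : Val × ℕ} :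
    w ∈ foldTraces L p (l ++ [x]) u ↔
      ∃ y ∈ foldTraces L p l u, ∃ z ∈ p.traces L (Val.cons x y.1), w = (z.1, y.2 + z.2) := by
  induction l generalizing u w with
  | nil =>
    simp only [List.nil_append, foldTraces, Set.mem_singleton_iff, exists_eq_left, zero_add,
      Set.mem_ofPred_eq]
    exact ⟨fun ⟨y, h, h'⟩ => ⟨y, h, h'⟩, fun ⟨y, h, h'⟩ => ⟨y, h, h'⟩⟩
  | cons a l ih =>
    simp only [List.cons_append, foldTraces, Set.mem_ofPred_eq, ih]
    constructor
    · rintro ⟨y, hy, _, ⟨y', hy', z, hz, rfl⟩, rfl⟩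
      exact ⟨_, ⟨y, hy, y', hy', rfl⟩, z, hz, by simp [add_assoc]⟩
    · rintro ⟨_, ⟨y, hy, y', hy', rfl⟩, z, hz, rfl⟩
      exact ⟨y, hy, _, ⟨y', hy', z, hz, rfl⟩, by simp [add_assoc]⟩

/-- The cost of a loop whose accumulator stays bounded. -/
theorem foldTraces_cost_le {L B : ℕ} {P : Polynomial ℕ}
    (hP : ∀ (v : Val), ∀ z ∈ p.traces L v, z.2 ≤ P.eval (v.size + L)) {l : List Val} {u : Val}
    (hl : ∀ x ∈ l, x.size ≤ B)
    (h : ∀ l', l' <+: l → ∀ w ∈ foldTraces L p l' u, w.1.size ≤ B) :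
    ∀ w ∈ foldTraces L p l u, w.2 ≤ l.length * P.eval (2 * B + 1 + L) := by
  induction l using List.reverseRecOn with
  | nil => intro w hw; rw [Set.mem_singleton_iff.1 hw]; simp
  | append_singleton l x ih =>
    intro w hw
    obtain ⟨y, hy, z, hz, rfl⟩ := mem_foldTraces_concat.1 hw
    have h1 := ih (fun x hx => hl x (by simp [hx]))
      (fun l' hl' => h l' (hl'.trans (List.prefix_append _ _))) y hy
    have h2 := h l (List.prefix_append _ _) y hy
    have h3 := hl x (by simp)
    have h4 := hP _ z hz
    have h5 := P.eval_nat_mono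
      (show (Val.cons x y.1).size + L ≤ 2 * B + 1 + L by simp only [Val.size]; omega)
    simp only [List.length_append, List.length_singleton, add_mul, one_mul]
    omega

/-- A loop may double its accumulator in each iteration, so a polynomial body is not enough. A bound
for the accumulator after each prefix of the list, in terms of the original input, excludes this. -/
theorem PolyTime.seq_fold (hq : q.PolyTime) (hp : p.PolyTime) (R : Polynomial ℕ)
    (h : ∀ L v, ∀ y ∈ q.traces L v, ∀ l', l' <+: y.1.hd.toList → ∀ w ∈ foldTraces L p l' y.1.tl,
      w.1.size ≤ R.eval (v.size + L)) : (Prog.seq q (Prog.fold p)).PolyTime := by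
  obtain ⟨P, hP⟩ := hp
  obtain ⟨Q, hQ⟩ := hq
  -- The terms are the cost of `q`, the charge for entering the loop, at most `Q` iterations on
  -- values of size at most `Q + R`, and the charge for the composition.
  refine ⟨Q + (Q + 2) + Q * P.comp (2 * (Q + R) + 1 + X) + (X + 2), fun L v z hz => ?_⟩
  obtain ⟨y, hy, z, hz, rfl⟩ := hz
  rw [traces_fold] at hz
  obtain ⟨w, hw, rfl⟩ := hz
  have h1 := hQ L v y hy
  have h2 := size_le_cost q hy
  have h2' := y.1.size_hd_le
  have h3 := foldTraces_cost_le (B := Q.eval (v.size + L) + R.eval (v.size + L)) (hP L)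
    (fun x hx => by have := Val.size_le_of_mem hx; omega)
    (fun l' hl' w hw => by have := h L v y hy l' hl' w hw; omega) w hw
  have h4 := y.1.hd.length_toList_le
  have h5 := Nat.mul_le_mul (show y.1.hd.toList.length ≤ Q.eval (v.size + L) by omega)
    (P.eval_nat_mono (show 2 * (Q.eval (v.size + L) + R.eval (v.size + L)) + 1 + L ≤
      2 * (Q.eval (v.size + L) + R.eval (v.size + L)) + 1 + (v.size + L) by omega))
  simp only [eval_add, eval_mul, eval_comp, eval_X, eval_ofNat, eval_one]
  omega

/-- A loop over a list with a context that remains unchanged: on input `(l, (c, u))`, replace `u`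
successively by the result of `p` on `(x, (c, u))`, and return `(c, u)`. -/
def loop (p : Prog) : Prog := fold (pair (seq tl hd) p)

theorem loop_invariant {R : ℕ → ℕ} {L B : ℕ} (hR : Monotone R)
    (h : ∀ x U, ∀ z ∈ p.traces L (Val.cons x U), z.1.size ≤ U.tl.size + R (x.size + U.hd.size + L))
    {l : List Val} {U : Val} (hl : ∀ x ∈ l, x.size + U.hd.size ≤ B) :
    ∀ w ∈ foldTraces L (pair (seq tl hd) p) l U,
      w.1.hd = U.hd ∧ w.1.tl.size ≤ U.tl.size + l.length * R (B + L) := by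
  induction l using List.reverseRecOn with
  | nil => intro w hw; rw [Set.mem_singleton_iff.1 hw]; simp
  | append_singleton l x ih =>
    intro w hw
    obtain ⟨y, hy, z, ⟨a, ⟨b, hb, c, hc, rfl⟩, d, hd, rfl⟩, rfl⟩ := mem_foldTraces_concat.1 hw
    have h1 := ih (fun x hx => hl x (by simp [hx])) y hy
    rw [Set.mem_singleton_iff.1 hb] at hc
    rw [Set.mem_singleton_iff.1 hc]
    have h2 := h _ _ d hd
    have h3 := hl x (by simp)
    rw [h1.1] at h2
    have h4 := hR (show x.size + U.hd.size + L ≤ B + L by omega)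
    refine ⟨by simpa [Val.hd, Val.tl] using h1.1, ?_⟩
    simp only [List.length_append, List.length_singleton, add_mul, one_mul]
    show d.1.size ≤ _
    omega

/-- The context is never changed, and the growth in one iteration does not depend on the
accumulator. So the accumulator grows linearly in the number of iterations, which itself is bounded
by the size of the input. -/
theorem PolyTime.loop (hp : p.PolyTime) (R : Polynomial ℕ)
    (h : ∀ L x U, ∀ z ∈ p.traces L (Val.cons x U),
      z.1.size ≤ U.tl.size + R.eval (x.size + U.hd.size + L)) : (loop p).PolyTime := by
  obtain ⟨P, hP⟩ := (polyTime_tl.seq polyTime_hd).pair hp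
  have key : ∀ (L : ℕ) (v : Val), ∀ l', l' <+: v.hd.toList →
      ∀ w ∈ foldTraces L (Prog.pair (Prog.seq .tl .hd) p) l' v.tl,
        w.1.size ≤ 2 * (v.size + L) + 1 + (v.size + L) * R.eval (2 * (v.size + L)) := by
    intro L v l' hl' w hw
    have h0 := v.hd_add_tl_le
    have h0' := v.one_le_size
    have h00 := v.size_tl_le
    have h1 := v.tl.size_hd_le
    have h1' := v.tl.size_tl_le
    have h2 := loop_invariant (B := 2 * v.size) (R := fun n => R.eval n)
      (fun _ _ h => R.eval_nat_mono h) (h L) (U := v.tl) (l := l')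
      (fun x hx => by have := Val.size_le_of_mem (hl'.subset hx); omega) w hw
    have h3 := hl'.length_le
    have h4 := v.hd.length_toList_le
    have h5 := v.size_hd_le
    have h6 := Nat.mul_le_mul (show l'.length ≤ v.size + L by omega)
      (R.eval_nat_mono (show 2 * v.size + L ≤ 2 * (v.size + L) by omega))
    have h7 : w.1.size ≤ 1 + w.1.hd.size + w.1.tl.size := by
      cases w.1 <;> simp [Val.size, Val.hd, Val.tl]
    rw [h2.1] at h7
    have h8 := h2.2
    omega
  refine ⟨X * P.comp (2 * (X + (2 * X + 1 + X * R.comp (2 * X))) + 1 + X) + (X + 2),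
    fun L v z hz => ?_⟩
  rw [Prog.loop, traces_fold] at hz
  obtain ⟨w, hw, rfl⟩ := hz
  have h3 := foldTraces_cost_le
    (B := v.size + L + (2 * (v.size + L) + 1 + (v.size + L) * R.eval (2 * (v.size + L)))) (hP L)
    (fun x hx => by have := Val.size_le_of_mem hx; have := v.size_hd_le; omega)
    (fun l' hl' w hw => by have := key L v l' hl' w hw; omega) w hw
  have h4 := v.hd.length_toList_le
  have h6 := v.size_hd_le
  have h5 := Nat.mul_le_mul (show v.hd.toList.length ≤ v.size + L by omega)
    (P.eval_nat_mono (show 2 * (v.size + L + (2 * (v.size + L) + 1 +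
      (v.size + L) * R.eval (2 * (v.size + L)))) + 1 + L ≤
      2 * (v.size + L + (2 * (v.size + L) + 1 +
      (v.size + L) * R.eval (2 * (v.size + L)))) + 1 + (v.size + L) by omega))
  simp only [eval_add, eval_mul, eval_comp, eval_X, eval_ofNat, eval_one]
  omega

theorem ev_loop_nil (p : Prog) (U : Val) (s t : Bits) (φ : Val → Bits → Bits → ℂ) :
    ev ((loop p).den O (Val.cons Val.nil U) s t) φ = φ U s t := by
  rw [loop, den_fold_nil _ _ _ rfl, ev_ket]; rfl

theorem ev_loop_cons (p : Prog) (x l c u : Val) (s t : Bits) (φ : Val → Bits → Bits → ℂ) :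
    ev ((loop p).den O (Val.cons (Val.cons x l) (Val.cons c u)) s t) φ =
      ev (p.den O (Val.cons x (Val.cons c u)) s t) fun u' s' t' =>
        ev ((loop p).den O (Val.cons l (Val.cons c u')) s' t') φ := by
  simp [loop, den_fold_cons, den, Val.hd, Val.tl]

theorem ev_seq (p q : Prog) (v : Val) (s t : Bits) (φ : Val → Bits → Bits → ℂ) :
    ev ((seq p q).den O v s t) φ =
      ev (p.den O v s t) fun u s' t' => ev (q.den O u s' t') φ := by
  simp [den]

theorem ev_pair (p q : Prog) (v : Val) (s t : Bits) (φ : Val → Bits → Bits → ℂ) :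
    ev ((pair p q).den O v s t) φ =
      ev (p.den O v s t) fun a s' t' => ev (q.den O v s' t') fun b s'' t'' =>
        φ (Val.cons a b) s'' t'' := by
  simp [den]

theorem ev_frame (p : Prog) (v : Val) (s t : Bits) (φ : Val → Bits → Bits → ℂ) :
    ev ((frame p).den O v s t) φ =
      ev (p.den O v.tl (s.drop v.hd.toNat) (t.drop v.hd.toNat)) fun a s' t' =>
        φ a (s.take v.hd.toNat ++ s') (t.take v.hd.toNat ++ t') := by
  simp [den]

end Prog

/-! ### Deterministic polynomial-time functions -/

open CQ Polynomial

/-- Functions computed by deterministic classical polynomial-time programs. -/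
@[fun_prop]
def FP (g : Val → Val) : Prop :=
  ∃ p : Prog, p.QueryFree ∧ p.PolyTime ∧ (∀ O v s t, p.den O v s t = ket (g v) s t) ∧
    ∀ L v, ∀ z ∈ p.traces L v, z.1 = g v

namespace FP

variable {f g F I : Val → Val}

/-- A program for a function in `FP`. -/
def prog (h : FP g) : Prog := h.choose

theorem queryFree (h : FP g) : h.prog.QueryFree := h.choose_spec.1

theorem polyTime (h : FP g) : h.prog.PolyTime := h.choose_spec.2.1

theorem den (h : FP g) (O : Val → CQ Val) (v : Val) (s t : Bits) :
    h.prog.den O v s t = ket (g v) s t := h.choose_spec.2.2.1 O v s t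

theorem ev_den (h : FP g) (O : Val → CQ Val) (v : Val) (s t : Bits) (φ : Val → Bits → Bits → ℂ) :
    ev (h.prog.den O v s t) φ = φ (g v) s t := by rw [h.den, ev_ket]

theorem traces (h : FP g) {L : ℕ} {v : Val} {z : Val × ℕ} (hz : z ∈ h.prog.traces L v) :
    z.1 = g v := h.choose_spec.2.2.2 L v z hz

@[fun_prop]
theorem id : FP fun v => v :=
  ⟨.skip, trivial, Prog.polyTime_skip, fun _ _ _ _ => rfl, fun _ _ z hz => by
    rw [Set.mem_singleton_iff.1 hz]⟩

@[fun_prop]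
theorem comp (hf : FP f) (hg : FP g) : FP fun v => f (g v) :=
  ⟨.seq hg.prog hf.prog, ⟨hg.queryFree, hf.queryFree⟩, hg.polyTime.seq hf.polyTime,
    fun O v s t => by simp [Prog.den, hg.den, hf.den],
    fun L v z hz => by
      obtain ⟨x, hx, y, hy, rfl⟩ := hz
      simp only [hf.traces hy, hg.traces hx]⟩

@[fun_prop]
theorem hd (hf : FP f) : FP fun v => (f v).hd :=
  comp (f := Val.hd) ⟨.hd, trivial, Prog.polyTime_hd, fun _ _ _ _ => rfl, fun _ _ z hz => by
    rw [Set.mem_singleton_iff.1 hz]⟩ hf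

@[fun_prop]
theorem tl (hf : FP f) : FP fun v => (f v).tl :=
  comp (f := Val.tl) ⟨.tl, trivial, Prog.polyTime_tl, fun _ _ _ _ => rfl, fun _ _ z hz => by
    rw [Set.mem_singleton_iff.1 hz]⟩ hf

@[fun_prop]
theorem cons (hf : FP f) (hg : FP g) : FP fun v => Val.cons (f v) (g v) :=
  ⟨.pair hf.prog hg.prog, ⟨hf.queryFree, hg.queryFree⟩, hf.polyTime.pair hg.polyTime,
    fun O v s t => by simp [Prog.den, hg.den, hf.den],
    fun L v z hz => by
      obtain ⟨x, hx, y, hy, rfl⟩ := hz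
      simp only [hf.traces hx, hg.traces hy]⟩

@[fun_prop]
theorem const (c : Val) : FP fun _ => c := by
  induction c with
  | nil => exact ⟨.nil, trivial, Prog.polyTime_nil, fun _ _ _ _ => rfl, fun _ _ z hz => by
      rw [Set.mem_singleton_iff.1 hz]⟩
  | cons a b iha ihb => exact iha.cons ihb

/-- The value of the function actually occurs as an outcome of the program, hence among its traces,
where size is bounded by cost. -/
theorem size_le (h : FP g) : ∃ R : Polynomial ℕ, ∀ v, (g v).size ≤ R.eval v.size := by
  obtain ⟨P, hP⟩ := h.polyTime
  refine ⟨P, fun v => ?_⟩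
  have h1 := Prog.supp_den (O := fun _ => pure Val.nil) h.queryFree 0 v (s := []) (t := []) rfl
  rw [h.den] at h1
  obtain ⟨_, k, hk, _⟩ := h1 (g v, [], []) (by
    rw [ket]; erw [Finsupp.mem_support_iff, Finsupp.single_eq_same]; exact one_ne_zero)
  exact (Prog.size_le_cost _ hk).trans (hP 0 v _ hk)

end FP

namespace Val

/-- `ite c a b` is `a` if `c` is not empty, and `b` otherwise. -/
def ite (c a b : Val) : Val := if c.isNil then b else a

end Val

namespace FP

variable {f g k F I : Val → Val} {G : Val → Val → Val → Val}

@[fun_prop]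
theorem ite (hf : FP f) (hg : FP g) (hk : FP k) : FP fun v => Val.ite (f v) (g v) (k v) := by
  have : FP fun w : Val => Val.ite w.hd w.tl.hd w.tl.tl := by
    have h1 : FP fun w : Val => w.hd := by fun_prop
    have h2 : FP fun w : Val => w.tl := by fun_prop
    refine ⟨.cond h1.prog h2.prog, ⟨h1.queryFree, h2.queryFree⟩, h1.polyTime.cond h2.polyTime,
      fun O v s t => ?_, fun L v z hz => ?_⟩
    · simp only [Prog.den, Val.ite, h1.den, h2.den]; split <;> rfl
    · obtain ⟨x, hx, rfl⟩ := hz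
      simp only [Val.ite]
      split at hx
      · exact (h2.traces hx).trans (if_pos ‹_›).symm
      · exact (h1.traces hx).trans (if_neg ‹_›).symm
  exact this.comp (hf.cons (hg.cons hk))

/-- The input `v` is carried along as the unchanged context of the loop, so that the body may depend
on it. The hypothesis on all prefixes bounds the accumulator. -/
theorem foldl (hF : FP F) (hI : FP I) (hG : FP fun w => G w.tl.hd w.hd w.tl.tl)
    (hb : ∃ R : Polynomial ℕ, ∀ v l, l <+: (F v).toList →
      (l.foldl (fun u x => G v x u) (I v)).size ≤ R.eval v.size) :
    FP fun v => (F v).toList.foldl (fun u x => G v x u) (I v) := by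
  obtain ⟨R, hR⟩ := hb
  have hq : FP fun v => Val.cons (F v) (Val.cons v (I v)) := by fun_prop
  have htr : ∀ (L : ℕ) (v : Val) (l : List Val) (u : Val),
      ∀ w ∈ Prog.foldTraces L (.pair (.seq .tl .hd) hG.prog) l (Val.cons v u),
        w.1 = Val.cons v (l.foldl (fun u x => G v x u) u) := by
    intro L v l
    induction l with
    | nil => intro u w hw; rw [Set.mem_singleton_iff.1 hw]; rfl
    | cons x l ih =>
      rintro u _ ⟨_, ⟨_, ⟨b, hb, c, hc, rfl⟩, d, hd, rfl⟩, w, hw, rfl⟩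
      rw [Set.mem_singleton_iff.1 hb] at hc
      rw [Set.mem_singleton_iff.1 hc] at hw
      have := ih _ w hw
      rw [hG.traces hd] at this
      exact this
  refine ⟨.seq (.seq hq.prog (.loop hG.prog)) .tl,
    ⟨⟨hq.queryFree, ⟨trivial, trivial⟩, hG.queryFree⟩, trivial⟩, ?_, fun O v s t => ?_,
    fun L v z hz => ?_⟩
  · refine Prog.PolyTime.seq (Prog.PolyTime.seq_fold hq.polyTime
      ((Prog.polyTime_tl.seq Prog.polyTime_hd).pair hG.polyTime) (1 + X + R) ?_) Prog.polyTime_tl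
    intro L v y hy l hl w hw
    rw [hq.traces hy] at hl hw
    rw [htr L v l (I v) w hw]
    have h1 := hR v l hl
    have h2 := R.eval_nat_mono (show v.size ≤ v.size + L by omega)
    simp only [Val.size, eval_add, eval_one, eval_X]
    omega
  · have : ∀ (l : Val) (u : Val) (s t : Bits), ∀ φ,
        ev ((Prog.loop hG.prog).den O (Val.cons l (Val.cons v u)) s t) φ =
          φ (Val.cons v (l.toList.foldl (fun u x => G v x u) u)) s t := by
      intro l
      induction l with
      | nil => intro u s t φ; rw [Prog.ev_loop_nil]; rfl
      | cons x l _ ih =>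
        intro u s t φ
        rw [Prog.ev_loop_cons, hG.ev_den, ih]
        rfl
    refine ext_ev fun φ => ?_
    rw [Prog.ev_seq, Prog.ev_seq, hq.ev_den, this]
    simp [Prog.den]
  · obtain ⟨x, ⟨a, ha, b, hb, rfl⟩, y, hy, rfl⟩ := hz
    rw [Prog.loop, Prog.traces_fold, hq.traces ha] at hb
    obtain ⟨w, hw, rfl⟩ := hb
    have := htr L v _ _ w hw
    rw [Set.mem_singleton_iff.1 hy]
    simp [this]

/-- The usual way to meet the bound in `foldl`: additive growth that does not depend on the
accumulator. -/
theorem foldl_additive (hF : FP F) (hI : FP I) (hG : FP fun w => G w.tl.hd w.hd w.tl.tl)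
    (R : Polynomial ℕ) (hb : ∀ v x u, (G v x u).size ≤ u.size + R.eval (v.size + x.size)) :
    FP fun v => (F v).toList.foldl (fun u x => G v x u) (I v) := by
  refine foldl hF hI hG ?_
  obtain ⟨P, hP⟩ := hF.size_le
  obtain ⟨Q, hQ⟩ := hI.size_le
  refine ⟨Q + P * R.comp (X + P), fun v l hl => ?_⟩
  have key : ∀ l : List Val, (∀ x ∈ l, x.size ≤ P.eval v.size) →
      (l.foldl (fun u x => G v x u) (I v)).size ≤
        (I v).size + l.length * R.eval (v.size + P.eval v.size) := by
    intro l hl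
    induction l using List.reverseRecOn with
    | nil => simp
    | append_singleton l x ih =>
      have h1 := ih fun x hx => hl x (by simp [hx])
      have h2 := hl x (by simp)
      have h3 := hb v x (l.foldl (fun u x => G v x u) (I v))
      have h4 := R.eval_nat_mono (show v.size + x.size ≤ v.size + P.eval v.size by omega)
      simp only [List.foldl_append, List.foldl_cons, List.foldl_nil, List.length_append,
        List.length_singleton, add_mul, one_mul]
      omega
  have h1 := key l fun x hx => (Val.size_le_of_mem (hl.subset hx)).trans (hP v)
  have h2 := hl.length_le.trans ((F v).length_toList_le.trans (hP v))
  have h3 := Nat.mul_le_mul_right (R.eval (v.size + P.eval v.size)) h2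
  have h4 := hQ v
  simp only [eval_add, eval_mul, eval_comp, eval_X]
  omega

end FP

/-! ### Lists -/

namespace Val

def rev (l : Val) : Val := ofList l.toList.reverse

def append (l m : Val) : Val := ofList (l.toList ++ m.toList)

def drop (l i : Val) : Val := ofList (l.toList.drop i.toNat)

def take (l i : Val) : Val := ofList (l.toList.take i.toNat)

def nth (l i : Val) : Val := l.toList.getD i.toNat nil

def flatten (l : Val) : Val := ofList (l.toList.map toList).flatten

def map (l : Val) (g : Val → Val) : Val := ofList (l.toList.map g)

/-- Each entry with its index. -/
def zipIdx (l : Val) : Val := ofList (l.toList.zipIdx.map fun x => cons x.1 (unary x.2))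

theorem ofList_append (l m : List Val) : ofList (l ++ m) = append (ofList l) (ofList m) := by
  simp [append]

@[simp] theorem toNat_unary (n : ℕ) : (unary n).toNat = n := by simp [unary, toNat]

theorem unary_succ (n : ℕ) : unary (n + 1) = cons nil (unary n) := rfl

theorem unary_add (m n : ℕ) : unary (m + n) = append (unary m) (unary n) := by
  simp [unary, append]

theorem size_unary (n : ℕ) : (unary n).size = 2 * n + 1 := by
  induction n with
  | zero => rfl
  | succ n ih => rw [unary_succ]; simp only [size, ih]; omega

theorem size_ofList_append (l m : List Val) :
    (ofList (l ++ m)).size + 1 = (ofList l).size + (ofList m).size := by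
  induction l with
  | nil => simp [ofList, size]; omega
  | cons a l ih => simp only [List.cons_append, ofList, size]; omega

end Val

namespace FP

variable {f g k F I : Val → Val} {G : Val → Val → Val}

@[fun_prop]
theorem rev (hf : FP f) : FP fun v => (f v).rev := by
  have := foldl_additive (G := fun _ x u => Val.cons x u) hf (const Val.nil) (by fun_prop)
    (X + 1) (fun v x u => by simp [Val.size]; omega)
  convert this using 2 with v
  have : ∀ (l : List Val) (u : Val), l.foldl (fun u x => Val.cons x u) u =
      Val.ofList (l.reverse ++ u.toList) := by
    intro l
    induction l with
    | nil => simp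
    | cons a l ih => intro u; simp [ih]
  rw [this]
  simp [Val.rev, Val.toList]

@[fun_prop]
theorem append (hf : FP f) (hg : FP g) : FP fun v => (f v).append (g v) := by
  have := foldl_additive (G := fun _ x u => Val.cons x u) hf.rev hg (by fun_prop)
    (X + 1) (fun v x u => by simp [Val.size]; omega)
  convert this using 2 with v
  have : ∀ (l : List Val) (u : Val), l.foldl (fun u x => Val.cons x u) u =
      Val.ofList (l.reverse ++ u.toList) := by
    intro l
    induction l with
    | nil => simp
    | cons a l ih => intro u; simp [ih]
  rw [this]
  simp [Val.rev, Val.append]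

@[fun_prop]
theorem drop (hf : FP f) (hg : FP g) : FP fun v => (f v).drop (g v) := by
  have := foldl_additive (G := fun _ _ u => u.tl) hg hf (by fun_prop)
    0 (fun v x u => by simpa using u.size_tl_le)
  convert this using 2 with v
  have : ∀ (l : List Val) (u : Val), l.foldl (fun u _ => u.tl) u =
      Val.ofList (u.toList.drop l.length) := by
    intro l
    induction l with
    | nil => simp
    | cons a l ih => intro u; cases u <;> simp [ih]
  rw [this]
  rfl

@[fun_prop]
theorem nth (hf : FP f) (hg : FP g) : FP fun v => (f v).nth (g v) := by
  have : FP fun v => ((f v).drop (g v)).hd := by fun_prop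
  convert this using 2 with v
  have : ∀ l : List Val, (Val.ofList l).hd = l.getD 0 Val.nil := by
    intro l; cases l <;> rfl
  rw [Val.drop, this, Val.nth]
  simp [List.getD_eq_getElem?_getD]

-- With only `drop` and reversal available, the first entries are obtained by dropping from the
-- reversed list as many entries as would remain behind them.
@[fun_prop]
theorem take (hf : FP f) (hg : FP g) : FP fun v => (f v).take (g v) := by
  have : FP fun v => ((f v).rev.drop ((f v).drop (g v))).rev := by fun_prop
  convert this using 2 with v
  simp only [Val.rev, Val.drop, Val.take, Val.toList_ofList, Val.toNat, List.length_drop]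
  rw [List.drop_reverse, List.reverse_reverse]
  congr 1
  have h1 : (f v).toList.take ((g v).toList.length) =
    (f v).toList.take (min (g v).toList.length (f v).toList.length) := by simp
  rw [h1]; congr 1; omega

@[fun_prop]
theorem flatten (hf : FP f) : FP fun v => (f v).flatten := by
  have := foldl_additive (G := fun _ x u => x.append u) hf.rev (const Val.nil) (by fun_prop)
    X (fun v x u => by
      have := Val.size_ofList_append x.toList u.toList
      simp only [Val.ofList_toList] at this
      simp [Val.append]; omega)
  convert this using 2 with v
  simp only [Val.rev, Val.flatten, Val.toList_ofList, List.foldl_reverse]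
  induction (f v).toList with
  | nil => rfl
  | cons a l ih =>
    simp only [List.map_cons, List.flatten_cons, List.foldr_cons, Val.ofList_append, ih,
      Val.ofList_toList]

@[fun_prop]
theorem map (hF : FP F) (hG : FP fun w => G w.hd w.tl) : FP fun v => (F v).map (G v) := by
  obtain ⟨R, hR⟩ := hG.size_le
  have hG' : FP fun w => Val.cons (G w.tl.hd w.hd) w.tl.tl := by
    have : FP fun w : Val => Val.cons w.tl.hd w.hd := by fun_prop
    exact (hG.comp this).cons (by fun_prop)
  have := (foldl_additive (G := fun v x u => Val.cons (G v x) u) hF (const Val.nil) hG'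
    (1 + R.comp (1 + X)) (fun v x u => by
      have := hR (Val.cons v x)
      simp only [Val.size, Val.hd_cons, Val.tl_cons, eval_add, eval_one, eval_comp, eval_X] at this ⊢
      rw [← add_assoc 1]
      omega)).rev
  convert this using 2 with v
  have : ∀ (l : List Val) (u : Val), l.foldl (fun u x => Val.cons (G v x) u) u =
      Val.ofList ((l.map (G v)).reverse ++ u.toList) := by
    intro l
    induction l with
    | nil => simp
    | cons a l ih => intro u; simp [ih]
  rw [this]
  simp [Val.rev, Val.map, Val.toList]

@[fun_prop]
theorem len (hf : FP f) : FP fun v => Val.unary (f v).toNat := by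
  have : FP fun v => (f v).map fun _ => Val.nil := by fun_prop
  convert this using 2 with v
  simp [Val.map, Val.unary, Val.toNat]

-- The accumulator contains the counter, whose size is added with each entry, so the growth is not
-- additive in the sense of `foldl_additive`. The accumulator is therefore described explicitly and
-- bounded via the length of the list.
@[fun_prop]
theorem zipIdx (hf : FP f) : FP fun v => (f v).zipIdx := by
  have := (foldl (G := fun _ x u => Val.cons (Val.cons Val.nil u.hd)
    (Val.cons (Val.cons x u.hd) u.tl)) hf (const (Val.cons Val.nil Val.nil)) (by fun_prop) ?_).tl.rev
  · convert this using 2 with v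
    have : ∀ (l : List Val) (n : ℕ) (u : Val),
        l.foldl (fun u x => Val.cons (Val.cons Val.nil u.hd) (Val.cons (Val.cons x u.hd) u.tl))
          (Val.cons (Val.unary n) u) =
        Val.cons (Val.unary (n + l.length))
          (Val.ofList (((l.zipIdx n).map fun x => Val.cons x.1 (Val.unary x.2)).reverse ++ u.toList)) := by
      intro l
      induction l with
      | nil => simp
      | cons a l ih =>
        intro n u
        simp only [List.foldl_cons, Val.hd_cons, Val.tl_cons, ← Val.unary_succ, ih]
        simp [add_comm, add_left_comm]
    have h := this (f v).toList 0 Val.nil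
    rw [show (Val.cons Val.nil Val.nil) = Val.cons (Val.unary 0) Val.nil from rfl, h]
    simp [Val.zipIdx, Val.rev, Val.toList]
  · obtain ⟨P, hP⟩ := hf.size_le
    refine ⟨3 + 2 * P + P * (2 + P + 2 * P), fun v l hl => ?_⟩
    have key : ∀ l : List Val, (∀ x ∈ l, x.size ≤ P.eval v.size) → l.length ≤ P.eval v.size →
        ∃ u, l.foldl (fun u x => Val.cons (Val.cons Val.nil u.hd)
          (Val.cons (Val.cons x u.hd) u.tl)) (Val.cons Val.nil Val.nil) =
            Val.cons (Val.unary l.length) u ∧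
          u.size ≤ 1 + l.length * (2 + P.eval v.size + 2 * P.eval v.size) := by
      intro l hl
      induction l using List.reverseRecOn with
      | nil => intro _; exact ⟨Val.nil, rfl, by simp [Val.size]⟩
      | append_singleton l x ih =>
        intro hlen
        simp only [List.length_append, List.length_singleton] at hlen ⊢
        obtain ⟨u, h1, h2⟩ := ih (fun x hx => hl x (by simp [hx])) (by omega)
        have h3 := hl x (by simp)
        refine ⟨_, by rw [List.foldl_append, h1]; rfl, ?_⟩
        simp only [Val.size, Val.hd_cons, Val.tl_cons, Val.size_unary, add_mul, one_mul]
        omega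
    have h1 := hl.length_le.trans ((f v).length_toList_le.trans (hP v))
    obtain ⟨u, h2, h3⟩ := key l
      (fun x hx => (Val.size_le_of_mem (hl.subset hx)).trans (hP v)) h1
    have h4 := Nat.mul_le_mul_right (2 + P.eval v.size + 2 * P.eval v.size) h1
    rw [h2]
    simp only [Val.size, Val.size_unary, eval_add, eval_mul, eval_ofNat]
    omega

/-- Unary numbers are added by concatenation, and multiplied by replacing each entry of a list by a
copy of the other factor and flattening. -/
theorem poly (P : Polynomial ℕ) (hf : FP f) : FP fun v => Val.unary (P.eval (f v).toNat) := by
  induction P using Polynomial.induction_on' with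
  | add p q hp hq =>
    simp only [eval_add, Val.unary_add]
    fun_prop
  | monomial n a =>
    simp only [eval_monomial]
    induction n with
    | zero => simpa using const (Val.unary a)
    | succ n ih =>
      have : FP fun v => ((f v).map fun _ => Val.unary (a * (f v).toNat ^ n)).flatten := by
        refine (map hf ?_).flatten
        exact ih.comp (f := fun v => Val.unary (a * (f v).toNat ^ n)) (hd id)
      convert this using 2 with v
      simp only [Val.flatten, Val.map, Val.unary, List.map_const', Val.toList_ofList,
        List.map_replicate, List.flatten_replicate_replicate]
      congr 2
      rw [Val.toNat, pow_succ]
      ring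

end FP

/-! ### Random choices, partial trace and polynomial-time sampling -/

namespace Val

/-- A uniformly random entry. -/
def rand (l : Val) : CQ Val :=
  if l.isNil then pure Val.nil
  else (l.toList.map fun x => ((l.toList.length : ℂ)⁻¹) • ket x [] []).sum

theorem ev_rand {l : List Val} (hl : l ≠ []) (φ : Val → Bits → Bits → ℂ) :
    ev (rand (ofList l)) φ = (l.length : ℂ)⁻¹ * (l.map fun x => φ x [] []).sum := by
  have : (ofList l).isNil = false := by cases l <;> simp_all [ofList, isNil]
  simp only [rand, this, toList_ofList, Bool.false_eq_true, if_false, ev_listSum, List.map_map,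
    Function.comp_def, ev_smul, ev_ket]
  exact List.sum_map_mul_left ..

theorem memoryless_rand (l : Val) : Memoryless (rand l) := by
  unfold rand
  split
  · exact memoryless_pure _
  · refine supp_listSum fun ρ hρ => ?_
    obtain ⟨x, _, rfl⟩ := List.mem_map.1 hρ
    exact supp_smul (supp_ket ⟨rfl, rfl⟩)

end Val

namespace Prog

variable {O : Val → CQ Val} {p : Prog}

/-- On input `(k, (c, nil))`: discard `k` qubits. -/
def clear : Prog := loop (seq nil discard)

theorem polyTime_clear : clear.PolyTime := by
  refine (polyTime_nil.seq polyTime_discard).loop 0 fun L x U z hz => ?_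
  obtain ⟨x, hx, y, hy, rfl⟩ := hz
  rw [Set.mem_singleton_iff.1 hx] at hy
  rw [Set.mem_singleton_iff.1 hy]
  simpa [Val.size] using U.tl.one_le_size

/-- An upper bound for the number of qubits suffices, because discarding at an invalid position has
no effect. -/
theorem ev_clear (k c : Val) {s t : Bits} (hst : s.length = t.length) (hk : s.length ≤ k.toNat)
    (φ : Val → Bits → Bits → ℂ) :
    ev (clear.den O (Val.cons k (Val.cons c Val.nil)) s t) φ =
      if s = t then φ (Val.cons c Val.nil) [] [] else 0 := by
  induction k generalizing s t with
  | nil =>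
    have hs : s = [] := by simpa [Val.toNat] using hk
    have ht : t = [] := by subst hs; simpa using hst.symm
    subst hs ht
    rw [clear, ev_loop_nil]; simp
  | cons a k _ ih =>
    rw [clear, ev_loop_cons, ← clear]
    match s, t with
    | [], [] => simpa [den, Val.toNat] using ih (s := []) (t := []) rfl (by simp)
    | x :: s, y :: t =>
      have hst' : s.length = t.length := by simpa using hst
      have hk' : s.length ≤ k.toNat := by simpa [Val.toNat] using hk
      by_cases h : x = y
      · simpa [den, Val.toNat, h] using ih hst' hk'
      · simp [den, Val.toNat, h]

/-- On input `(k, x)`: run `p` on `x` and then discard `k` qubits. -/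
def traced (p : Prog) : Prog :=
  seq (seq (pair hd (seq tl p)) (pair hd (pair tl nil))) (seq clear hd)

theorem PolyTime.traced (hp : p.PolyTime) : (traced p).PolyTime :=
  ((polyTime_hd.pair (polyTime_tl.seq hp)).seq
    (polyTime_hd.pair (polyTime_tl.pair polyTime_nil))).seq (polyTime_clear.seq polyTime_hd)

theorem QueryFree.traced (hp : p.QueryFree) : (traced p).QueryFree := by
  simp [Prog.traced, QueryFree, hp, clear, loop]

/-- A program adds at most one qubit per step, so initial length plus running time bounds the memory
that has to be discarded. -/
theorem ev_traced (hp : p.QueryFree) (k x : Val) {s t : Bits} (hst : s.length = t.length)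
    (hk : ∀ z ∈ p.traces 0 x, s.length + z.2 ≤ k.toNat) (φ : Val → Bits → Bits → ℂ) :
    ev ((traced p).den O (Val.cons k x) s t) φ = ev (p.run x s t).traceOut φ := by
  rw [run_eq_den hp O, ev_traceOut]
  simp only [traced, ev_seq, ev_pair]
  simp only [den, ev_ket, Val.hd_cons, Val.tl_cons]
  refine ev_congr (supp_den hp 0 x hst) fun u s' t' ⟨h1, k', h2, h3⟩ => ?_
  have := hk _ h2
  rw [ev_clear _ _ h1 (by simp at this; omega)]
  simp

end Prog

/-- Distributions sampled by polynomial-time programs. -/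
def FR (f : Val → CQ Val) : Prop :=
  ∃ p : Prog, p.QueryFree ∧ p.PolyTime ∧ (∀ O v, p.den O v [] [] = f v) ∧ ∀ v, Memoryless (f v)

namespace FR

variable {f : Val → CQ Val} {g : Val → Val → CQ Val} {F : Val → Val}

/-- A program for a function in `FR`. -/
def prog (h : FR f) : Prog := h.choose

theorem queryFree (h : FR f) : h.prog.QueryFree := h.choose_spec.1

theorem polyTime (h : FR f) : h.prog.PolyTime := h.choose_spec.2.1

theorem den (h : FR f) (O : Val → CQ Val) (v : Val) : h.prog.den O v [] [] = f v :=
  h.choose_spec.2.2.1 O v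

theorem memoryless (h : FR f) (v : Val) : Memoryless (f v) := h.choose_spec.2.2.2 v

theorem pure (hF : FP F) : FR fun v => pure (F v) :=
  ⟨hF.prog, hF.queryFree, hF.polyTime, fun O v => hF.den O v [] [], fun _ => memoryless_pure _⟩

theorem comp (hf : FR f) (hF : FP F) : FR fun v => f (F v) :=
  ⟨.seq hF.prog hf.prog, ⟨hF.queryFree, hf.queryFree⟩, hF.polyTime.seq hf.polyTime,
    fun O v => ext_ev fun φ => by rw [Prog.ev_seq, hF.ev_den, hf.den], fun v => hf.memoryless _⟩

/-- The sampler `f` leaves no qubits, so that the program for `g` starts with empty memory, as its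
specification demands; the input is kept by pairing. -/
theorem bind (hf : FR f) (hg : FR fun w => g w.hd w.tl) : FR fun v => f v >>= g v :=
  ⟨.seq (.pair .skip hf.prog) hg.prog, ⟨⟨trivial, hf.queryFree⟩, hg.queryFree⟩,
    (Prog.polyTime_skip.pair hf.polyTime).seq hg.polyTime,
    fun O v => ext_ev fun φ => by
      rw [Prog.ev_seq, Prog.ev_pair]
      simp only [Prog.den, ev_ket, hf.den, ev_bind]
      refine (hf.memoryless v).ev_congr fun a => ?_
      rw [hg.den]
      rfl,
    fun v => (hf.memoryless v).bind fun a => hg.memoryless (Val.cons v a)⟩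

theorem map (hf : FR f) {G : Val → Val → Val} (hG : FP fun w => G w.hd w.tl) :
    FR fun v => G v <$> f v := by
  simp only [map_eq_pure_bind]
  exact hf.bind (pure hG)

theorem rand (hF : FP F) : FR fun v => (F v).rand :=
  comp (f := Val.rand) ⟨.rand, trivial, Prog.polyTime_rand, fun O v => by
    simp only [Prog.den, Val.rand]; rfl, Val.memoryless_rand⟩ hF

/-- Turns a quantum algorithm whose classical output alone is of interest into a sampler. `B`
computes a bound for the time, which is the number of qubits that may have to be removed. -/
theorem traceOut {p : Prog} {B : Val → Val} (hp : p.QPT) (hF : FP F) (hB : FP B)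
    (h : ∀ v, ∀ z ∈ p.traces 0 (F v), z.2 ≤ (B v).toNat) :
    FR fun v => (p.run (F v) [] []).traceOut := by
  have hFB : FP fun v => Val.cons (B v) (F v) := by fun_prop
  refine ⟨.seq hFB.prog (.traced p), ⟨hFB.queryFree, hp.1.traced⟩, hFB.polyTime.seq hp.2.traced,
    fun O v => ext_ev fun φ => ?_, fun v => memoryless_traceOut _⟩
  rw [Prog.ev_seq, hFB.ev_den, Prog.ev_traced hp.1 _ _ rfl (by simpa using h v)]

theorem mapM (hg : FR fun w => g w.hd w.tl) (hF : FP F) :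
    FR fun v => Val.ofList <$> (F v).toList.mapM (g v) := by
  have h1 : FP fun v => Val.cons (F v) (Val.cons v Val.nil) := by fun_prop
  have h2 : FP fun w => Val.cons w.tl.hd w.hd := by fun_prop
  have h3 : FP fun w => w.tl.rev := by fun_prop
  refine ⟨.seq h1.prog (.seq (.loop (.pair (.seq h2.prog hg.prog) (.seq .tl .tl))) h3.prog),
    ⟨h1.queryFree, ⟨⟨trivial, trivial⟩, ⟨h2.queryFree, hg.queryFree⟩, trivial, trivial⟩,
      h3.queryFree⟩, ?_, fun O v => ext_ev fun φ => ?_,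
    fun v => (memoryless_mapM (fun a => hg.memoryless (Val.cons v a)) _).map _⟩
  · obtain ⟨P, hP⟩ := hg.polyTime
    refine h1.polyTime.seq (Prog.PolyTime.seq (Prog.PolyTime.loop ((h2.polyTime.seq
      hg.polyTime).pair (Prog.polyTime_tl.seq Prog.polyTime_tl)) (P.comp (1 + X) + 1) ?_)
      h3.polyTime)
    rintro L x U z ⟨y, ⟨a', ha', b', hb', rfl⟩, w, ⟨a, ha, b, hb, rfl⟩, rfl⟩
    rw [Set.mem_singleton_iff.1 ha] at hb
    rw [Set.mem_singleton_iff.1 hb]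
    rw [h2.traces ha'] at hb'
    have h4 := hP _ _ _ hb'
    have h5 := Prog.size_le_cost _ hb'
    simp only [Val.tl_cons, Val.hd_cons, Val.size] at h4
    simp only [Val.tl_cons, Val.size, eval_add, eval_comp, eval_one, eval_X]
    rw [show 1 + (x.size + U.hd.size + L) = 1 + U.hd.size + x.size + L by ring]
    omega
  · have : ∀ (l acc : Val) (φ : Val → Bits → Bits → ℂ),
        ev ((Prog.loop (.pair (.seq h2.prog hg.prog) (.seq .tl .tl))).den O
          (Val.cons l (Val.cons v acc)) [] []) φ =
        ev (l.toList.mapM (g v)) fun rs _ _ =>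
          φ (Val.cons v (Val.ofList (rs.reverse ++ acc.toList))) [] [] := by
      intro l
      induction l with
      | nil => intro acc φ; rw [Prog.ev_loop_nil]; simp
      | cons x l _ ih =>
        intro acc φ
        rw [Prog.ev_loop_cons, Val.toList_cons, ev_mapM_cons, Prog.ev_pair, Prog.ev_seq, h2.ev_den,
          hg.den]
        refine (hg.memoryless (Val.cons v x)).ev_congr fun a => ?_
        simp only [Prog.den, ev_ket, ev_apply, Val.tl_cons, ih]
        simp
    rw [Prog.ev_seq, h1.ev_den, Prog.ev_seq, this, ev_map]
    refine (memoryless_mapM (fun a => hg.memoryless (Val.cons v a)) _).ev_congr fun a => ?_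
    rw [h3.ev_den]
    simp [Val.rev]

end FR

namespace Val

@[simp] theorem toBool_ofBool (b : Bool) : (ofBool b).toBool = b := by cases b <;> rfl

@[simp] theorem toBits_ofBits (w : Bits) : (ofBits w).toBits = w := by
  simp [ofBits, toBits, Function.comp_def]

@[simp] theorem ite_ofBool (b : Bool) (x y : Val) : ite (ofBool b) x y = if b then x else y := by
  cases b <;> rfl

theorem ite_eq_ofBool (v : Val) : ite v (cons nil nil) nil = ofBool v.toBool := by
  cases v <;> rfl

theorem size_ofBits_le (w : Bits) : (ofBits w).size ≤ 1 + 4 * w.length := by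
  induction w with
  | nil => simp [ofBits, ofList, size]
  | cons b w ih =>
    cases b <;> simp only [ofBits, List.map_cons, ofList, size, ofBool, List.length_cons] at ih ⊢ <;>
      omega

theorem size_drop_le (l i : Val) : (l.drop i).size ≤ l.size := by
  have h := size_ofList_append (l.toList.take i.toNat) (l.toList.drop i.toNat)
  rw [List.take_append_drop, ofList_toList] at h
  have := (ofList (l.toList.take i.toNat)).one_le_size
  simp only [drop]; omega

theorem drop_unary (m n : ℕ) : (unary m).drop (unary n) = unary (m - n) := by
  simp [drop, unary, toNat]

end Val

theorem fitBits_self {k : ℕ} {w : Bits} (h : w.length = k) : fitBits k w = w := by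
  simp [fitBits, ← h]

/-! ### Algorithms of the encryption scheme -/

namespace CertSKE

variable (S : CertSKE) {n : ℕ}

theorem memoryless_keyGen (n : ℕ) : Memoryless (S.keyGen n) := (memoryless_traceOut _).map _

theorem supp_keyGen (n : ℕ) :
    Supp (S.keyGen n) fun w _ _ => w.length = S.keyLen.eval n := by
  refine supp_map (supp_traceOut ?_)
  intro x hx _
  obtain ⟨w, h1, h2⟩ := S.keyGen_range n x hx
  simp [h2, h1]

/-- Total probability one, a consequence of trace preservation. It is needed where a key is chosen
and never used. -/
theorem ev_keyGen_const (n : ℕ) (c : ℂ) : (ev (S.keyGen n) fun _ _ _ => c) = c := by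
  have h := Prog.ev_den_trace (O := fun _ => pure Val.nil) S.keyGen_qpt.1 (Val.unary n)
    (s := []) (t := []) rfl
  have h2 := ev_mul_left c (S.KeyGen.run (Val.unary n) [] [])
    (fun _ s t => if s = t then 1 else 0)
  simp only [keyGen, ev_map, ev_traceOut]
  simp only [mul_ite, mul_one, mul_zero] at h2
  rw [h2, Prog.run, h]
  simp

theorem ev_run_enc {sk m : Bits} (hsk : sk.length = S.keyLen.eval n)
    (hm : m.length = S.keyLen.eval n) (φ : Val → Bits → Bits → ℂ) :
    ev (S.Enc.run (Val.cons (Val.unary n) (Val.cons (Val.ofBits sk) (Val.ofBits m))) [] []) φ =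
      ev (S.enc n sk m) fun vk s t => φ (Val.ofBits vk) s t := by
  rw [enc, ev_map]
  refine ev_congr (Q := fun u _ _ => ∃ w : Bits, u = Val.ofBits w)
    (fun x hx => ?_) fun u s t ⟨w, h⟩ => by simp [h]
  obtain ⟨⟨w, _, h⟩, _⟩ := S.enc_range n sk m hsk hm x hx
  exact ⟨w, h⟩

theorem supp_enc {sk m : Bits} (hsk : sk.length = S.keyLen.eval n)
    (hm : m.length = S.keyLen.eval n) :
    Supp (S.enc n sk m) fun vk s t => vk.length = S.vkLen.eval n ∧
      s.length = S.ctLen.eval n ∧ t.length = S.ctLen.eval n := by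
  refine supp_map fun x hx => ?_
  obtain ⟨⟨w, h1, h2⟩, h3⟩ := S.enc_range n sk m hsk hm x hx
  exact ⟨by simp [h2, h1], h3⟩

/-- Encryption of a list of plaintexts, each with its key. -/
def encList (n : ℕ) (l : List (Bits × Bits)) : CQ (List Bits) := l.mapM fun x => S.enc n x.1 x.2

/-- Keys and plaintexts of the right lengths. -/
def Fits (n : ℕ) (x : Bits × Bits) : Prop :=
  x.1.length = S.keyLen.eval n ∧ x.2.length = S.keyLen.eval n

theorem supp_encList {l : List (Bits × Bits)} (hl : ∀ x ∈ l, S.Fits n x) :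
    Supp (S.encList n l) fun vks s t =>
      (vks.length = l.length ∧ ∀ vk ∈ vks, vk.length = S.vkLen.eval n) ∧
      s.length = l.length * S.ctLen.eval n ∧ t.length = l.length * S.ctLen.eval n := by
  induction l with
  | nil => exact supp_pure (by simp)
  | cons a l ih =>
    have ha := hl a (by simp)
    rw [encList, List.mapM_cons]
    refine supp_bind (S.supp_enc ha.1 ha.2) fun vk s t h =>
      supp_bind (ih fun x hx => hl x (by simp [hx])) fun vks s' t' h' => supp_pure ?_
    simp only [List.length_cons, h'.1.1, List.mem_cons, forall_eq_or_imp, h.1, true_and,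
      List.length_append, h.2, h'.2, List.append_nil]
    exact ⟨h'.1.2, by ring, by ring⟩

/-! ### Encrypting a list of plaintexts -/

/-- An encryption task, with the key to be used, or `none` for the unknown key of an oracle. -/
def codeTask (x : Option Bits × Bits) : Val :=
  Val.cons (match x.1 with
    | none => Val.nil
    | some k => Val.cons Val.nil (Val.ofBits k)) (Val.ofBits x.2)

/-- Arranges the input of the body of the following loop so that the branch is taken according to
whether a key is present. The memory bound comes first, because it is the argument of `frame`: a
frame that skips the whole memory lets `Enc` run on fresh qubits. -/
theorem fp_encInput : FP fun b => Val.cons b.hd.hd (Val.cons b.tl.hd.tl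
    (Val.cons b.tl.hd.hd (Val.cons b.hd.hd.tl b.hd.tl))) := by fun_prop

theorem fp_encPlain : FP fun w => w.tl.tl.tl := by fun_prop

/-- Encrypt the plaintexts in a list of tasks, where `q` is used for the unknown key; the context
consists of `1ⁿ` and a bound for the size of the memory. The verification keys are collected in
reverse order. -/
def encAll (q : Prog) : Prog :=
  .loop (.pair (.seq fp_encInput.prog (.cond (.frame S.Enc) (.seq fp_encPlain.prog q)))
    (.seq .tl .tl))

theorem queryFree_encAll {q : Prog} (hq : q.QueryFree) : (S.encAll q).QueryFree :=
  ⟨⟨trivial, trivial⟩, ⟨fp_encInput.queryFree, S.enc_qpt.1, fp_encPlain.queryFree, hq⟩, trivial,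
    trivial⟩

theorem polyTime_encAll {q : Prog} (hq : q.PolyTime) : (S.encAll q).PolyTime := by
  have hc := (S.enc_qpt.2.frame.cond (fp_encPlain.polyTime.seq hq))
  have hp := (fp_encInput.polyTime.seq hc).pair (Prog.polyTime_tl.seq Prog.polyTime_tl)
  obtain ⟨P, hP⟩ := hc
  refine hp.loop (P.comp (6 + 4 * X) + 1) ?_
  rintro L x U z ⟨y, ⟨a', ha', b', hb', rfl⟩, w, ⟨a, ha, b, hb, rfl⟩, rfl⟩
  rw [Set.mem_singleton_iff.1 ha] at hb
  rw [Set.mem_singleton_iff.1 hb]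
  rw [fp_encInput.traces ha'] at hb'
  have h4 := hP _ _ _ hb'
  have h5 := Prog.size_le_cost _ hb'
  have h1 := x.size_hd_le
  have h2 := x.size_tl_le
  have h3 := x.hd.size_tl_le
  have h6 := U.hd.size_hd_le
  have h7 := U.hd.size_tl_le
  simp only [Val.tl_cons, Val.hd_cons, Val.size] at h4
  simp only [Val.tl_cons, Val.size, eval_add, eval_comp, eval_one, eval_X, eval_mul, eval_ofNat]
  have h8 := P.eval_nat_mono (show 1 + x.hd.size + (1 + U.hd.tl.size + (1 + U.hd.hd.size +
    (1 + x.hd.tl.size + x.tl.size))) + L ≤ 6 + 4 * (x.size + U.hd.size + L) by omega)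
  omega

/-- The hypothesis `hq` says that `q` acts as encryption under the unknown key `sk`. The number `M`
must bound the memory during the whole loop, so that each encryption runs behind all existing
qubits. -/
theorem ev_encAll {q : Prog} {O : Val → CQ Val} {sk : Bits} {M : Val}
    {l : List (Option Bits × Bits)} (hl : ∀ x ∈ l, S.Fits n (x.1.getD sk, x.2))
    (hq : ∀ x ∈ l, x.1 = none → ∀ s t φ, ev (q.den O (Val.ofBits x.2) s t) φ =
      ev (S.enc n sk x.2) fun vk s' t' => φ (Val.ofBits vk) (s ++ s') (t ++ t'))
    {s t : Bits} (hst : s.length = t.length)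
    (hM : s.length + l.length * S.ctLen.eval n ≤ M.toNat) (acc : Val)
    (φ : Val → Bits → Bits → ℂ) :
    ev ((S.encAll q).den O (Val.cons (Val.ofList (l.map codeTask))
      (Val.cons (Val.cons (Val.unary n) M) acc)) s t) φ =
    ev (S.encList n (l.map fun x => (x.1.getD sk, x.2))) fun vks s' t' =>
      φ (Val.cons (Val.cons (Val.unary n) M) (Val.ofList ((vks.map Val.ofBits).reverse ++
        acc.toList))) (s ++ s') (t ++ t') := by
  induction l generalizing s t acc with
  | nil =>
    rw [encAll, List.map_nil, Val.ofList, Prog.ev_loop_nil]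
    simp [encList]
  | cons x l ih =>
    rw [List.map_cons, Val.ofList, encAll, Prog.ev_loop_cons, ← encAll, Prog.ev_pair,
      Prog.ev_seq, fp_encInput.ev_den, encList, List.map_cons, ev_mapM_cons, ← encList]
    have hx := hl x (by simp)
    have key : ∀ ψ : Val → Bits → Bits → ℂ, ev ((Prog.cond (.frame S.Enc)
        (.seq fp_encPlain.prog q)).den O (Val.cons (codeTask x).hd (Val.cons M
          (Val.cons (Val.unary n) (Val.cons (codeTask x).hd.tl (codeTask x).tl)))) s t) ψ =
        ev (S.enc n (x.1.getD sk) x.2) fun vk s' t' => ψ (Val.ofBits vk) (s ++ s') (t ++ t') := by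
      intro ψ
      simp only [List.length_cons, add_mul] at hM
      obtain ⟨k, m⟩ := x
      match k with
      | none =>
        simp only [Prog.den, codeTask, Val.hd_cons, Val.isNil, if_true, Val.tl_cons, ev_apply,
          fp_encPlain.ev_den]
        rw [hq (none, m) (by simp) rfl]
        rfl
      | some k =>
        simp only [Prog.den, codeTask, Val.hd_cons, Val.isNil, Bool.false_eq_true, if_false,
          Val.tl_cons, ev_appendTo]
        rw [List.drop_of_length_le (by omega), List.drop_of_length_le (by omega),
          List.take_of_length_le (by omega), List.take_of_length_le (by omega),
          ← Prog.run_eq_den S.enc_qpt.1, S.ev_run_enc (sk := k) (m := m) hx.1 hx.2]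
        rfl
    refine (key _).trans (ev_congr (S.supp_enc hx.1 hx.2) fun vk s' t' hvk => ?_)
    simp only [Prog.den, ev_apply, ev_ket, Val.tl_cons]
    rw [ih (fun x hx => hl x (by simp [hx])) (fun x hx => hq x (by simp [hx]))
      (by simp [hst, hvk]) (by simp only [List.length_cons, add_mul] at hM; simp [hvk]; omega)]
    refine ev_fun_congr fun vks s'' t'' => ?_
    simp

theorem ev_query {sk m : Bits} (hm : m.length = S.keyLen.eval n) (s t : Bits)
    (φ : Val → Bits → Bits → ℂ) :
    ev (Prog.query.den (S.encOracle n sk) (Val.ofBits m) s t) φ =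
      ev (S.enc n sk m) fun vk s' t' => φ (Val.ofBits vk) (s ++ s') (t ++ t') := by
  simp [Prog.den, encOracle, fitBits_self hm]

end CertSKE

/-! ### The number of qubits -/

namespace Prog

variable {O : Val → CQ Val}

/-- Prepare a qubit in the state `|1⟩`; the memory must be empty. -/
def one : Prog :=
  .seq .new (.seq .gateH (.seq .gateT (.seq .gateT (.seq .gateT (.seq .gateT .gateH)))))

theorem polyTime_one : one.PolyTime :=
  polyTime_new.seq (polyTime_gateH.seq (polyTime_gateT.seq (polyTime_gateT.seq
    (polyTime_gateT.seq (polyTime_gateT.seq polyTime_gateH)))))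

theorem ev_gateT_singleton (x y : Bool) (φ : Val → Bits → Bits → ℂ) :
    ev (gateT.den O Val.nil [x] [y]) φ =
      tGate x x * star (tGate y y) * φ Val.nil [x] [y] := by
  cases x <;> cases y <;> simp [den, applyGate, Val.toNat, tGate]

theorem ev_gateH_singleton (x y : Bool) (φ : Val → Bits → Bits → ℂ) :
    ev (gateH.den O Val.nil [x] [y]) φ =
      ∑ a, ∑ b, hadamard a x * star (hadamard b y) * φ Val.nil [a] [b] := by
  simp only [den, applyGate, Val.toNat, Val.toList_nil, List.length_nil, List.getElem?_cons_zero,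
    ev_sum, ev_smul, ev_ket, List.set_cons_zero]

theorem tGate_pow_four : tGate true true ^ 4 = -1 := by
  simp only [tGate, if_true]
  rw [← Complex.exp_nat_mul, ← Complex.exp_pi_mul_I]
  congr 1
  push_cast
  ring

theorem ev_gateT_four (x y : Bool) (φ : Val → Bits → Bits → ℂ) :
    ev ((seq gateT (seq gateT (seq gateT (seq gateT gateH)))).den O Val.nil [x] [y]) φ =
      (if x then -1 else 1) * (if y then -1 else 1) * ev (gateH.den O Val.nil [x] [y]) φ := by
  have h4 := tGate_pow_four
  have h4' : (starRingEnd ℂ) (tGate true true) ^ 4 = -1 := by rw [← map_pow, h4]; simp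
  have h5 : tGate false false = 1 := by simp [tGate]
  simp only [ev_seq, ev_gateT_singleton, Complex.star_def]
  have h (x : Bool) : tGate x x ^ 4 = if x then -1 else 1 := by cases x <;> simp [h4, h5]
  have h' (x : Bool) : (starRingEnd ℂ) (tGate x x) ^ 4 = if x then -1 else 1 := by
    cases x <;> simp [h4', h5]
  rw [← h, ← h']
  ring

/-- The fourth power of the `π/8` gate is the Pauli matrix `Z`, and conjugation with Hadamard gates
turns it into `X`, which flips the new qubit. -/
theorem ev_one (φ : Val → Bits → Bits → ℂ) :
    ev (one.den O Val.nil [] []) φ = φ Val.nil [true] [true] := by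
  have h : ((Real.sqrt 2 : ℝ) : ℂ) ^ 2 = 2 := by
    rw [← Complex.ofReal_pow, Real.sq_sqrt (by norm_num)]; simp
  have h0 : ((Real.sqrt 2 : ℝ) : ℂ) ≠ 0 := by simp
  rw [one, ev_seq]
  simp only [show new.den O Val.nil [] [] = ket Val.nil [false] [false] from rfl, ev_ket]
  rw [ev_seq, ev_gateH_singleton]
  simp only [ev_gateT_four, ev_gateH_singleton, Fintype.sum_bool]
  simp only [hadamard, Bool.and_true, Bool.and_false, if_true, if_false,
    Bool.false_eq_true, Complex.star_def, Complex.conj_ofReal, map_div₀, map_one, map_neg]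
  generalize ((Real.sqrt 2 : ℝ) : ℂ) = r at *
  have h2 : (1 / r) ^ 2 = 1 / 2 := by rw [div_pow, h]; norm_num
  rw [neg_div]
  generalize 1 / r = u at *
  -- The two paths to `1` give the amplitude `2u²`, so the weight is `4u⁴`, and `4u⁴ - 1 = (4u² +
  -- 2)(u² - 1/2)`. The other entries cancel.
  linear_combination (4 * u ^ 2 + 2) * φ Val.nil [true] [true] * h2

theorem fp_finderInput : FP fun b => Val.cons b.tl.tl (Val.cons b.tl.tl b.hd) := by fun_prop

/-- Measure the qubits at the given positions, until the outcome is `1`; then remove this qubit and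
return its position. -/
def finder : Prog :=
  .loop (.seq fp_finderInput.prog (.cond .hd (.seq .tl (.seq (.pair .meas .skip)
    (.cond (.pair .nil .discard) .nil)))))

theorem polyTime_finder : finder.PolyTime := by
  refine PolyTime.loop (fp_finderInput.polyTime.seq (polyTime_hd.cond (polyTime_tl.seq
    ((polyTime_meas.pair polyTime_skip).seq
      ((polyTime_nil.pair polyTime_discard).cond polyTime_nil))))) (X + 2) ?_
  rintro L x U z ⟨a, ha, b, hb, rfl⟩
  rw [fp_finderInput.traces ha] at hb
  obtain ⟨c, hc, rfl⟩ := hb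
  have := U.tl.one_le_size
  simp only [eval_add, eval_X, eval_ofNat]
  split at hc
  · obtain ⟨d, hd, e, ⟨f, ⟨f1, hf1, f2, hf2, rfl⟩, g, ⟨k, hk, rfl⟩, rfl⟩, rfl⟩ := hc
    rw [Set.mem_singleton_iff.1 hd] at hf2
    rw [Set.mem_singleton_iff.1 hf2] at hk
    simp only
    split at hk
    · rw [Set.mem_singleton_iff.1 hk]; simp only [Val.size]; omega
    · obtain ⟨k1, hk1, k2, hk2, rfl⟩ := hk
      rw [Set.mem_singleton_iff.1 hk1, Set.mem_singleton_iff.1 hk2]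
      simp only [Val.size, Val.tl_cons, Val.hd_cons]; omega
  · rw [Set.mem_singleton_iff.1 hc]
    simp only [Val.hd_cons, Val.tl_cons]; omega

/-- The numbers `k - 1, …, 0`. -/
def countdown (k : ℕ) : List Val := (List.range k).reverse.map Val.unary

theorem ev_finder_found (l : List Val) (c x : Val) (s t : Bits) (φ : Val → Bits → Bits → ℂ) :
    ev (finder.den O (Val.cons (Val.ofList l) (Val.cons c (Val.cons Val.nil x))) s t) φ =
      φ (Val.cons c (Val.cons Val.nil x)) s t := by
  induction l with
  | nil => rw [Val.ofList, finder, ev_loop_nil]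
  | cons a l ih =>
    rw [Val.ofList, finder, ev_loop_cons, ← finder, ev_seq, fp_finderInput.ev_den]
    simpa [den, Val.isNil] using ih

/-- Positions are tried from above. Positions behind the memory give no outcome, so the first
outcome `1` is that of the marker at the end, and no other qubit is ever measured. Removing the
marker restores the memory. -/
theorem ev_finder {k : ℕ} (c : Val) {s t : Bits} (hst : s.length = t.length) (hk : s.length < k)
    (φ : Val → Bits → Bits → ℂ) :
    ev (finder.den O (Val.cons (Val.ofList (countdown k)) (Val.cons c Val.nil))
      (s ++ [true]) (t ++ [true])) φ =
      φ (Val.cons c (Val.cons Val.nil (Val.unary s.length))) s t := by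
  induction k with
  | zero => omega
  | succ k ih =>
    have hc : countdown (k + 1) = Val.unary k :: countdown k := by
      simp [countdown, List.range_succ]
    rw [hc, Val.ofList, finder, ev_loop_cons, ← finder, ev_seq, fp_finderInput.ev_den]
    rcases Nat.lt_succ_iff_lt_or_eq.1 hk with h | h
    · rw [← ih h]
      have h1 : (s ++ [true])[k]? = none := by simp; omega
      simp [den, Val.isNil, h1]
    · subst h
      have h2 : (t ++ [true])[s.length]? = some true := by rw [hst]; simp
      have h3 : (t ++ [true]).eraseIdx s.length = t := by
        rw [hst, List.eraseIdx_append_of_length_le (by simp)]; simp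
      have h4 : (s ++ [true]).eraseIdx s.length = s := by
        rw [List.eraseIdx_append_of_length_le (by simp)]; simp
      simp [den, Val.isNil, h2, h3, h4, Val.ofBool, ev_finder_found]

/-- Move the qubits at a given position, one after the other, to the end. -/
def moves : Prog := .loop (.seq (.seq .tl .hd) .move)

theorem polyTime_moves : moves.PolyTime := by
  refine PolyTime.loop ((polyTime_tl.seq polyTime_hd).seq polyTime_move) X ?_
  rintro L x U z ⟨a, ⟨b, hb, c, hc, rfl⟩, d, hd, rfl⟩
  rw [Set.mem_singleton_iff.1 hb] at hc
  rw [Set.mem_singleton_iff.1 hc] at hd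
  rw [Set.mem_singleton_iff.1 hd]
  simp; omega

theorem eraseIdx_middle {s₁ s₂ : Bits} {x : Bool} {o : ℕ} (h : s₁.length = o) :
    (s₁ ++ x :: s₂).eraseIdx o ++ (s₁ ++ x :: s₂)[o]?.toList = s₁ ++ s₂ ++ [x] := by
  subst h
  rw [List.eraseIdx_append_of_length_le (by simp)]
  simp

/-- The position stays the same while the block shrinks, because each move brings the next qubit of
the block to this position. -/
theorem ev_moves (k o : Val) {s₁ t₁ s₂ t₂ : Bits} (s₃ t₃ : Bits) (u : Val)
    (hs₁ : s₁.length = o.toNat) (ht₁ : t₁.length = o.toNat)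
    (hs₂ : s₂.length = k.toNat) (ht₂ : t₂.length = k.toNat) (ψ : Bits → Bits → ℂ) :
    (ev (moves.den O (Val.cons k (Val.cons o u)) (s₁ ++ s₂ ++ s₃) (t₁ ++ t₂ ++ t₃))
      fun _ s t => ψ s t) = ψ (s₁ ++ s₃ ++ s₂) (t₁ ++ t₃ ++ t₂) := by
  induction k generalizing s₂ t₂ s₃ t₃ u with
  | nil =>
    simp only [Val.toNat, Val.toList_nil, List.length_nil, List.length_eq_zero_iff] at hs₂ ht₂
    subst hs₂ ht₂
    rw [moves, ev_loop_nil]; simp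
  | cons a k _ ih =>
    obtain ⟨x, s₂, rfl⟩ := List.exists_cons_of_length_eq_add_one (n := k.toNat) hs₂
    obtain ⟨y, t₂, rfl⟩ := List.exists_cons_of_length_eq_add_one (n := k.toNat) ht₂
    rw [moves, ev_loop_cons, ← moves]
    have h1 := eraseIdx_middle (s₁ := s₁) (s₂ := s₂ ++ s₃) (x := x) hs₁
    have h2 := eraseIdx_middle (s₁ := t₁) (s₂ := t₂ ++ t₃) (x := y) ht₁
    simp only [den, ket_apply, ev_ket, Val.tl_cons, Val.hd_cons, List.append_assoc,
      List.cons_append] at h1 h2 ⊢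
    rw [h1, h2]
    have := ih (s₂ := s₂) (t₂ := t₂) (s₃ ++ [x]) (t₃ ++ [y]) o
      (by simpa [Val.toNat] using hs₂) (by simpa [Val.toNat] using ht₂)
    simpa [List.append_assoc] using this

end Prog

namespace Prog

variable {O : Val → CQ Val}

theorem fp_markInput : FP fun b => Val.cons b Val.nil := by fun_prop

theorem fp_countdown : FP fun b => Val.cons
    (((Val.cons Val.nil b.hd).zipIdx.map fun x => x.tl).rev) (Val.cons Val.nil Val.nil) := by
  fun_prop

theorem fp_tltl : FP fun b => b.tl.tl := by fun_prop

/-- The number of qubits, which must be at most the input. -/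
def memLen : Prog :=
  .seq (.pair .skip (.seq fp_markInput.prog (.frame one)))
    (.seq fp_countdown.prog (.seq finder fp_tltl.prog))

theorem polyTime_memLen : memLen.PolyTime :=
  (polyTime_skip.pair (fp_markInput.polyTime.seq polyTime_one.frame)).seq
    (fp_countdown.polyTime.seq (polyTime_finder.seq fp_tltl.polyTime))

/-- There is no instruction for the number of qubits. It is found by preparing a qubit in the state
`1` behind the memory and searching for it from an upper bound downwards. -/
theorem ev_memLen {M : Val} {s t : Bits} (hst : s.length = t.length) (hM : s.length ≤ M.toNat)
    (φ : Val → Bits → Bits → ℂ) :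
    ev (memLen.den O M s t) φ = φ (Val.unary s.length) s t := by
  have h : ((Val.cons Val.nil M).zipIdx.map fun x => x.tl).rev =
      Val.ofList (countdown (M.toNat + 1)) := by
    simp only [Val.zipIdx, Val.map, Val.rev, Val.toList_ofList, List.map_map, Function.comp_def,
      Val.tl_cons, countdown, List.map_reverse]
    congr 2
    rw [show (fun x : Val × ℕ => Val.unary x.2) = Val.unary ∘ Prod.snd from rfl, ← List.map_map,
      List.zipIdx_map_snd]
    simp [Val.toNat, List.range_eq_range']
  rw [memLen, ev_seq, ev_pair]
  simp only [den, ev_ket, ev_apply, fp_markInput.ev_den, ev_appendTo, Val.hd_cons, Val.tl_cons]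
  rw [List.drop_of_length_le hM, List.drop_of_length_le (hst ▸ hM), List.take_of_length_le hM,
    List.take_of_length_le (hst ▸ hM), ev_one, fp_countdown.ev_den, Val.hd_cons, h,
    ev_finder _ hst (by omega), fp_tltl.ev_den]
  rfl

end Prog

/-! ### Verifying a sequence of certificates -/

namespace CertSKE

variable (S : CertSKE) {n : ℕ} {O : Val → CQ Val}

theorem ev_vrfy (vk s t : Bits) (φ : Bool → Bits → Bits → ℂ) :
    ev (S.vrfy n vk s t) φ =
      ev (S.Vrfy.run (Val.cons (Val.unary n) (Val.ofBits vk)) s t).traceOut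
        fun v s t => φ v.toBool s t := by
  rw [vrfy, ev_map]

theorem memoryless_vrfy (vk s t : Bits) : Memoryless (S.vrfy n vk s t) :=
  (memoryless_traceOut _).map _

/-- The weight with which the certificates in the memory are accepted. -/
def vrfyProd (n : ℕ) : List Bits → Bits → Bits → ℂ
  | [], _, _ => 1
  | vk :: vks, s, t =>
    let c := S.certLen.eval n
    (ev (S.vrfy n vk (s.take c) (t.take c)) fun ok _ _ => if ok then 1 else 0) *
      vrfyProd n vks (s.drop c) (t.drop c)

/-- The verifications act on disjoint groups of qubits and leave nothing behind, so their weights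
multiply. This allows the factor of the challenge to be isolated. -/
theorem vrfyProd_append (vks vks' : List Bits) (s t : Bits) :
    S.vrfyProd n (vks ++ vks') s t = S.vrfyProd n vks s t *
      S.vrfyProd n vks' (s.drop (vks.length * S.certLen.eval n))
        (t.drop (vks.length * S.certLen.eval n)) := by
  induction vks generalizing s t with
  | nil => simp [vrfyProd]
  | cons vk vks ih =>
    simp only [List.cons_append, vrfyProd, ih, List.drop_drop, List.length_cons, add_mul, one_mul,
      mul_assoc]
    rw [add_comm (S.certLen.eval n)]

theorem vrfyProd_take (vks : List Bits) {k : ℕ} (hk : vks.length * S.certLen.eval n ≤ k)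
    (s t : Bits) : S.vrfyProd n vks (s.take k) (t.take k) = S.vrfyProd n vks s t := by
  induction vks generalizing s t k with
  | nil => simp [vrfyProd]
  | cons vk vks ih =>
    simp only [List.length_cons, add_mul, one_mul] at hk
    simp only [vrfyProd, List.take_take, List.drop_take, show min (S.certLen.eval n) k =
      S.certLen.eval n by omega]
    rw [ih (by omega)]

/-- All certificates have to be accepted: as soon as one is rejected, the conjunction is false and
the branch contributes nothing. -/
theorem ev_vrfyAll (vks : List Bits) (s t : Bits) (c : ℂ) :
    (ev (S.vrfyAll n vks s t) fun ok _ _ => if ok then c else 0) = S.vrfyProd n vks s t * c := by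
  induction vks generalizing s t c with
  | nil => simp [vrfyAll, vrfyProd]
  | cons vk vks ih =>
    simp only [vrfyAll, vrfyProd, ev_bind, ev_pure]
    rw [mul_assoc, ← ih, ← ev_mul_right]
    refine ev_fun_congr fun ok _ _ => ?_
    cases ok
    · simp [ev_fun_zero]
    · simp

/-- The time of `Vrfy`, plus the length of its input. -/
def vrfyBound : Polynomial ℕ :=
  S.certLen + S.vrfy_qpt.2.choose.comp (3 + 2 * X + 4 * S.vkLen)

theorem vrfyBound_spec {vk : Bits} (hvk : vk.length = S.vkLen.eval n) :
    ∀ z ∈ S.Vrfy.traces 0 (Val.cons (Val.unary n) (Val.ofBits vk)),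
      S.certLen.eval n + z.2 ≤ S.vrfyBound.eval n := by
  intro z hz
  have h1 := S.vrfy_qpt.2.choose_spec 0 _ z hz
  have h2 := Val.size_ofBits_le vk
  have h3 := S.vrfy_qpt.2.choose.eval_nat_mono
    (show (Val.cons (Val.unary n) (Val.ofBits vk)).size + 0 ≤ 3 + 2 * n + 4 * S.vkLen.eval n by
      simp only [Val.size, Val.size_unary]; omega)
  simp only [vrfyBound, eval_add, eval_comp, eval_mul, eval_ofNat, eval_X]
  omega

theorem fp_movesInput : FP fun b =>
    Val.cons b.tl.hd.tl.hd (Val.cons b.tl.hd.tl.tl.hd Val.nil) := by fun_prop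

theorem fp_vrfyInput : FP fun w => Val.cons (w.hd.tl.tl.hd.drop w.hd.tl.hd.tl.hd)
    (Val.cons w.hd.tl.hd.tl.tl.tl (Val.cons w.hd.tl.hd.hd w.hd.hd)) := by fun_prop

theorem fp_vrfyOutput : FP fun w => Val.cons (w.hd.tl.tl.hd.drop w.hd.tl.hd.tl.hd)
    (Val.ite w.hd.tl.tl.tl (Val.ite w.tl (Val.cons Val.nil Val.nil) Val.nil) Val.nil) := by
  fun_prop

/-- Verification of one certificate: the body of the following loop. -/
def vrfyStep : Prog :=
  .seq (.pair .skip (.seq fp_movesInput.prog .moves))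
    (.seq (.pair .hd (.seq fp_vrfyInput.prog (.frame (.traced S.Vrfy)))) fp_vrfyOutput.prog)

/-- Verify and remove certificates, for the verification keys in the given list. The context
`(1ⁿ, (c, (o, T)))` consists of the length `c` of a certificate, the position `o` of the first one,
and a bound `T` for the memory that is used for the verification. The accumulator `(m, ok)` consists
of the number of qubits and the result so far. -/
def vrfyLoop : Prog := .loop S.vrfyStep

theorem polyTime_vrfyLoop : S.vrfyLoop.PolyTime := by
  refine Prog.PolyTime.loop ((Prog.polyTime_skip.pair (fp_movesInput.polyTime.seq
    Prog.polyTime_moves)).seq ((Prog.polyTime_hd.pair (fp_vrfyInput.polyTime.seq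
      S.vrfy_qpt.2.traced.frame)).seq fp_vrfyOutput.polyTime)) 6 ?_
  rintro L x U z ⟨a, ⟨b, hb, c, hc, rfl⟩, d, ⟨e, ⟨f, hf, g, hg, rfl⟩, k, hk, rfl⟩, rfl⟩
  have h1 := fp_vrfyOutput.traces hk
  rw [Set.mem_singleton_iff.1 hb] at hf
  rw [Set.mem_singleton_iff.1 hf] at h1
  simp only [h1, Val.hd_cons, Val.tl_cons, Val.size, eval_ofNat]
  have h2 := U.tl.hd.size_drop_le U.hd.tl.hd
  have h3 := U.tl.size_hd_le
  have h4 : ∀ a b : Val, (Val.ite a (Val.ite b (Val.cons Val.nil Val.nil) Val.nil) Val.nil).size ≤ 3 := by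
    intro a b
    unfold Val.ite
    split
    · simp [Val.size]
    · split <;> simp [Val.size]
  have := h4 U.tl.tl g.1
  omega

/-- The certificate is moved to the end of the memory and verified there inside a frame, with
everything traced out afterwards. The frame starts at `m - certLen`, which is why the accumulator
keeps track of the number of qubits. -/
theorem ev_vrfyStep {vk : Bits} (hvk : vk.length = S.vkLen.eval n) {o m : ℕ} (ok : Bool)
    {s₁ t₁ s₂ t₂ s₃ t₃ : Bits} (hs₁ : s₁.length = o) (ht₁ : t₁.length = o)
    (hs₂ : s₂.length = S.certLen.eval n) (ht₂ : t₂.length = S.certLen.eval n)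
    (hst : s₃.length = t₃.length) (hm : m = (s₁ ++ s₂ ++ s₃).length)
    (φ : Val → Bits → Bits → ℂ) :
    ev (S.vrfyStep.den O (Val.cons (Val.ofBits vk) (Val.cons (Val.cons (Val.unary n)
      (Val.cons (Val.unary (S.certLen.eval n)) (Val.cons (Val.unary o)
        (Val.unary (S.vrfyBound.eval n))))) (Val.cons (Val.unary m) (Val.ofBool ok))))
        (s₁ ++ s₂ ++ s₃) (t₁ ++ t₂ ++ t₃)) φ =
      ev (S.vrfy n vk s₂ t₂) fun r _ _ =>
        φ (Val.cons (Val.unary (m - S.certLen.eval n)) (Val.ofBool (ok && r)))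
          (s₁ ++ s₃) (t₁ ++ t₃) := by
  rw [vrfyStep, Prog.ev_seq, Prog.ev_pair]
  simp only [Prog.den, ev_ket, ev_apply, fp_movesInput.ev_den, Val.hd_cons, Val.tl_cons,
    fp_vrfyInput.ev_den, Val.drop_unary, Val.toNat_unary, ev_appendTo, fp_vrfyOutput.ev_den]
  rw [Prog.ev_moves (s₁ := s₁) (t₁ := t₁) (s₂ := s₂) (t₂ := t₂) _ _ s₃ t₃ _ (by simpa)
    (by simpa) (by simpa) (by simpa)]
  have h1 : m - S.certLen.eval n = (s₁ ++ s₃).length := by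
    rw [hm]; simp [hs₂]; omega
  have h2 : m - S.certLen.eval n = (t₁ ++ t₃).length := by
    rw [h1]; simp [hs₁, ht₁, hst]
  rw [List.drop_left' h1.symm, List.drop_left' h2.symm, List.take_left' h1.symm,
    List.take_left' h2.symm, Prog.ev_traced S.vrfy_qpt.1 _ _ (by rw [hs₂, ht₂])
    (by simpa [hs₂] using S.vrfyBound_spec hvk), S.ev_vrfy]
  refine (memoryless_traceOut _).ev_congr fun a => ?_
  simp only [List.append_nil, Val.ite_eq_ofBool, Val.ite_ofBool]
  cases ok <;> rfl

/-- The first `o` qubits are left in place. Only functionals that vanish after a rejection are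
considered, so that the weights of the accepted certificates can be pulled out one after the other.
-/
theorem ev_vrfyLoop {vks : List Bits} (hvks : ∀ vk ∈ vks, vk.length = S.vkLen.eval n) {o m : ℕ}
    (ok : Bool) {s₁ t₁ s₂ t₂ : Bits} (hs₁ : s₁.length = o) (ht₁ : t₁.length = o)
    (hst : s₂.length = t₂.length) (hle : vks.length * S.certLen.eval n ≤ s₂.length)
    (hm : m = (s₁ ++ s₂).length) (φ : Bits → Bits → ℂ) (ψ : Val → Bits → Bits → ℂ)
    (hψ : ∀ c m ok s t, ψ (Val.cons c (Val.cons m (Val.ofBool ok))) s t = if ok then φ s t else 0) :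
    ev (S.vrfyLoop.den O (Val.cons (Val.ofList (vks.map Val.ofBits))
      (Val.cons (Val.cons (Val.unary n)
      (Val.cons (Val.unary (S.certLen.eval n)) (Val.cons (Val.unary o)
        (Val.unary (S.vrfyBound.eval n))))) (Val.cons (Val.unary m) (Val.ofBool ok))))
        (s₁ ++ s₂) (t₁ ++ t₂)) ψ =
      if ok then S.vrfyProd n vks s₂ t₂ * φ (s₁ ++ s₂.drop (vks.length * S.certLen.eval n))
        (t₁ ++ t₂.drop (vks.length * S.certLen.eval n)) else 0 := by
  induction vks generalizing s₂ t₂ m ok with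
  | nil => rw [List.map_nil, Val.ofList, vrfyLoop, Prog.ev_loop_nil, hψ]; simp [vrfyProd]
  | cons vk vks ih =>
    set c := S.certLen.eval n with hc
    simp only [List.length_cons, add_mul, one_mul] at hle
    have h1 := S.ev_vrfyStep (O := O) (hvks vk (by simp)) (m := m) ok hs₁ ht₁
      (s₂ := s₂.take c) (t₂ := t₂.take c) (s₃ := s₂.drop c) (t₃ := t₂.drop c)
      (by simp [← hc]; omega) (by simp [← hc, ← hst]; omega) (by simp [hst])
      (by rw [List.append_assoc, List.take_append_drop]; exact hm)
    simp only [List.append_assoc, List.take_append_drop, ← hc] at h1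
    rw [List.map_cons, Val.ofList, vrfyLoop, Prog.ev_loop_cons, ← vrfyLoop, h1]
    have h2 : ∀ r : Bool, _ := fun r => ih (fun x hx => hvks x (by simp [hx])) (ok && r)
      (s₂ := s₂.drop c) (t₂ := t₂.drop c) (m := m - c) (by simp [hst]) (by simp; omega)
      (by rw [hm]; simp; omega)
    simp only [h2, vrfyProd, List.drop_drop, List.length_cons, add_mul, one_mul, ← hc]
    cases ok
    · simp [ev_fun_zero]
    · simp only [Bool.true_and, if_true]
      rw [add_comm c, mul_assoc, ← ev_mul_right]
      refine ev_fun_congr fun r _ _ => ?_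
      split <;> simp

end CertSKE

/-! ### Symbolic descriptions of ciphertexts relative to the active keys -/

/-- The key with index `a` of a wire. -/
def wireKey (K : List (Bits × Bits)) (w : ℕ) (a : Bool) : Bits := sel (K.getD w ([], [])) a

/-- Description of a ciphertext in a garbled circuit: the plaintext `pad`, xored with the key with
index `bit` of the wire `out` if `carry`, is encrypted with the key with index `side` of the wire
`wire`. -/
structure Spec where
  wire : ℕ
  side : Bool
  pad : Bits
  out : ℕ
  carry : Bool
  bit : Bool

namespace Spec

/-- The simulated ciphertext, which does not depend on the function of the gate. -/
def zero (x : Spec) : Spec := { x with bit := false }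

/-- Key and plaintext of the ciphertext. -/
def task (K : List (Bits × Bits)) (x : Spec) : Bits × Bits :=
  (wireKey K x.wire x.side,
    if x.carry then CertSKE.xorBits x.pad (wireKey K x.out x.bit) else x.pad)

end Spec

/-- A gate given by its wires and its truth table. -/
structure Slot where
  inA : ℕ
  inB : ℕ
  out : ℕ
  table : Bits

namespace Slot

def fn (r : Slot) (a b : Bool) : Bool :=
  r.table.getD ((if a then 2 else 0) + (if b then 1 else 0)) false

/-- The two ciphertexts for an entry of the truth table. -/
def specs (r : Slot) (e : Bool × Bool) (P : Bits) : List Spec :=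
  [⟨r.inA, e.1, P, r.out, e.1, r.fn e.1 e.2⟩, ⟨r.inB, e.2, P, r.out, !e.1, r.fn e.1 e.2⟩]

/-- The same gate with the constant function `0`. -/
def zero (r : Slot) : Slot := { r with table := [] }

end Slot

/-- Exchange the components of the pairs at the given places. -/
def swapPairs (w : Bits) (K : List (Bits × Bits)) : List (Bits × Bits) :=
  List.zipWith (fun b k => if b then (k.2, k.1) else k) w K

/-- Holds for all indices: outside of the list both sides are the empty default. -/
theorem sel_swapPairs {w : Bits} {K : List (Bits × Bits)} (h : w.length = K.length) (i : ℕ)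
    (a : Bool) : sel ((swapPairs w K).getD i ([], [])) a = wireKey K i (xor a (w.getD i false)) := by
  by_cases hi : i < K.length
  · have hi' : i < w.length := h ▸ hi
    simp only [swapPairs, wireKey, List.getD_eq_getElem?_getD, List.getElem?_zipWith,
      List.getElem?_eq_getElem hi, List.getElem?_eq_getElem hi']
    cases w[i] <;> cases a <;> simp [sel]
  · have hi' : ¬ i < w.length := h ▸ hi
    simp only [swapPairs, wireKey, List.getD_eq_getElem?_getD, List.getElem?_zipWith,
      List.getElem?_eq_none (not_lt.1 hi), List.getElem?_eq_none (not_lt.1 hi')]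
    cases a <;> simp [sel]

namespace CertSKE

variable (S : CertSKE) {n : ℕ}

/-- All keys have the right length. -/
def FitKeys (n : ℕ) (K : List (Bits × Bits)) : Prop :=
  ∀ k ∈ K, k.1.length = S.keyLen.eval n ∧ k.2.length = S.keyLen.eval n

theorem FitKeys.length_wireKey {S : CertSKE} {K : List (Bits × Bits)} (h : S.FitKeys n K) {w : ℕ}
    (hw : w < K.length) (a : Bool) : (wireKey K w a).length = S.keyLen.eval n := by
  have := h _ (List.getElem_mem hw)
  simp only [wireKey, List.getD_eq_getElem?_getD, List.getElem?_eq_getElem hw, Option.getD_some]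
  cases a
  · exact this.1
  · exact this.2

/-! ### Sampling keys -/

/-- A pair of keys. -/
def keyPair (n : ℕ) : CQ (Bits × Bits) := do
  let k₀ ← S.keyGen n
  let k₁ ← S.keyGen n
  return (k₀, k₁)

theorem memoryless_keyPair (n : ℕ) : Memoryless (S.keyPair n) :=
  (S.memoryless_keyGen n).bind fun _ => (S.memoryless_keyGen n).bind fun _ => memoryless_pure _

theorem keyPairs_eq (n : ℕ) {α : Type} (l : List α) :
    S.keyPairs n l.length = l.mapM fun _ => S.keyPair n := by
  have h : ∀ l : List α, (l.mapM fun _ => S.keyPair n) =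
      (List.replicate l.length ()).mapM fun _ => S.keyPair n := by
    intro l
    induction l with
    | nil => rfl
    | cons a l ih => simp only [List.mapM_cons, List.length_cons, List.replicate_succ, ih]
  rw [h]
  have h' : ∀ l : List ℕ, (l.mapM fun _ => S.keyPair n) =
      (List.replicate l.length ()).mapM fun _ => S.keyPair n := by
    intro l
    induction l with
    | nil => rfl
    | cons a l ih => simp only [List.mapM_cons, List.length_cons, List.replicate_succ, ih]
  have := h' (List.range l.length)
  rw [List.length_range] at this
  exact this

theorem memoryless_keyPairs (n N : ℕ) : Memoryless (S.keyPairs n N) :=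
  memoryless_mapM (fun _ => S.memoryless_keyPair n) _

theorem supp_keyPair (n : ℕ) : Supp (S.keyPair n) fun k _ _ =>
    k.1.length = S.keyLen.eval n ∧ k.2.length = S.keyLen.eval n :=
  supp_bind (S.supp_keyGen n) fun _ _ _ h => supp_bind (S.supp_keyGen n) fun _ _ _ h' =>
    supp_pure ⟨h, h'⟩

theorem supp_keyPairs (n N : ℕ) :
    Supp (S.keyPairs n N) fun K _ _ => K.length = N ∧ S.FitKeys n K := by
  have := supp_mapM (l := List.range N) fun _ _ => S.supp_keyPair n
  rw [List.length_range] at this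
  exact this

theorem ev_keyPair (n : ℕ) (φ : Bits × Bits → ℂ) :
    (ev (S.keyPair n) fun k _ _ => φ k) =
      ev (S.keyGen n) fun k₀ _ _ => ev (S.keyGen n) fun k₁ _ _ => φ (k₀, k₁) := by
  simp [keyPair]

theorem ev_keyPairs_succ (n N : ℕ) (φ : List (Bits × Bits) → ℂ) :
    (ev (S.keyPairs n (N + 1)) fun K _ _ => φ K) =
      ev (S.keyPair n) fun k _ _ => ev (S.keyPairs n N) fun K _ _ => φ (k :: K) := by
  have h1 := S.keyPairs_eq n (List.replicate N ())
  have h2 := S.keyPairs_eq n (List.replicate (N + 1) ())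
  rw [List.length_replicate] at h1 h2
  rw [h1, h2, List.replicate_succ, ev_mapM_cons]

theorem ev_keyPairs_add (n a b : ℕ) (φ : List (Bits × Bits) → ℂ) :
    (ev (S.keyPairs n (a + b)) fun K _ _ => φ K) =
      ev (S.keyPairs n a) fun K _ _ => ev (S.keyPairs n b) fun K' _ _ => φ (K ++ K') := by
  induction a generalizing φ with
  | zero => simp [keyPairs]
  | succ a ih =>
    rw [show a + 1 + b = a + b + 1 by ring, ev_keyPairs_succ, ev_keyPairs_succ]
    refine ev_fun_congr fun k _ _ => ?_
    rw [ih]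
    rfl

/-- The two keys of a pair are independent with the same distribution. With `w` the list of wire
values, this makes the active key of each wire the one with index 0. -/
theorem ev_keyPairs_swap (w : Bits) (φ : List (Bits × Bits) → ℂ) :
    (ev (S.keyPairs n w.length) fun K _ _ => φ K) =
      ev (S.keyPairs n w.length) fun K _ _ => φ (swapPairs w K) := by
  induction w generalizing φ with
  | nil => simp [keyPairs, swapPairs]
  | cons b w ih =>
    rw [List.length_cons, ev_keyPairs_succ, ev_keyPairs_succ]
    simp only [swapPairs, List.zipWith_cons_cons]
    simp only [swapPairs] at ih
    cases b
    · exact ev_fun_congr fun k _ _ => ih _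
    · rw [S.ev_keyPair n fun k => ev (S.keyPairs n w.length) fun K _ _ => φ (k :: K),
        S.ev_keyPair n fun k => ev (S.keyPairs n w.length) fun K _ _ =>
          φ ((if true = true then (k.2, k.1) else k) :: List.zipWith _ w K), ev_comm]
      exact ev_fun_congr fun k _ _ => ev_fun_congr fun k _ _ => ih _

/-- Complete each key to a pair with a new key. -/
def completePairs (n : ℕ) (l : List Bits) : CQ (List (Bits × Bits)) :=
  l.mapM fun k => do
    let k' ← S.keyGen n
    return (k, k')

/-- Choosing keys again does not change the distribution. -/
theorem ev_keyPairs_complete (x : Bits) (φ : List (Bits × Bits) → ℂ) :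
    (ev (S.keyPairs n x.length) fun K _ _ =>
      ev (S.completePairs n (GarblingScheme.activeLabels K x)) fun K' _ _ => φ K') =
      ev (S.keyPairs n x.length) fun K _ _ => φ K := by
  induction x generalizing φ with
  | nil => simp [keyPairs, GarblingScheme.activeLabels, completePairs]
  | cons b x ih =>
    rw [List.length_cons, ev_keyPairs_succ, ev_keyPairs_succ]
    have h1 : ∀ k : Bits × Bits, (ev (S.keyPairs n x.length) fun K _ _ =>
        ev (S.completePairs n (GarblingScheme.activeLabels (k :: K) (b :: x))) fun K' _ _ => φ K') =
        ev (S.keyGen n) fun k' _ _ => ev (S.keyPairs n x.length) fun K _ _ =>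
          φ ((sel k b, k') :: K) := by
      intro k
      simp only [GarblingScheme.activeLabels, completePairs, List.zipWith_cons_cons, ev_mapM_cons,
        ev_bind, ev_pure] at ih ⊢
      rw [ev_comm]
      exact ev_fun_congr fun k' _ _ => ih _
    simp only [h1]
    rw [S.ev_keyPair n fun k => ev (S.keyGen n) fun k' _ _ => ev (S.keyPairs n x.length)
        fun K _ _ => φ ((sel k b, k') :: K),
      S.ev_keyPair n fun k => ev (S.keyPairs n x.length) fun K _ _ => φ (k :: K)]
    cases b
    · simp only [sel, Bool.false_eq_true, if_false, ev_keyGen_const]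
    · simp only [sel, if_true, ev_keyGen_const]

/-! ### Sampling pads and orders -/

theorem memoryless_randomKey (n : ℕ) : Memoryless (S.randomKey n) := memoryless_uniform.map _

theorem supp_randomKey (n : ℕ) :
    Supp (S.randomKey n) fun P _ _ => P.length = S.keyLen.eval n :=
  supp_map ((supp_true _).mono fun a _ _ _ => by simp)

theorem length_xorBits (v w : Bits) : (xorBits v w).length = min v.length w.length := by
  simp [xorBits]

theorem xorBits_xorBits {v w : Bits} (h : v.length = w.length) :
    xorBits (xorBits v w) w = v := by
  refine List.ext_getElem (by simp [xorBits, h]) fun i h1 h2 => ?_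
  simp [xorBits]

/-- Addition of a fixed key is an involution of the key space, so it preserves the uniform
distribution. -/
theorem ev_randomKey_xor {k : Bits} (hk : k.length = S.keyLen.eval n) (φ : Bits → ℂ) :
    (ev (S.randomKey n) fun P _ _ => φ P) = ev (S.randomKey n) fun P _ _ => φ (xorBits P k) := by
  simp only [randomKey, ev_map, ev_uniform]
  congr 1
  let f : (Fin (S.keyLen.eval n) → Bool) → (Fin (S.keyLen.eval n) → Bool) :=
    fun P i => xor (P i) (k[i]'(by rw [hk]; exact i.2))
  have hf : Function.Involutive f := fun P => by funext i; simp [f]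
  rw [← Equiv.sum_comp hf.toPerm]
  refine Finset.sum_congr rfl fun P _ => congrArg φ ?_
  refine List.ext_getElem (by simp [xorBits, hk]) fun i h1 h2 => ?_
  simp [xorBits, f]

/-- The descriptions of the ciphertexts of a garbled gate. -/
def sampleSlot (n : ℕ) (r : Slot) : CQ (List Spec) := do
  let γ ← CQ.uniform (Equiv.Perm (Bool × Bool))
  let l ← entries.mapM fun e => r.specs (γ e) <$> S.randomKey n
  return l.flatten

/-- The descriptions of the ciphertexts of a garbled circuit. -/
def sampleSpecs (n : ℕ) (rs : List Slot) : CQ (List Spec) :=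
  List.flatten <$> rs.mapM (S.sampleSlot n)

theorem memoryless_sampleSlot (n : ℕ) (r : Slot) : Memoryless (S.sampleSlot n r) :=
  memoryless_uniform.bind fun _ =>
    (memoryless_mapM (fun _ => (S.memoryless_randomKey n).map _) _).bind fun _ => memoryless_pure _

theorem memoryless_sampleSpecs (n : ℕ) (rs : List Slot) : Memoryless (S.sampleSpecs n rs) :=
  (memoryless_mapM (fun r => S.memoryless_sampleSlot n r) _).map _

theorem ev_sampleSlot (r : Slot) (φ : List Spec → ℂ) :
    (ev (S.sampleSlot n r) fun l _ _ => φ l) =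
      ev (CQ.uniform (Equiv.Perm (Bool × Bool))) fun γ _ _ =>
        ev (entries.mapM fun e => r.specs (γ e) <$> S.randomKey n) fun l _ _ => φ l.flatten := by
  simp [sampleSlot]

theorem ev_mapM_zero {α β : Type} {f g : α → CQ (List β)} {z : β → β} {l : List α}
    (h : ∀ a ∈ l, ∀ φ : List β → ℂ, (ev (f a) fun b _ _ => φ (b.map z)) = ev (g a) fun b _ _ => φ b)
    (φ : List (List β) → ℂ) :
    (ev (l.mapM f) fun b _ _ => φ (b.map (List.map z))) = ev (l.mapM g) fun b _ _ => φ b := by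
  induction l generalizing φ with
  | nil => simp
  | cons a l ih =>
    rw [ev_mapM_cons, ev_mapM_cons, ← h a (by simp)]
    exact ev_fun_congr fun b _ _ => ih (fun x hx => h x (by simp [hx])) fun bs => φ (b.map z :: bs)

/-- Pads and orders are chosen independently of the truth tables, which enter the descriptions only
through the field `bit`. -/
theorem ev_sampleSpecs_zero (rs : List Slot) (φ : List Spec → ℂ) :
    (ev (S.sampleSpecs n rs) fun l _ _ => φ (l.map Spec.zero)) =
      ev (S.sampleSpecs n (rs.map Slot.zero)) fun l _ _ => φ l := by
  simp only [sampleSpecs, ev_map, List.mapM_map, List.map_flatten]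
  refine ev_mapM_zero (fun r _ φ => ?_) fun l => φ l.flatten
  show _ = ev (S.sampleSlot n r.zero) fun b _ _ => φ b
  rw [S.ev_sampleSlot r fun l => φ (l.map Spec.zero), S.ev_sampleSlot]
  refine ev_fun_congr fun γ _ _ => ?_
  simp only [List.map_flatten]
  refine ev_mapM_zero (fun e _ φ => ?_) fun l => φ l.flatten
  simp [Slot.specs, Spec.zero, Slot.zero, Slot.fn]

end CertSKE

/-! ### Wire values and truth tables relative to them -/

namespace Circuit

variable {C : Circuit} {x : Bits}

theorem wireValues_aux (gs : List Gate) (w : Bits) :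
    ∃ w', gs.foldl (fun w G => w ++ [G.fn (w.getD G.inA false) (w.getD G.inB false)]) w = w ++ w' ∧
      w'.length = gs.length := by
  induction gs generalizing w with
  | nil => exact ⟨[], by simp⟩
  | cons G gs ih =>
    obtain ⟨w', h1, h2⟩ := ih (w ++ [G.fn (w.getD G.inA false) (w.getD G.inB false)])
    exact ⟨G.fn (w.getD G.inA false) (w.getD G.inB false) :: w', by
      rw [List.foldl_cons, h1]; simp, by simp [h2]⟩

theorem exists_wireValues (C : Circuit) (x : Bits) :
    ∃ w', C.wireValues x = x ++ w' ∧ w'.length = C.gates.length := wireValues_aux _ _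

theorem length_wireValues (hx : x.length = C.inputs) :
    (C.wireValues x).length = C.inputs + C.gates.length := by
  obtain ⟨w, h1, h2⟩ := C.exists_wireValues x
  simp [h1, h2, hx]

/-- The value of the outgoing wire of a gate. -/
theorem wireValues_gate (hC : C.Valid) (hx : x.length = C.inputs) {i : ℕ} {G : Gate}
    (hG : C.gates[i]? = some G) :
    (C.wireValues x).getD (C.inputs + i) false =
      G.fn ((C.wireValues x).getD G.inA false) ((C.wireValues x).getD G.inB false) := by
  obtain ⟨hi, hG'⟩ := List.getElem?_eq_some_iff.1 hG
  have h := hC.1 i G hG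
  set step := fun (w : Bits) (G : Gate) => w ++ [G.fn (w.getD G.inA false) (w.getD G.inB false)]
  have h1 : C.wireValues x = (C.gates.drop (i + 1)).foldl step
      (step ((C.gates.take i).foldl step x) G) := by
    show C.gates.foldl step x = _
    conv_lhs => rw [← List.take_append_drop i C.gates, List.foldl_append,
      List.drop_eq_getElem_cons hi, List.foldl_cons, hG']
  obtain ⟨w, h2, h2'⟩ := wireValues_aux (C.gates.take i) x
  obtain ⟨w', h3, h3'⟩ := wireValues_aux (C.gates.drop (i + 1)) (step ((C.gates.take i).foldl step x) G)
  -- When the gate is reached, exactly the wires before its outgoing wire have values; both incoming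
  -- wires are among them, and later gates only append values.
  have hlen : (x ++ w).length = C.inputs + i := by
    simp [h2', hx]; omega
  rw [h1, h3, h2]
  simp only [step, List.append_assoc]
  rw [← List.append_assoc x w]
  generalize x ++ w = y at hlen
  simp only [List.getD_eq_getElem?_getD]
  rw [List.getElem?_append_left (by omega : G.inA < y.length),
    List.getElem?_append_left (by omega : G.inB < y.length),
    List.getElem?_append_right (by omega)]
  simp [hlen]

/-- The gate with index `i`, relative to the values of its wires. -/
def slot (C : Circuit) (w : Bits) (G : Gate) (i : ℕ) : Slot where
  inA := G.inA
  inB := G.inB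
  out := C.inputs + i
  table := [(false, false), (false, true), (true, false), (true, true)].map fun e =>
    xor (G.fn (xor e.1 (w.getD G.inA false)) (xor e.2 (w.getD G.inB false)))
      (w.getD (C.inputs + i) false)

theorem slot_fn (C : Circuit) (w : Bits) (G : Gate) (i : ℕ) (a b : Bool) :
    (C.slot w G i).fn a b = xor (G.fn (xor a (w.getD G.inA false)) (xor b (w.getD G.inB false)))
      (w.getD (C.inputs + i) false) := by
  cases a <;> cases b <;> rfl

def slots (C : Circuit) (w : Bits) : List Slot := C.gates.zipIdx.map fun Gi => C.slot w Gi.1 Gi.2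

/-- Two active incoming keys lead to the active outgoing key. This is the only property of the
relative truth tables that the argument needs. -/
theorem slot_fn_false (hC : C.Valid) (hx : x.length = C.inputs) {i : ℕ} {G : Gate}
    (hG : C.gates[i]? = some G) : (C.slot (C.wireValues x) G i).fn false false = false := by
  rw [slot_fn, wireValues_gate hC hx hG]
  simp

end Circuit

/-- The table for an output wire with value `y`. -/
def outputTable (k : Bits × Bits) (y : Bool) : Val :=
  Val.ofList [Val.cons (Val.ofBits (sel k y)) (Val.ofBool false),
    Val.cons (Val.ofBits (sel k !y)) (Val.ofBool true)]

/-- The classical part of a garbled circuit. -/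
def garbledTables (T : Topology) (y : Bits) (K : List (Bits × Bits)) : Val :=
  Val.cons T.toVal (Val.ofList (List.zipWith (fun o b => outputTable (K.getD o ([], [])) b) T.outs y))

/-- The keys with index `0` of the input wires. -/
def inputKeys (N : ℕ) (K : List (Bits × Bits)) : List Bits := (K.take N).map Prod.fst

/-! ### Hybrids, and the real garbling as the first of them -/

namespace CertSKE

variable (S : CertSKE) {n : ℕ}

/-- Garbling of a circuit with the given gates, where the first `h` ciphertexts are simulated. -/
def hybrid (n : ℕ) (T : Topology) (y : Bits) (rs : List Slot) (h : ℕ)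
    (φ : List Bits → Val → List Bits → Bits → Bits → ℂ) : ℂ :=
  ev (S.keyPairs n (T.inputs + T.wires.length)) fun K _ _ =>
    ev (S.sampleSpecs n rs) fun l _ _ =>
      ev (S.encList n (((l.take h).map Spec.zero ++ l.drop h).map (Spec.task K)))
        (φ (inputKeys T.inputs K) (garbledTables T y K))

/-- If the first key of the entry is inactive, the substitution of `P ⊕ key` for the pad `P` moves
the output key from the second share to the first. In the other case the second share carries it
already. -/
theorem ev_encPair (K : List (Bits × Bits)) (r : Slot) (e : Bool × Bool)
    (hc : r.out < K.length) (hK : S.FitKeys n K)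
    (φ : List Bits → Bits → Bits → ℂ) :
    (ev (S.randomKey n) fun P _ _ => ev (S.enc n (wireKey K r.inA e.1) P) fun vka s t =>
      ev (S.enc n (wireKey K r.inB e.2) (xorBits P (wireKey K r.out (r.fn e.1 e.2))))
        fun vkb s' t' => φ [vka, vkb] (s ++ s') (t ++ t')) =
      ev (r.specs e <$> S.randomKey n) fun l _ _ =>
        ev (l.mapM fun x => S.enc n (x.task K).1 (x.task K).2) φ := by
  simp only [ev_map, Slot.specs, ev_mapM_cons, ev_mapM_nil, Spec.task, List.append_nil]
  obtain ⟨a, b⟩ := e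
  cases a
  · simp
  · have hk := hK.length_wireKey hc (r.fn true b)
    refine ((S.ev_randomKey_xor hk fun P => ev (S.enc n (wireKey K r.inA true) P) fun vka s t =>
      ev (S.enc n (wireKey K r.inB b) (xorBits P (wireKey K r.out (r.fn true b))))
        fun vkb s' t' => φ [vka, vkb] (s ++ s') (t ++ t'))).trans ?_
    refine ev_congr (S.supp_randomKey n) fun P _ _ hP => ?_
    rw [xorBits_xorBits (hP.trans hk.symm)]
    simp

/-- Shift of the truth table. -/
def shiftPerm (a b : Bool) : Equiv.Perm (Bool × Bool) :=
  (show Function.Involutive fun e : Bool × Bool => (xor e.1 a, xor e.2 b) from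
    fun e => by simp).toPerm

/-- The two ciphertexts of an entry in a garbled gate. -/
def entryGarble (n : ℕ) (g : Bool → Bool → Bool) (ka kb kc : Bits × Bits) (σ : Bool × Bool) :
    CQ (List Bits) := do
  let p ← S.randomKey n
  let vka ← S.enc n (sel ka σ.1) p
  let vkb ← S.enc n (sel kb σ.2) (xorBits p (sel kc (g σ.1 σ.2)))
  return [vka, vkb]

/-- Renaming the keys replaces the entry `σ` by its sum with the values of the incoming wires, and
the truth table by the relative one. -/
theorem ev_entryGarble {C : Circuit} {w : Bits} {K : List (Bits × Bits)} (hw : w.length = K.length)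
    (hK : S.FitKeys n K) {G : Gate} {i : ℕ} (hc : C.inputs + i < K.length) (σ : Bool × Bool)
    (φ : List Bits → Bits → Bits → ℂ) :
    ev (S.entryGarble n G.fn ((swapPairs w K).getD G.inA ([], []))
      ((swapPairs w K).getD G.inB ([], [])) ((swapPairs w K).getD (C.inputs + i) ([], [])) σ) φ =
      ev ((C.slot w G i).specs (shiftPerm (w.getD G.inA false) (w.getD G.inB false) σ) <$>
        S.randomKey n) fun l _ _ => ev (l.mapM fun x => S.enc n (x.task K).1 (x.task K).2) φ := by
  rw [← S.ev_encPair K (C.slot w G i) _ hc hK]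
  simp only [entryGarble, ev_bind, ev_pure, sel_swapPairs hw]
  refine (S.memoryless_randomKey n).ev_congr fun P => ?_
  have : (C.slot w G i).fn (shiftPerm (w.getD G.inA false) (w.getD G.inB false) σ).1
      (shiftPerm (w.getD G.inA false) (w.getD G.inB false) σ).2 =
      xor (G.fn σ.1 σ.2) (w.getD (C.inputs + i) false) := by
    rw [Circuit.slot_fn]
    simp [shiftPerm]
  rw [this]
  simp only [List.nil_append, List.append_nil]
  rfl

/-- Left multiplication by the shift is a bijection of the permutations of the entries. So the
random order hides the values of the incoming wires. -/
theorem ev_gateGarble {C : Circuit} {w : Bits} {K : List (Bits × Bits)} (hw : w.length = K.length)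
    (hK : S.FitKeys n K) {G : Gate} {i : ℕ} (hc : C.inputs + i < K.length)
    (φ : List Bits → Bits → Bits → ℂ) :
    ev (S.gateGarble n G.fn ((swapPairs w K).getD G.inA ([], []))
      ((swapPairs w K).getD G.inB ([], [])) ((swapPairs w K).getD (C.inputs + i) ([], []))) φ =
      ev (S.sampleSlot n (C.slot w G i)) fun l _ _ =>
        ev (l.mapM fun x => S.enc n (x.task K).1 (x.task K).2) φ := by
  rw [S.ev_sampleSlot _ fun l => ev (l.mapM fun x => S.enc n (x.task K).1 (x.task K).2) φ]
  have h : ∀ ka kb kc, ev (S.gateGarble n G.fn ka kb kc) φ =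
      ev (CQ.uniform (Equiv.Perm (Bool × Bool))) fun γ _ _ =>
        ev (entries.mapM fun e => S.entryGarble n G.fn ka kb kc (γ e)) fun l => φ l.flatten := by
    intro ka kb kc
    show ev (CQ.uniform (Equiv.Perm (Bool × Bool)) >>= fun γ =>
      (entries.mapM fun e => S.entryGarble n G.fn ka kb kc (γ e)) >>= fun l => pure l.flatten) φ = _
    rw [ev_bind]
    refine memoryless_uniform.ev_congr fun γ => ?_
    rw [ev_bind]
    refine ev_fun_congr fun l s t => ?_
    simp
  rw [h, ev_uniform, ev_uniform]
  congr 1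
  rw [← Equiv.sum_comp (Equiv.mulLeft (shiftPerm (w.getD G.inA false) (w.getD G.inB false)))
    fun γ => ev (entries.mapM fun e => (C.slot w G i).specs (γ e) <$> S.randomKey n) fun l _ _ =>
      ev (l.flatten.mapM fun x => S.enc n (x.task K).1 (x.task K).2) φ]
  refine Finset.sum_congr rfl fun γ _ => ?_
  exact ev_mapM_flatten
    (g := fun e => (C.slot w G i).specs
      (shiftPerm (w.getD G.inA false) (w.getD G.inB false) (γ e)) <$> S.randomKey n)
    (e := fun x => S.enc n (x.task K).1 (x.task K).2)
    (fun e _ => (S.memoryless_randomKey n).map _)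
    (fun e _ φ => S.ev_entryGarble hw hK hc (γ e) φ) φ

/-- The labels from `Setup` and the keys from `Garble` form one list of independent pairs; after
swapping the pairs according to the wire values, the active labels, the output tables and the gates
take the form used in the hybrids. -/
theorem ev_garble {C : Circuit} (hC : C.Valid) {x : Bits} (hx : x.length = C.inputs)
    (φ : List Bits → Val → Val → Bits → Bits → ℂ) :
    (ev (S.keyPairs n C.inputs) fun labels _ _ => ev (S.garble n C labels) fun g s t =>
      φ (GarblingScheme.activeLabels labels x) g.1 g.2 s t) =
    S.hybrid n C.topology (C.output x) (C.slots (C.wireValues x)) 0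
      fun act c vks => φ act c (Val.ofList (vks.map Val.ofBits)) := by
  have hw := Circuit.length_wireValues hx
  have h1 : C.topology.wires.length = C.gates.length := by simp [Circuit.topology]
  rw [hybrid, h1]
  show _ = ev (S.keyPairs n (C.inputs + C.gates.length)) _
  have key : ∀ K : List (Bits × Bits), K.length = C.inputs + C.gates.length → S.FitKeys n K →
      ∀ φ : List Bits → Bits → Bits → ℂ,
      (ev (C.gates.zipIdx.mapM fun Gi => S.gateGarble n Gi.1.fn
        ((swapPairs (C.wireValues x) K).getD Gi.1.inA ([], []))
        ((swapPairs (C.wireValues x) K).getD Gi.1.inB ([], []))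
        ((swapPairs (C.wireValues x) K).getD (C.inputs + Gi.2) ([], []))) fun vks => φ vks.flatten) =
      ev (S.sampleSpecs n (C.slots (C.wireValues x))) fun l _ _ =>
        ev (S.encList n (l.map (Spec.task K))) φ := by
    intro K hK hK' φ
    rw [ev_mapM_flatten (g := fun Gi => S.sampleSlot n (C.slot (C.wireValues x) Gi.1 Gi.2))
      (fun Gi _ => S.memoryless_sampleSlot n _) fun Gi hGi φ => ?_]
    · simp only [sampleSpecs, ev_map, Circuit.slots, List.mapM_map, encList]
      rfl
    · have hi := List.mem_zipIdx_iff_getElem?.1 hGi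
      have h := hC.1 _ _ hi
      have h2 := (List.getElem?_eq_some_iff.1 hi).1
      exact S.ev_gateGarble (hw.trans hK.symm) hK' (by omega) φ
  let Φ : List (Bits × Bits) → ℂ := fun K =>
    ev (C.gates.zipIdx.mapM fun Gi => S.gateGarble n Gi.1.fn (K.getD Gi.1.inA ([], []))
        (K.getD Gi.1.inB ([], [])) (K.getD (C.inputs + Gi.2) ([], []))) fun vks =>
      φ (GarblingScheme.activeLabels (K.take C.inputs) x)
        (Val.cons C.topology.toVal (Val.ofList (C.outs.map fun o =>
          Val.ofList [Val.cons (Val.ofBits (K.getD o ([], [])).1) (Val.ofBool false),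
            Val.cons (Val.ofBits (K.getD o ([], [])).2) (Val.ofBool true)])))
        (Val.ofList (vks.flatten.map Val.ofBits))
  have hl : (ev (S.keyPairs n C.inputs) fun labels _ _ => ev (S.garble n C labels) fun g s t =>
      φ (GarblingScheme.activeLabels labels x) g.1 g.2 s t) =
      ev (S.keyPairs n (C.inputs + C.gates.length)) fun K _ _ => Φ K := by
    rw [ev_keyPairs_add]
    refine ev_congr (S.supp_keyPairs n _) fun labels _ _ hL => ?_
    simp only [garble, ev_bind, ev_pure]
    refine (S.memoryless_keyPairs n _).ev_congr fun inner => ?_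
    simp only [List.nil_append, List.append_nil, Φ, ← hL.1, List.take_left]
  -- From here on `K` is the list of renamed pairs, and the actual keys are `swapPairs (C.wireValues
  -- x) K`.
  rw [hl, ← hw, S.ev_keyPairs_swap, hw]
  refine ev_congr (S.supp_keyPairs n _) fun K _ _ hK => ?_
  simp only [List.take_zero, List.map_nil, List.nil_append, List.drop_zero]
  rw [← key K hK.1 hK.2]
  have e1 : GarblingScheme.activeLabels ((swapPairs (C.wireValues x) K).take C.inputs) x =
      inputKeys C.topology.inputs K := by
    obtain ⟨w', e, e'⟩ := C.exists_wireValues x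
    have hk := hK.1
    refine List.ext_getElem ?_ fun i h1 h2 => ?_
    · simp [GarblingScheme.activeLabels, inputKeys, Circuit.topology, swapPairs, e]
      omega
    · have hi : i < x.length := by
        simp [GarblingScheme.activeLabels] at h1
        omega
      simp only [GarblingScheme.activeLabels, inputKeys, Circuit.topology, swapPairs, e,
        List.getElem_zipWith, List.getElem_take, List.getElem_map, List.getElem_append_left hi]
      cases x[i] <;> simp [sel]
  have e2 : (Val.cons C.topology.toVal (Val.ofList (C.outs.map fun o =>
          Val.ofList [Val.cons (Val.ofBits ((swapPairs (C.wireValues x) K).getD o ([], [])).1)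
            (Val.ofBool false), Val.cons (Val.ofBits ((swapPairs (C.wireValues x) K).getD o ([], [])).2)
              (Val.ofBool true)]))) = garbledTables C.topology (C.output x) K := by
    -- In the output table the key with index 0 belongs to the bit `C(x)`, but the entries stay
    -- listed by the bit, so the table depends on the renamed keys and on `C(x)` only.
    simp only [garbledTables, Circuit.output, Circuit.topology, List.zipWith_map_right,
      List.zipWith_self]
    congr 2
    refine List.map_congr_left fun o _ => ?_
    have h0 := sel_swapPairs (hw.trans hK.1.symm) o false
    have h1 := sel_swapPairs (hw.trans hK.1.symm) o true
    simp only [outputTable]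
    simp only [sel, wireKey, Bool.false_eq_true, if_false, if_true, Bool.false_xor, Bool.true_xor]
      at h0 h1 ⊢
    rw [h0, h1]
  simp only [Φ, e1, e2]

end CertSKE

/-! ### Conditions on wires, order and lengths in a garbled circuit -/

namespace CQ

theorem supp_mapM_forall₂ {α β : Type} {f : α → CQ β} {Q : α → β → Prop} {l : List α}
    (h : ∀ a ∈ l, Supp (f a) fun b _ _ => Q a b) :
    Supp (l.mapM f) fun bs _ _ => List.Forall₂ Q l bs := by
  induction l with
  | nil => exact supp_pure .nil
  | cons a l ih =>
    rw [List.mapM_cons]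
    exact supp_bind (h a (by simp)) fun b _ _ hb => supp_bind (ih fun x hx => h x (by simp [hx]))
      fun bs _ _ hbs => supp_pure (.cons hb hbs)

end CQ

namespace Spec

/-- A possible ciphertext of a gate, with plaintexts of length `k`. -/
structure Of (k : ℕ) (r : Slot) (x : Spec) : Prop where
  out_eq : x.out = r.out
  wire_eq : x.wire = r.inA ∨ x.wire = r.inB
  length_pad : x.pad.length = k
  side_eq : r.fn false false = false → x.carry = true → x.bit = true → x.side = true

/-- The properties of the list of all ciphertexts of a circuit. -/
structure Regular (k : ℕ) (T : Topology) (l : List Spec) : Prop where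
  length_eq : l.length = 8 * T.wires.length
  sorted : l.Pairwise fun x y => x.out ≤ y.out
  wire_lt : ∀ x ∈ l, x.wire < x.out
  out_lt : ∀ x ∈ l, x.out < T.inputs + T.wires.length
  length_pad : ∀ x ∈ l, x.pad.length = k
  side_eq : ∀ x ∈ l, x.carry = true → x.bit = true → x.side = true
  wire_notMem : ∀ x ∈ l, x.wire ∉ T.outs

end Spec

theorem List.pairwise_flatten_of_forall₂ {α β : Type} {f : α → ℕ} {g : β → ℕ} {l : List α}
    {m : List (List β)} (h : List.Forall₂ (fun a b => ∀ x ∈ b, g x = f a) l m)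
    (hl : l.Pairwise fun a b => f a ≤ f b) : m.flatten.Pairwise fun x y => g x ≤ g y := by
  induction h with
  | nil => simp
  | @cons a b l m hab h ih =>
    rw [List.pairwise_cons] at hl
    rw [List.flatten_cons, List.pairwise_append]
    refine ⟨List.pairwise_of_forall_mem_list fun x hx y hy => by rw [hab x hx, hab y hy], ih hl.2,
      fun x hx y hy => ?_⟩
    obtain ⟨c, hc, hy⟩ := List.mem_flatten.1 hy
    obtain ⟨i, hi, rfl⟩ := List.getElem_of_mem hc
    have hi' : i < l.length := by rw [h.length_eq]; exact hi
    rw [hab x hx, List.forall₂_iff_get.1 h |>.2 i hi' hi y hy]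
    exact hl.1 _ (List.getElem_mem hi')

/-- The gates, with the constant function `0`. -/
def Topology.slots (T : Topology) : List Slot :=
  T.wires.zipIdx.map fun w => ⟨w.1.1, w.1.2, T.inputs + w.2, []⟩

theorem Circuit.slots_map_zero (C : Circuit) (w : Bits) :
    (C.slots w).map Slot.zero = C.topology.slots := by
  simp [Circuit.slots, Topology.slots, Circuit.topology, List.zipIdx_map, Slot.zero, Circuit.slot,
    Function.comp_def]

/-- The properties of the list of gates of a circuit, relative to the values of the wires. -/
structure Slot.Regular (T : Topology) (rs : List Slot) : Prop where
  length_eq : rs.length = T.wires.length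
  sorted : rs.Pairwise fun r r' => r.out ≤ r'.out
  wire_lt : ∀ r ∈ rs, r.inA < r.out ∧ r.inB < r.out
  out_lt : ∀ r ∈ rs, r.out < T.inputs + T.wires.length
  wire_notMem : ∀ r ∈ rs, r.inA ∉ T.outs ∧ r.inB ∉ T.outs
  fn_false : ∀ r ∈ rs, r.fn false false = false

theorem Slot.Regular.map_zero {T : Topology} {rs : List Slot} (h : Slot.Regular T rs) :
    Slot.Regular T (rs.map Slot.zero) where
  length_eq := by rw [List.length_map, h.length_eq]
  sorted := by rw [List.pairwise_map]; exact h.sorted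
  wire_lt := List.forall_mem_map.2 h.wire_lt
  out_lt := List.forall_mem_map.2 h.out_lt
  wire_notMem := List.forall_mem_map.2 h.wire_notMem
  fn_false := List.forall_mem_map.2 fun _ _ => rfl

theorem Circuit.regular_slots {C : Circuit} (hC : C.Valid) {x : Bits} (hx : x.length = C.inputs) :
    Slot.Regular C.topology (C.slots (C.wireValues x)) := by
  have hmem : ∀ r ∈ C.slots (C.wireValues x), ∃ i G, C.gates[i]? = some G ∧
      r = C.slot (C.wireValues x) G i := by
    intro r hr
    obtain ⟨⟨G, i⟩, hG, rfl⟩ := List.mem_map.1 hr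
    exact ⟨i, G, List.mem_zipIdx_iff_getElem?.1 hG, rfl⟩
  refine ⟨by simp [Circuit.slots, Circuit.topology], ?_, fun r hr => ?_, fun r hr => ?_,
    fun r hr => ?_, fun r hr => ?_⟩
  · rw [List.pairwise_iff_getElem]
    intro i j hi hj hij
    simp [Circuit.slots, Circuit.slot]
    omega
  all_goals obtain ⟨i, G, hG, rfl⟩ := hmem r hr
  · exact hC.1 i G hG
  · have := (List.getElem?_eq_some_iff.1 hG).1
    simpa [Circuit.slot, Circuit.topology] using this
  · have hG' := List.mem_of_getElem? hG
    exact ⟨fun ho => ((hC.2 _ ho).2 G hG').1 rfl, fun ho => ((hC.2 _ ho).2 G hG').2 rfl⟩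
  · exact C.slot_fn_false hC hx hG

namespace CertSKE

variable (S : CertSKE) {n : ℕ}

theorem supp_sampleSlot (n : ℕ) (r : Slot) : Supp (S.sampleSlot n r) fun l _ _ =>
    l.length = 8 ∧ ∀ x ∈ l, x.Of (S.keyLen.eval n) r := by
  refine supp_bind (supp_true _) fun γ _ _ _ => ?_
  refine supp_bind (supp_mapM (Q := fun b => b.length = 2 ∧ ∀ x ∈ b, Spec.Of (S.keyLen.eval n) r x)
    fun e _ => supp_map ((S.supp_randomKey n).mono fun P _ _ hP => ?_))
    fun l _ _ hl => supp_pure ?_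
  · generalize γ e = e
    obtain ⟨a, b⟩ := e
    refine ⟨rfl, fun x hx => ?_⟩
    simp only [Slot.specs, List.mem_cons, List.not_mem_nil, or_false] at hx
    rcases hx with rfl | rfl
    · exact ⟨rfl, .inl rfl, hP, fun _ h _ => h⟩
    -- The second share carries the key only if the first index is 0; then the second index is 1,
    -- since the entry `(0,0)` never leads to a key with index 1.
    · refine ⟨rfl, .inr rfl, hP, fun h0 h1 h2 => ?_⟩
      cases a <;> cases b <;> simp_all
  · refine ⟨?_, fun x hx => ?_⟩
    · rw [List.length_flatten, List.map_congr_left (g := fun _ => 2) fun b hb => (hl.2 b hb).1]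
      simp [hl.1, entries]
    · obtain ⟨b, hb, hx⟩ := List.mem_flatten.1 hx
      exact (hl.2 b hb).2 x hx

/-- Collects what the hybrid argument uses: the order by outgoing wires, incoming wires before
outgoing ones, and the fact that a carried key with index 1 is encrypted under a key with index 1.
-/
theorem supp_sampleSpecs {T : Topology} {rs : List Slot} (h : Slot.Regular T rs) :
    Supp (S.sampleSpecs n rs) fun l _ _ => Spec.Regular (S.keyLen.eval n) T l := by
  refine supp_map ((supp_mapM_forall₂ fun r _ => S.supp_sampleSlot n r).mono fun m _ _ hm => ?_)
  have hmem : ∀ y ∈ m.flatten, ∃ r ∈ rs, y.Of (S.keyLen.eval n) r := by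
    intro y hy
    obtain ⟨b, hb, hy⟩ := List.mem_flatten.1 hy
    obtain ⟨i, hi, rfl⟩ := List.getElem_of_mem hb
    have hi' : i < rs.length := by rw [hm.length_eq]; exact hi
    exact ⟨rs[i], List.getElem_mem _, ((List.forall₂_iff_get.1 hm).2 i hi' hi).2 y hy⟩
  refine ⟨?_, ?_, fun y hy => ?_, fun y hy => ?_, fun y hy => ?_, fun y hy => ?_, fun y hy => ?_⟩
  · rw [List.length_flatten, List.map_congr_left (g := fun _ => 8)]
    · simp [← hm.length_eq, h.length_eq, mul_comm]
    · intro b hb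
      obtain ⟨i, hi, rfl⟩ := List.getElem_of_mem hb
      have hi' : i < rs.length := by rw [hm.length_eq]; exact hi
      exact ((List.forall₂_iff_get.1 hm).2 i hi' hi).1
  · exact List.pairwise_flatten_of_forall₂ (f := Slot.out) (hm.imp fun r b h y hy =>
      (h.2 y hy).out_eq) h.sorted
  all_goals obtain ⟨r, hr, h'⟩ := hmem y hy
  · rw [h'.out_eq]
    rcases h'.wire_eq with e | e <;> rw [e]
    · exact (h.wire_lt r hr).1
    · exact (h.wire_lt r hr).2
  · rw [h'.out_eq]
    exact h.out_lt r hr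
  · exact h'.length_pad
  · exact h'.side_eq (h.fn_false r hr)
  · rcases h'.wire_eq with e | e <;> rw [e]
    · exact (h.wire_notMem r hr).1
    · exact (h.wire_notMem r hr).2

/-- If all ciphertexts are simulated, then the functions of the gates do not matter. -/
theorem hybrid_eq_of_le {C : Circuit} (hC : C.Valid) {x : Bits} (hx : x.length = C.inputs) {h : ℕ}
    (hh : 8 * C.gates.length ≤ h) (y : Bits)
    (φ : List Bits → Val → List Bits → Bits → Bits → ℂ) :
    S.hybrid n C.topology y (C.slots (C.wireValues x)) h φ =
      S.hybrid n C.topology y C.topology.slots 0 φ := by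
  rw [← C.slots_map_zero (C.wireValues x)]
  refine ev_fun_congr fun K _ _ => ?_
  simp only [List.take_zero, List.map_nil, List.nil_append, List.drop_zero]
  rw [← S.ev_sampleSpecs_zero _ fun l => ev (S.encList n (l.map (Spec.task K)))
    (φ (inputKeys C.topology.inputs K) (garbledTables C.topology y K))]
  refine ev_congr (S.supp_sampleSpecs (C.regular_slots hC hx)) fun l _ _ hl => ?_
  have := hl.length_eq
  simp only [Circuit.topology, List.length_map] at this
  rw [List.take_of_length_le (by omega), List.drop_of_length_le (by omega), List.append_nil]

end CertSKE

/-! ### Lists of keys with one missing key -/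

theorem getD_append_cons {α : Type} (K₁ K₂ : List α) (p p' d : α) {i : ℕ} (hi : i ≠ K₁.length) :
    (K₁ ++ p :: K₂).getD i d = (K₁ ++ p' :: K₂).getD i d := by
  simp only [List.getD_eq_getElem?_getD]
  rcases lt_or_gt_of_ne hi with h | h
  · rw [List.getElem?_append_left h, List.getElem?_append_left h]
  · rw [List.getElem?_append_right h.le, List.getElem?_append_right h.le]
    obtain ⟨k, hk⟩ := Nat.exists_eq_add_of_lt h
    rw [show i - K₁.length = k + 1 by omega]
    simp

/-- Pairs of keys, where the second key of one pair is missing. -/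
def holeKeys (K₁ : List (Bits × Bits)) (k : Bits) (K₂ : List (Bits × Bits)) : List (Bits × Bits) :=
  K₁ ++ (k, []) :: K₂

section Hole

variable {K₁ K₂ : List (Bits × Bits)} {k k' : Bits}

theorem wireKey_hole (i : ℕ) (a : Bool) : wireKey (K₁ ++ (k, k') :: K₂) i a =
    if i = K₁.length ∧ a = true then k' else wireKey (holeKeys K₁ k K₂) i a := by
  by_cases hi : i = K₁.length
  · subst hi
    cases a <;> simp [wireKey, sel, holeKeys]
  · simp only [wireKey, holeKeys, hi, false_and, if_false]
    rw [getD_append_cons _ _ _ _ _ hi]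

theorem inputKeys_hole (N : ℕ) :
    inputKeys N (K₁ ++ (k, k') :: K₂) = inputKeys N (holeKeys K₁ k K₂) := by
  simp only [inputKeys, holeKeys]
  rw [List.map_take, List.map_take]
  simp

/-- Here it matters that no output wire is an incoming wire of a gate: the output tables would
otherwise reveal the missing key. -/
theorem garbledTables_hole {T : Topology} (h : K₁.length ∉ T.outs) (y : Bits) :
    garbledTables T y (K₁ ++ (k, k') :: K₂) = garbledTables T y (holeKeys K₁ k K₂) := by
  unfold garbledTables holeKeys
  congr 2
  refine List.ext_getElem (by simp) fun i h1 h2 => ?_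
  simp only [List.getElem_zipWith]
  rw [getD_append_cons]
  intro h'
  exact h (h' ▸ List.getElem_mem _)

end Hole

/-- The ciphertext as a task, where `none` stands for the key with index `1` of the wire `w`. -/
def Spec.holeTask (K : List (Bits × Bits)) (w : ℕ) (x : Spec) : Option Bits × Bits :=
  (if x.wire = w ∧ x.side = true then none else some (wireKey K x.wire x.side), (x.task K).2)

/-- A plaintext involves the missing key only if the ciphertext belongs to the gate with this
outgoing wire and carries a key with index 1. Apart from such ciphertexts, everything can be
produced from the incomplete keys and an encryption oracle. -/
theorem Spec.holeTask_getD {K₁ K₂ : List (Bits × Bits)} {k k' : Bits} {x : Spec}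
    (h : x.bit = true → x.out ≠ K₁.length) :
    ((x.holeTask (holeKeys K₁ k K₂) K₁.length).1.getD k',
      (x.holeTask (holeKeys K₁ k K₂) K₁.length).2) = x.task (K₁ ++ (k, k') :: K₂) := by
  simp only [Spec.holeTask, Spec.task, wireKey_hole]
  refine Prod.ext_iff.2 ⟨?_, ?_⟩
  · simp only
    split <;> simp
  · simp only
    by_cases hb : x.bit = true
    · simp [h hb]
    · simp [hb]

/-- The challenge is encrypted under the missing key, and its plaintext does not involve this key
because its incoming wire differs from its outgoing wire. -/
theorem Spec.task_hole {K₁ K₂ : List (Bits × Bits)} {k k' : Bits} {x : Spec}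
    (hw : x.wire = K₁.length) (ho : x.out ≠ K₁.length) (hs : x.side = true) :
    x.task (K₁ ++ (k, k') :: K₂) = (k', (x.task (holeKeys K₁ k K₂)).2) := by
  simp only [Spec.task, wireKey_hole, hw, ho, hs, false_and, if_false, and_self, if_true]

/-- The ciphertext depends on the function of the gate. -/
def useful (l : List Spec) (j : ℕ) : Bool := (l[j]?).any fun x => x.carry && x.bit

/-- The wire whose key with index `1` is used for the ciphertext with index `j`. -/
def wireAt (l : List Spec) (j : ℕ) : ℕ := ((l[j]?).map Spec.wire).getD 0

theorem exists_of_useful {l : List Spec} {j : ℕ} (h : useful l j = true) :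
    ∃ l₁ x l₂, l = l₁ ++ x :: l₂ ∧ l₁.length = j ∧ x.carry = true ∧ x.bit = true ∧
      wireAt l j = x.wire := by
  have hj : j < l.length := by
    by_contra hj
    simp [useful, List.getElem?_eq_none (not_lt.1 hj)] at h
  simp only [useful, List.getElem?_eq_getElem hj, Option.any_some, Bool.and_eq_true] at h
  exact ⟨l.take j, l[j], l.drop (j + 1), by simp, by simp; omega, h.1, h.2,
    by simp [wireAt, hj]⟩

theorem Spec.fits {S : CertSKE} {n : ℕ} {K : List (Bits × Bits)} (hK : S.FitKeys n K) {x : Spec}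
    (hw : x.wire < K.length) (ho : x.out < K.length) (hp : x.pad.length = S.keyLen.eval n) :
    S.Fits n (x.task K) := by
  refine ⟨hK.length_wireKey hw _, ?_⟩
  have h3 := hK.length_wireKey ho x.bit
  simp only [Spec.task]
  split
  · rw [CertSKE.length_xorBits, h3, hp, min_self]
  · exact hp

theorem Spec.Regular.fits {S : CertSKE} {n : ℕ} {T : Topology} {l : List Spec}
    (h : Spec.Regular (S.keyLen.eval n) T l) {K : List (Bits × Bits)} (hK : S.FitKeys n K)
    (hl : K.length = T.inputs + T.wires.length) {x : Spec} (hx : x ∈ l) :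
    S.Fits n (x.task K) ∧ S.Fits n (x.zero.task K) := by
  have h1 := h.wire_lt x hx
  have h2 := h.out_lt x hx
  rw [← hl] at h2
  exact ⟨Spec.fits hK (by omega) h2 (h.length_pad x hx),
    Spec.fits hK (x := x.zero) (h1.trans h2) h2 (h.length_pad x hx)⟩

/-! ### Consecutive hybrids and the challenge ciphertext -/

namespace CertSKE

variable (S : CertSKE) {n : ℕ}

/-- Independence allows the key with index 1 of the wire `w` to be chosen first; in the reduction it
is the key of the IND-CPA experiment. -/
theorem ev_keyPairs_extract {N w : ℕ} (hw : w < N) (φ : List (Bits × Bits) → ℂ) :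
    (ev (S.keyPairs n N) fun K _ _ => φ K) =
      ev (S.keyGen n) fun k' _ _ => ev (S.keyPairs n w) fun K₁ _ _ =>
        ev (S.keyGen n) fun k _ _ => ev (S.keyPairs n (N - (w + 1))) fun K₂ _ _ =>
          φ (K₁ ++ (k, k') :: K₂) := by
  obtain ⟨r, rfl⟩ := Nat.exists_eq_add_of_lt hw
  rw [show w + r + 1 = w + (r + 1) by ring, ev_keyPairs_add, ev_comm (S.keyGen n)]
  refine ev_fun_congr fun K₁ _ _ => ?_
  rw [ev_keyPairs_succ, S.ev_keyPair n fun k => ev (S.keyPairs n r) fun K _ _ => φ (K₁ ++ k :: K),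
    ev_comm, show w + (r + 1) - (w + 1) = r by omega]

/-- The part of a hybrid that depends on whether the ciphertext with index `j` is simulated. -/
def gap (n : ℕ) (T : Topology) (y : Bits) (rs : List Slot) (j : ℕ) (b : Bool)
    (φ : List Bits → Val → List Bits → Bits → Bits → ℂ) : ℂ :=
  ev (S.keyPairs n (T.inputs + T.wires.length)) fun K _ _ =>
    ev (S.sampleSpecs n rs) fun l _ _ => if useful l j then
      ev (S.encList n (((l.take (j + b.toNat)).map Spec.zero ++ l.drop (j + b.toNat)).map
        (Spec.task K))) (φ (inputKeys T.inputs K) (garbledTables T y K)) else 0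

/-- A ciphertext without an inactive key in its plaintext is its own simulation, so hybrid steps at
such places are trivial. -/
theorem task_zero_of_not_useful {x : Spec} (h : (x.carry && x.bit) = false)
    (K : List (Bits × Bits)) : x.zero.task K = x.task K := by
  obtain ⟨w, a, p, o, c, b⟩ := x
  cases c <;> cases b <;> simp_all [Spec.zero, Spec.task]

/-- The two hybrids agree wherever the ciphertext with index `j` is not useful or does not exist.
Restriction to the remaining cases guarantees that the challenge uses a key with index 1. -/
theorem hybrid_sub (n : ℕ) (T : Topology) (y : Bits) (rs : List Slot) (j : ℕ)
    (φ : List Bits → Val → List Bits → Bits → Bits → ℂ) :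
    S.hybrid n T y rs j φ - S.hybrid n T y rs (j + 1) φ =
      S.gap n T y rs j false φ - S.gap n T y rs j true φ := by
  simp only [hybrid, gap, ← ev_fun_sub]
  refine ev_fun_congr fun K _ _ => ev_fun_congr fun l _ _ => ?_
  by_cases h : useful l j = true
  · simp [h]
  · simp only [h, Bool.false_eq_true, if_false, sub_self, sub_eq_zero]
    congr 2
    by_cases hj : j < l.length
    · have h' : ((l[j]).carry && (l[j]).bit) = false := by
        simpa [useful, hj] using h
      rw [List.drop_eq_getElem_cons hj, List.take_succ_eq_append_getElem hj]
      simp only [List.map_append, List.map_cons, List.map_nil, task_zero_of_not_useful h',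
        List.append_assoc, List.cons_append, List.nil_append]
    · rw [List.drop_of_length_le (by omega), List.drop_of_length_le (by omega),
        List.take_of_length_le (by omega), List.take_of_length_le (by omega)]

/-- The experiment in which the ciphertext with index `j` is the challenge, where the key `k'` that
is used for it is only needed for encryption. -/
def challenge (n : ℕ) (T : Topology) (y : Bits) (l : List Spec) (j : ℕ) (b : Bool)
    (K₁ : List (Bits × Bits)) (k k' : Bits) (K₂ : List (Bits × Bits))
    (φ : List Bits → Val → List Bits → Bits → Bits → ℂ) : ℂ :=
  ev (S.encList n (((l.take j).map Spec.zero).map (Spec.task (K₁ ++ (k, k') :: K₂))))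
    fun vks s t => ev (S.enc n k' (((l[j]?).map fun x => (Spec.task (holeKeys K₁ k K₂)
      (if b then x.zero else x)).2).getD [])) fun vk s' t' =>
      ev (S.encList n ((l.drop (j + 1)).map (Spec.task (K₁ ++ (k, k') :: K₂)))) fun vks' s'' t'' =>
        φ (inputKeys T.inputs (holeKeys K₁ k K₂)) (garbledTables T y (holeKeys K₁ k K₂))
          (vks ++ vk :: vks') (s ++ s' ++ s'') (t ++ t' ++ t'')

/-- The descriptions are chosen before the keys, so the wire of the challenge is known when its key
is separated. Neither the active labels, nor the output tables, nor the plaintext of the challenge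
involve this key, so they can be computed with a hole in its place. -/
theorem gap_eq {T : Topology} {rs : List Slot} (h : Slot.Regular T rs) (y : Bits)
    (j : ℕ) (b : Bool) (φ : List Bits → Val → List Bits → Bits → Bits → ℂ) :
    S.gap n T y rs j b φ =
      ev (S.keyGen n) fun k' _ _ => ev (S.sampleSpecs n rs) fun l _ _ =>
        ev (S.keyPairs n (wireAt l j)) fun K₁ _ _ => ev (S.keyGen n) fun k _ _ =>
          ev (S.keyPairs n (T.inputs + T.wires.length - (wireAt l j + 1))) fun K₂ _ _ =>
            if useful l j then S.challenge n T y l j b K₁ k k' K₂ φ else 0 := by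
  rw [gap, ev_comm, ev_comm (S.keyGen n)]
  refine ev_congr (S.supp_sampleSpecs h) fun l _ _ hl => ?_
  by_cases hu : useful l j = true
  · simp only [hu, if_true]
    obtain ⟨l₁, x, l₂, rfl, rfl, hc, hb, hw⟩ := exists_of_useful hu
    rw [hw]
    have hx : x ∈ l₁ ++ x :: l₂ := by simp
    have h1 := hl.wire_lt x hx
    have h2 := hl.out_lt x hx
    rw [S.ev_keyPairs_extract (show x.wire < T.inputs + T.wires.length by omega)]
    refine ev_fun_congr fun k' _ _ => ev_congr (S.supp_keyPairs n _) fun K₁ _ _ hK₁ =>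
      ev_fun_congr fun k _ _ => ev_fun_congr fun K₂ _ _ => ?_
    have h3 : (K₁ ++ (k, k') :: K₂).length = K₁.length + (K₂.length + 1) := by simp
    have e1 := garbledTables_hole (K₁ := K₁) (K₂ := K₂) (k := k) (k' := k')
      (by rw [hK₁.1]; exact hl.wire_notMem x hx) y
    have e2 : ∀ z : Spec, z.wire = x.wire → z.out = x.out → z.side = true →
        z.task (K₁ ++ (k, k') :: K₂) = (k', (z.task (holeKeys K₁ k K₂)).2) :=
      fun z hz1 hz2 hz3 => Spec.task_hole (by rw [hz1, hK₁.1]) (by rw [hz2, hK₁.1]; omega) hz3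
    have e3 : x.side = true := hl.side_eq x hx hc hb
    rw [challenge, inputKeys_hole, e1]
    cases b
    · simp only [Bool.toNat_false, add_zero, List.take_left, List.drop_left, List.map_append,
        List.map_cons, encList, ev_mapM_append, ev_mapM_cons]
      simp [e2 x rfl rfl e3]
    · simp only [Bool.toNat_true, List.drop_append, List.take_append, List.map_append,
        encList, ev_mapM_append]
      simp [e2 x.zero rfl rfl e3, List.take_of_length_le, List.drop_of_length_le]
  · simp [hu, ev_fun_zero]

end CertSKE

/-! ### Bit operations and table look-up as tree functions -/

namespace Val

theorem ofBits_toBits (v : Val) : ofBits v.toBits = v.map fun x => ofBool x.toBool := by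
  simp [ofBits, toBits, map, Function.comp_def]

@[simp] theorem toList_ofBits (w : Bits) : (ofBits w).toList = w.map ofBool := by simp [ofBits]

@[simp] theorem toNat_ofBits (w : Bits) : (ofBits w).toNat = w.length := by simp [toNat]

@[simp] theorem toList_unary (n : ℕ) : (unary n).toList = List.replicate n nil := by simp [unary]

theorem toBool_ite (c x y : Val) :
    (ite c x y).toBool = if c.toBool then x.toBool else y.toBool := by
  cases c <;> rfl

theorem ite_toBool (c x y : Val) : ite c x y = if c.toBool then x else y := by
  cases c <;> rfl

theorem getD_ofBits (w : Bits) (i : ℕ) :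
    (w.map ofBool).getD i nil = ofBool (w.getD i false) := by
  simp only [List.getD_eq_getElem?_getD, List.getElem?_map]
  cases w[i]? <;> rfl

theorem nth_ofBits (w : Bits) (i : Val) : (ofBits w).nth i = ofBool (w.getD i.toNat false) := by
  rw [nth, toList_ofBits, getD_ofBits]

theorem toBool_nth (v i : Val) : (v.nth i).toBool = v.toBits.getD i.toNat false := by
  simp only [nth, toBits, List.getD_eq_getElem?_getD, List.getElem?_map]
  cases v.toList[i.toNat]? <;> rfl

/-- Exclusive or. -/
def bxor (a b : Val) : Val := ofBool (xor a.toBool b.toBool)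

/-- Equality of unary numbers. -/
def eqNat (a b : Val) : Val := ite (a.drop b) nil (ite (b.drop a) nil (cons nil nil))

theorem eqNat_unary (m n : ℕ) : eqNat (unary m) (unary n) = ofBool (decide (m = n)) := by
  have h : ∀ k x y, ite (unary k) x y = if k = 0 then y else x := by
    intro k x y; cases k <;> rfl
  rw [eqNat, drop_unary, drop_unary, h, h]
  rcases lt_trichotomy m n with h | h | h
  · simp [show m - n = 0 by omega, show ¬ n - m = 0 by omega, show m ≠ n by omega, ofBool]
  · simp [h, ofBool]
  · simp [show ¬ m - n = 0 by omega, show m ≠ n by omega, ofBool]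

/-- Look up an entry of a truth table. -/
def table (t a b : Val) : Val :=
  ofBool (t.nth (ite a (ite b (unary 3) (unary 2)) (ite b (unary 1) (unary 0)))).toBool

theorem table_eq (t a b : Val) : table t a b = ofBool (t.toBits.getD
    ((if a.toBool then 2 else 0) + (if b.toBool then 1 else 0)) false) := by
  rw [table, toBool_nth]
  cases ha : a.toBool <;> cases hb : b.toBool <;> simp [ite_toBool, ha, hb]

/-- Exclusive or of bit strings. -/
def bitsXor (v w : Val) : Val := (v.take w).zipIdx.map fun x => bxor x.hd (w.nth x.tl)

theorem bitsXor_ofBits (v w : Bits) :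
    bitsXor (ofBits v) (ofBits w) = ofBits (CertSKE.xorBits v w) := by
  simp only [bitsXor, map, zipIdx, take, toList_ofList, toList_ofBits, List.map_map,
    Function.comp_def, hd_cons, tl_cons, nth_ofBits, toNat_unary, bxor, toBool_ofBool, toNat_ofBits]
  simp only [ofBits]
  congr 1
  refine List.ext_getElem (by simp [CertSKE.xorBits, min_comm]) fun i h1 h2 => ?_
  have hi : i < w.length := by
    simp [CertSKE.xorBits] at h2
    omega
  simp [CertSKE.xorBits, List.getD_eq_getElem?_getD, hi]

end Val

namespace FP

variable {f g k : Val → Val}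

@[fun_prop]
theorem ofBool_toBool (hf : FP f) : FP fun v => Val.ofBool (f v).toBool := by
  simp only [← Val.ite_eq_ofBool]
  fun_prop

@[fun_prop]
theorem ofBits_toBits (hf : FP f) : FP fun v => Val.ofBits (f v).toBits := by
  simp only [Val.ofBits_toBits]
  fun_prop

@[fun_prop]
theorem bxor (hf : FP f) (hg : FP g) : FP fun v => Val.bxor (f v) (g v) := by
  have : FP fun v => Val.ofBool
      (Val.ite (f v) (Val.ite (g v) Val.nil (Val.cons Val.nil Val.nil)) (g v)).toBool := by fun_prop
  convert this using 2 with v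
  simp only [Val.bxor, Val.toBool_ite]
  cases (f v).toBool <;> cases (g v).toBool <;> rfl

@[fun_prop]
theorem eqNat (hf : FP f) (hg : FP g) : FP fun v => Val.eqNat (f v) (g v) := by
  unfold Val.eqNat; fun_prop

@[fun_prop]
theorem table (hf : FP f) (hg : FP g) (hk : FP k) : FP fun v => Val.table (f v) (g v) (k v) := by
  unfold Val.table; fun_prop

@[fun_prop]
theorem bitsXor (hf : FP f) (hg : FP g) : FP fun v => Val.bitsXor (f v) (g v) := by
  unfold Val.bitsXor; fun_prop

end FP

/-! ### Codes -/

namespace Spec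

def code (x : Spec) : Val :=
  .cons (.unary x.wire) (.cons (.ofBool x.side) (.cons (.ofBits x.pad) (.cons (.unary x.out)
    (.cons (.ofBool x.carry) (.ofBool x.bit)))))

end Spec

namespace Slot

def code (r : Slot) : Val :=
  .cons (.unary r.inA) (.cons (.unary r.inB) (.cons (.unary r.out) (.ofBits r.table)))

def ofVal (v : Val) : Slot where
  inA := v.hd.toNat
  inB := v.tl.hd.toNat
  out := v.tl.tl.hd.toNat
  table := v.tl.tl.tl.toBits

@[simp] theorem ofVal_code (r : Slot) : ofVal r.code = r := by simp [ofVal, code]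

end Slot

def codeKeys (K : List (Bits × Bits)) : Val :=
  .ofList (K.map fun k => .cons (.ofBits k.1) (.ofBits k.2))

/-- The default for missing entries is the empty tree, which is not the code of a pair; but its two
subtrees are the codes of the empty default keys, which is what the next two statements use. -/
theorem nth_codeKeys (K : List (Bits × Bits)) (i : Val) : (codeKeys K).nth i =
    .cons (.ofBits (K.getD i.toNat ([], [])).1) (.ofBits (K.getD i.toNat ([], [])).2) ∨
    (codeKeys K).nth i = .nil ∧ K.getD i.toNat ([], []) = ([], []) := by
  simp only [Val.nth, codeKeys, Val.toList_ofList, List.getD_eq_getElem?_getD, List.getElem?_map]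
  cases K[i.toNat]? <;> simp

theorem hd_nth_codeKeys (K : List (Bits × Bits)) (i : Val) :
    ((codeKeys K).nth i).hd = .ofBits (K.getD i.toNat ([], [])).1 := by
  rcases nth_codeKeys K i with h | ⟨h, h'⟩
  · rw [h, Val.hd_cons]
  · rw [h, h']; rfl

theorem tl_nth_codeKeys (K : List (Bits × Bits)) (i : Val) :
    ((codeKeys K).nth i).tl = .ofBits (K.getD i.toNat ([], [])).2 := by
  rcases nth_codeKeys K i with h | ⟨h, h'⟩
  · rw [h, Val.tl_cons]
  · rw [h, h']; rfl

namespace Val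

/-- The code of a key. -/
def key (K i a : Val) : Val := ite a (K.nth i).tl (K.nth i).hd

theorem key_eq (K : List (Bits × Bits)) (i : ℕ) (a : Bool) :
    key (codeKeys K) (unary i) (ofBool a) = ofBits (wireKey K i a) := by
  rw [key, tl_nth_codeKeys, hd_nth_codeKeys, toNat_unary, ite_ofBool, wireKey, sel]
  cases a <;> rfl

/-- The code of a ciphertext without its dependence on the function. -/
def zeroSpec (x : Val) : Val :=
  cons x.hd (cons x.tl.hd (cons x.tl.tl.hd (cons x.tl.tl.tl.hd (cons x.tl.tl.tl.tl.hd nil))))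

theorem zeroSpec_code (x : Spec) : zeroSpec x.code = x.zero.code := by
  simp [zeroSpec, Spec.code, Spec.zero, ofBool]

/-- The code of the plaintext of a ciphertext. -/
def plain (K x : Val) : Val :=
  ite x.tl.tl.tl.tl.hd (bitsXor x.tl.tl.hd (key K x.tl.tl.tl.hd x.tl.tl.tl.tl.tl)) x.tl.tl.hd

theorem plain_eq (K : List (Bits × Bits)) (x : Spec) :
    plain (codeKeys K) x.code = ofBits (x.task K).2 := by
  simp only [plain, Spec.code, hd_cons, tl_cons, key_eq, bitsXor_ofBits, ite_ofBool, Spec.task]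
  split <;> rfl

/-- The code of an encryption task. -/
def specTask (K x : Val) : Val := cons (cons nil (key K x.hd x.tl.hd)) (plain K x)

theorem specTask_eq (K : List (Bits × Bits)) (x : Spec) :
    specTask (codeKeys K) x.code = CertSKE.codeTask (some (x.task K).1, (x.task K).2) := by
  rw [specTask, plain_eq]
  simp only [Spec.code, hd_cons, tl_cons, key_eq, CertSKE.codeTask, Spec.task]

/-- The code of an encryption task where one key is missing. -/
def holeTask (K w x : Val) : Val :=
  cons (ite (eqNat x.hd w) (ite x.tl.hd nil (cons nil (key K x.hd x.tl.hd)))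
    (cons nil (key K x.hd x.tl.hd))) (plain K x)

theorem holeTask_eq (K : List (Bits × Bits)) (w : ℕ) (x : Spec) :
    holeTask (codeKeys K) (unary w) x.code = CertSKE.codeTask (x.holeTask K w) := by
  rw [holeTask, plain_eq]
  simp only [Spec.code, hd_cons, tl_cons, key_eq, CertSKE.codeTask, Spec.holeTask, eqNat_unary,
    ite_ofBool, decide_eq_true_eq]
  by_cases h1 : x.wire = w <;> by_cases h2 : x.side = true <;> simp [h1, h2]

end Val

namespace FP

variable {f g k : Val → Val}

@[fun_prop]
theorem key (hf : FP f) (hg : FP g) (hk : FP k) : FP fun v => Val.key (f v) (g v) (k v) := by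
  unfold Val.key; fun_prop

@[fun_prop]
theorem zeroSpec (hf : FP f) : FP fun v => Val.zeroSpec (f v) := by
  unfold Val.zeroSpec; fun_prop

@[fun_prop]
theorem plain (hf : FP f) (hg : FP g) : FP fun v => Val.plain (f v) (g v) := by
  unfold Val.plain; fun_prop

@[fun_prop]
theorem specTask (hf : FP f) (hg : FP g) : FP fun v => Val.specTask (f v) (g v) := by
  unfold Val.specTask; fun_prop

@[fun_prop]
theorem holeTask (hf : FP f) (hg : FP g) (hk : FP k) :
    FP fun v => Val.holeTask (f v) (g v) (k v) := by
  unfold Val.holeTask; fun_prop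

end FP

/-! ### Garbled tables -/

namespace Val

/-- The code of an output table, for a code of a pair of keys. -/
def outTable (k y : Val) : Val :=
  cons (cons (ite y k.tl k.hd) nil) (cons (cons (ite y k.hd k.tl) (cons nil nil)) nil)

/-- The classical part of a garbled circuit. -/
def tables (T y K : Val) : Val :=
  cons T ((T.tl.tl.take y).zipIdx.map fun x => outTable (K.nth x.hd) (y.nth x.tl))

theorem tables_eq (T : Topology) (y : Bits) (K : List (Bits × Bits)) :
    tables T.toVal (ofBits y) (codeKeys K) = garbledTables T y K := by
  simp only [tables, garbledTables, Topology.toVal, hd_cons, tl_cons, map, zipIdx, take,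
    toList_ofList, List.map_map, Function.comp_def, toNat_ofBits, nth_ofBits, toNat_unary]
  congr 2
  refine List.ext_getElem (by simp [min_comm]) fun i h1 h2 => ?_
  have hi : i < y.length := by
    simp at h2
    omega
  simp only [List.getElem_map, List.getElem_zipIdx, List.getElem_take, List.getElem_zipWith,
    outTable, hd_nth_codeKeys, tl_nth_codeKeys, toNat_unary, ite_ofBool, zero_add,
    List.getD_eq_getElem?_getD, List.getElem?_eq_getElem hi, Option.getD_some, outputTable, sel]
  cases y[i] <;> simp [ofList, ofBool]

end Val

namespace FP

variable {f g k : Val → Val}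

@[fun_prop]
theorem outTable (hf : FP f) (hg : FP g) : FP fun v => Val.outTable (f v) (g v) := by
  unfold Val.outTable; fun_prop

@[fun_prop]
theorem tables (hf : FP f) (hg : FP g) (hk : FP k) :
    FP fun v => Val.tables (f v) (g v) (k v) := by
  unfold Val.tables; fun_prop

end FP

theorem map_take_codeKeys (N : ℕ) (K : List (Bits × Bits)) :
    ((codeKeys K).take (.unary N)).map Val.hd = .ofList ((inputKeys N K).map .ofBits) := by
  simp [Val.map, Val.take, codeKeys, inputKeys, ← List.map_take, Function.comp_def]

/-! ### The circuit -/

namespace Circuit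

variable (C : Circuit)

theorem fp_inputs : FP fun v => .unary (ofVal v).inputs := by
  simp only [ofVal]; fun_prop

theorem fp_topology : FP fun v => (ofVal v).topology.toVal := by
  have : FP fun v : Val => Val.cons (.unary v.hd.toNat) (.cons (v.tl.hd.map fun g =>
    .cons (.unary g.tl.hd.toNat) (.unary g.tl.tl.toNat)) (v.tl.tl.map fun o => .unary o.toNat)) := by
    fun_prop
  convert this using 2 with v
  simp [Topology.toVal, topology, ofVal, gateOfVal, Val.map, Function.comp_def]

/-- The code of the value of the outgoing wire of a gate. -/
def gateV (u g : Val) : Val := Val.table g.hd (u.nth g.tl.hd) (u.nth g.tl.tl)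

theorem gateV_ofBits (w : Bits) (g : Val) : gateV (.ofBits w) g =
    .ofBool ((gateOfVal g).fn (w.getD (gateOfVal g).inA false) (w.getD (gateOfVal g).inB false)) := by
  rw [gateV, Val.table_eq, Val.nth_ofBits, Val.nth_ofBits, Val.toBool_ofBool, Val.toBool_ofBool]
  rfl

/-- The input of the circuit. -/
def input (v : Val) : Bits := fitBits (ofVal v.hd).inputs v.tl.toBits

theorem length_input (v : Val) : (input v).length = (ofVal v.hd).inputs := by
  simp [input, fitBits]

theorem fp_input : FP fun v => .ofBits (input v) := by
  have h := fp_inputs.comp (g := Val.hd) (by fun_prop)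
  have : FP fun v : Val => ((Val.ofBits v.tl.toBits).append (.unary (ofVal v.hd).inputs)).take
    (.unary (ofVal v.hd).inputs) := by fun_prop
  convert this using 2 with v
  rw [Val.take, Val.append, Val.toNat_unary, Val.toList_ofList, Val.ofBits, input, fitBits]
  simp [List.map_take, Val.ofBool]

theorem fp_wireValues : FP fun v => .ofBits ((ofVal v.hd).wireValues (input v)) := by
  have h : FP fun w : Val => w.tl.tl.append (.cons (gateV w.tl.tl w.hd) .nil) := by
    unfold gateV; fun_prop
  have := FP.foldl_additive (F := fun v => v.hd.tl.hd) (I := fun v => .ofBits (input v))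
    (G := fun _ g u => u.append (.cons (gateV u g) .nil)) (by fun_prop) fp_input h 10
    (fun v x u => by
      have h1 := Val.size_ofList_append u.toList [gateV u x]
      have h2 : (gateV u x).size ≤ 3 := by
        rw [gateV, Val.table_eq]
        cases List.getD _ _ _ <;> simp [Val.ofBool, Val.size]
      simp only [Val.append, Val.toList_cons, Val.toList_nil]
      simp only [Val.ofList_toList, Val.ofList, Val.size] at h1
      simp
      omega)
  convert this using 2 with v
  simp only [wireValues, ofVal]
  generalize input v = w
  generalize v.hd.tl.hd.toList = l
  induction l generalizing w with
  | nil => rfl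
  | cons g l ih =>
    simp only [List.map_cons, List.foldl_cons]
    rw [ih, gateV_ofBits]
    congr 1
    simp [Val.append, Val.ofBits]

theorem fp_output : FP fun v => .ofBits ((ofVal v.hd).output (input v)) := by
  have h := fp_wireValues
  have : FP fun v : Val => v.hd.tl.tl.map fun o =>
    (Val.ofBits ((ofVal v.hd).wireValues (input v))).nth o := by
    have h1 := h.comp (g := Val.hd) (by fun_prop)
    fun_prop
  convert this using 2 with v
  simp only [Val.map, Val.nth_ofBits]
  simp [output, ofVal, Val.ofBits, Function.comp_def]

/-- The code of a gate relative to the values of its wires. -/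
def slotV (N u x : Val) : Val :=
  .cons (.unary x.hd.tl.hd.toNat) (.cons (.unary x.hd.tl.tl.toNat) (.cons (N.append x.tl)
    ((Val.ofList [.cons .nil .nil, .cons .nil (.cons .nil .nil), .cons (.cons .nil .nil) .nil,
      .cons (.cons .nil .nil) (.cons .nil .nil)]).map fun e => Val.bxor (Val.table x.hd.hd
        (Val.bxor e.hd (u.nth x.hd.tl.hd)) (Val.bxor e.tl (u.nth x.hd.tl.tl)))
          (u.nth (N.append x.tl)))))

@[fun_prop]
theorem fp_slotV {f g k : Val → Val} (hf : FP f) (hg : FP g) (hk : FP k) :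
    FP fun v => slotV (f v) (g v) (k v) := by
  unfold slotV; fun_prop

theorem slotV_eq (C : Circuit) (w : Bits) (g : Val) (i : ℕ) :
    slotV (.unary C.inputs) (.ofBits w) (.cons g (.unary i)) =
      (C.slot w (gateOfVal g) i).code := by
  simp only [slotV, Val.hd_cons, Val.tl_cons, Slot.code, slot, ← Val.unary_add, Val.map,
    Val.toList_ofList, List.map_cons, List.map_nil, Val.nth_ofBits, Val.table_eq, Val.bxor,
    Val.toBool_ofBool, Val.toNat_unary, gateOfVal]
  rfl

theorem fp_slots :
    FP fun v => .ofList (((ofVal v.hd).slots ((ofVal v.hd).wireValues (input v))).map Slot.code) := by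
  have h1 : FP fun w => .unary (ofVal w.hd.hd).inputs :=
    fp_inputs.comp (g := fun w => w.hd.hd) (by fun_prop)
  have h2 := fp_wireValues.comp (g := Val.hd) (by fun_prop)
  have : FP fun v : Val => v.hd.tl.hd.zipIdx.map (slotV (.unary (ofVal v.hd).inputs)
    (.ofBits ((ofVal v.hd).wireValues (input v)))) := by
    fun_prop
  convert this using 2 with v
  simp only [slots, Val.map, Val.zipIdx, Val.toList_ofList, List.map_map, Function.comp_def,
    slotV_eq]
  simp only [ofVal, List.zipIdx_map, List.map_map]
  rfl

end Circuit

namespace Topology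

@[simp] theorem ofVal_toVal (T : Topology) : ofVal T.toVal = T := by
  simp [ofVal, toVal, Function.comp_def]

theorem fp_slots : FP fun v => .ofList ((ofVal v).slots.map Slot.code) := by
  have : FP fun v : Val => v.tl.hd.zipIdx.map fun x => .cons (.unary x.hd.hd.toNat)
    (.cons (.unary x.hd.tl.toNat) (.cons ((Val.unary v.hd.toNat).append x.tl) .nil)) := by
    fun_prop
  convert this using 2 with v
  simp only [slots, Val.map, Val.zipIdx, Val.toList_ofList, List.map_map, Function.comp_def,
    Val.hd_cons, Val.tl_cons, ← Val.unary_add, ofVal, List.zipIdx_map]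
  rfl

end Topology

/-! ### Sampling -/

namespace FR

variable {f : Val → ℕ} {F : Val → Val}

theorem congr {f g : Val → CQ Val} (hf : FR f) (h : ∀ v φ, ev (g v) φ = ev (f v) φ) : FR g := by
  rwa [show g = f from funext fun v => ext_ev (h v)]

theorem keyGen (S : CertSKE) (hf : FP fun v => .unary (f v)) :
    FR fun v => Val.ofBits <$> S.keyGen (f v) := by
  obtain ⟨P, hP⟩ := S.keyGen_qpt.2
  have hB : FP fun v => .unary ((P.comp (2 * X + 1)).eval (f v)) := by
    have := FP.poly (P.comp (2 * X + 1)) hf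
    simpa only [Val.toNat_unary] using this
  refine ((FR.traceOut S.keyGen_qpt hf hB fun v z hz => ?_).map
    (G := fun _ a => .ofBits a.toBits) (by fun_prop)).congr fun v φ => ?_
  · have := hP _ _ z hz
    simpa [Val.size_unary] using this
  · simp [CertSKE.keyGen]

theorem keyPair (S : CertSKE) (hf : FP fun v => .unary (f v)) :
    FR fun v => (fun k : Bits × Bits => Val.cons (.ofBits k.1) (.ofBits k.2)) <$>
      S.keyPair (f v) := by
  have h2 : FR fun w => Val.ofBits <$> S.keyGen (f w.hd) := keyGen S (hf.comp (g := Val.hd)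
    (by fun_prop))
  refine ((keyGen S hf).bind (g := fun v a => Val.cons a <$> Val.ofBits <$> S.keyGen (f v))
    (h2.map (G := fun w b => .cons w.tl b) (by fun_prop))).congr fun v φ => ?_
  simp [CertSKE.keyPair]

theorem keyPairs (S : CertSKE) (hf : FP fun v => .unary (f v)) {N : Val → ℕ}
    (hN : FP fun v => .unary (N v)) : FR fun v => codeKeys <$> S.keyPairs (f v) (N v) := by
  refine (mapM (g := fun v _ => (fun k : Bits × Bits => Val.cons (.ofBits k.1) (.ofBits k.2)) <$>
    S.keyPair (f v)) ((keyPair S hf).comp (F := Val.hd) (by fun_prop)) hN).congr fun v φ => ?_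
  have := S.keyPairs_eq (f v) (Val.unary (N v)).toList
  rw [Val.toList_unary, List.length_replicate] at this
  rw [this, ev_map, ev_map, Val.toList_unary]
  generalize List.replicate (N v) Val.nil = l
  have h : ∀ φ : List Val → Bits → Bits → ℂ, (ev (l.mapM fun _ => S.keyPair (f v)) fun K =>
      φ (K.map fun k => Val.cons (.ofBits k.1) (.ofBits k.2))) =
      ev (l.mapM fun _ => (fun k : Bits × Bits => Val.cons (.ofBits k.1) (.ofBits k.2)) <$>
        S.keyPair (f v)) φ := by
    induction l with
    | nil => intro φ; simp
    | cons a l ih =>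
      intro φ
      rw [ev_mapM_cons, ev_mapM_cons, ev_map]
      refine ev_fun_congr fun k s t => ?_
      rw [← ih]
      rfl
  rw [← h]
  rfl

theorem completePairs (S : CertSKE) (hf : FP fun v => .unary (f v)) {L : Val → List Bits}
    (hL : FP fun v => .ofList ((L v).map .ofBits)) :
    FR fun v => codeKeys <$> S.completePairs (f v) (L v) := by
  have h2 : FR fun w => Val.ofBits <$> S.keyGen (f w.hd) := keyGen S (hf.comp (g := Val.hd)
    (by fun_prop))
  refine (mapM (g := fun v x => Val.cons x <$> Val.ofBits <$> S.keyGen (f v))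
    (h2.map (G := fun w b => .cons w.tl b) (by fun_prop)) hL).congr fun v φ => ?_
  rw [ev_map, ev_map, Val.toList_ofList]
  generalize L v = l
  have h : ∀ φ : List Val → Bits → Bits → ℂ, (ev (S.completePairs (f v) l) fun K =>
      φ (K.map fun k => Val.cons (.ofBits k.1) (.ofBits k.2))) =
      ev ((l.map Val.ofBits).mapM fun x => Val.cons x <$> Val.ofBits <$> S.keyGen (f v)) φ := by
    induction l with
    | nil => intro φ; simp [CertSKE.completePairs]
    | cons a l ih =>
      intro φ
      rw [CertSKE.completePairs, List.map_cons, ev_mapM_cons, ev_mapM_cons, ← CertSKE.completePairs]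
      simp only [ev_map, ev_bind, ev_pure]
      refine ev_fun_congr fun k s t => ?_
      rw [← ih]
      simp
  rw [← h]
  rfl

/-- A uniform string is a sequence of independent uniform bits, the form in which programs sample
it. -/
theorem ev_uniform_succ (k : ℕ) (φ : Bits → ℂ) :
    (ev (List.ofFn <$> CQ.uniform (Fin (k + 1) → Bool)) fun P _ _ => φ P) =
      ev (CQ.uniform Bool) fun b _ _ => ev (List.ofFn <$> CQ.uniform (Fin k → Bool)) fun P _ _ =>
        φ (b :: P) := by
  simp only [ev_map, ev_uniform]
  rw [← Equiv.sum_comp (Fin.consEquiv fun _ => Bool), Fintype.sum_prod_type]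
  simp only [Fin.consEquiv_apply, List.ofFn_succ, Fin.cons_zero, Fin.cons_succ, Fintype.card_pi,
    Finset.prod_const, Finset.card_univ, Fintype.card_fin, Fintype.card_bool, Finset.mul_sum]
  refine Finset.sum_congr rfl fun b _ => Finset.sum_congr rfl fun P _ => ?_
  push_cast
  rw [pow_succ, mul_inv]
  ring

theorem randomKey (S : CertSKE) (hf : FP fun v => .unary (f v)) :
    FR fun v => Val.ofBits <$> S.randomKey (f v) := by
  have hN : FP fun v => .unary (S.keyLen.eval (f v)) := by
    have := FP.poly S.keyLen hf
    simpa only [Val.toNat_unary] using this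
  refine (mapM (g := fun _ _ => Val.rand (.ofList [.ofBool true, .ofBool false]))
    (FR.rand (FP.const _)) hN).congr fun v φ => ?_
  rw [CertSKE.randomKey, Val.toList_unary]
  generalize S.keyLen.eval (f v) = k
  have h : ∀ φ : List Val → ℂ, (ev (List.ofFn <$> CQ.uniform (Fin k → Bool)) fun P _ _ =>
      φ (P.map Val.ofBool)) = ev ((List.replicate k Val.nil).mapM fun _ =>
        Val.rand (.ofList [.ofBool true, .ofBool false])) fun l _ _ => φ l := by
    induction k with
    | zero => intro φ; simp [ev_uniform]
    | succ k ih =>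
      intro φ
      rw [ev_uniform_succ k fun P => φ (P.map Val.ofBool), List.replicate_succ, ev_mapM_cons,
        Val.ev_rand (by simp), ev_uniform]
      simp [← ih, mul_add]
  have h1 : Memoryless (CQ.uniform (Fin k → Bool)) := memoryless_uniform
  have h2 : Memoryless ((List.replicate k Val.nil).mapM fun _ =>
        Val.rand (.ofList [.ofBool true, .ofBool false])) :=
    memoryless_mapM (fun _ => Val.memoryless_rand _) _
  simp only [ev_map] at h ⊢
  rw [h1.ev, h2.ev, ← h]
  rfl

/-- The code of a uniformly random order of the entries of a gate. -/
def permCode : CQ Val := (fun γ : Equiv.Perm (Bool × Bool) => Val.ofList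
  (CertSKE.entries.map fun e => .cons (.ofBool (γ e).1) (.ofBool (γ e).2))) <$>
    CQ.uniform (Equiv.Perm (Bool × Bool))

/-- The permutations of the four entries form a fixed finite list, so a random order is a random
entry of a constant. -/
theorem perm : FR fun _ => permCode := by
  refine (FR.rand (FP.const (.ofList ((Finset.univ : Finset (Equiv.Perm (Bool × Bool))).toList.map
    fun γ => Val.ofList (CertSKE.entries.map fun e => .cons (.ofBool (γ e).1)
      (.ofBool (γ e).2)))))).congr fun v φ => ?_
  rw [Val.ev_rand, permCode, ev_map, ev_uniform, List.map_map, List.length_map,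
    Finset.length_toList, Function.comp_def, Finset.sum_map_toList, Finset.card_univ]
  simp [Finset.univ_nonempty.ne_empty]

/-- The code of a list of descriptions of ciphertexts. -/
def _root_.codeSpecs (l : List Spec) : Val := .ofList (l.map Spec.code)

theorem fp_fn {R : Val → Slot} {a b : Val → Bool} (hR : FP fun v => (R v).code)
    (ha : FP fun v => .ofBool (a v)) (hb : FP fun v => .ofBool (b v)) :
    FP fun v => .ofBool ((R v).fn (a v) (b v)) := by
  have : FP fun v => Val.table (R v).code.tl.tl.tl (.ofBool (a v)) (.ofBool (b v)) := by fun_prop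
  convert this using 2 with v
  simp [Val.table_eq, Slot.code, Slot.fn]

theorem fp_specs {R : Val → Slot} {a b : Val → Bool} {P : Val → Bits} (hR : FP fun v => (R v).code)
    (ha : FP fun v => .ofBool (a v)) (hb : FP fun v => .ofBool (b v))
    (hP : FP fun v => .ofBits (P v)) : FP fun v => codeSpecs ((R v).specs (a v, b v) (P v)) := by
  have h1 : FP fun v => .unary (R v).inA := by
    simpa [Slot.code] using hR.hd
  have h2 : FP fun v => .unary (R v).inB := by
    simpa [Slot.code] using hR.tl.hd
  have h3 : FP fun v => .unary (R v).out := by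
    simpa [Slot.code] using hR.tl.tl.hd
  have h4 := fp_fn hR ha hb
  have h5 : FP fun v => .ofBool (!a v) := by
    have : FP fun v => Val.bxor (.ofBool (a v)) (.ofBool true) := by fun_prop
    simpa [Val.bxor] using this
  simp only [codeSpecs, Slot.specs, List.map_cons, List.map_nil, Spec.code, Val.ofList]
  fun_prop

/-- The codes of the two ciphertexts for an entry of the truth table. -/
def entrySpecs (S : CertSKE) (n : ℕ) (r : Slot) (e : Val) : CQ Val :=
  (fun P => codeSpecs (r.specs (e.hd.toBool, e.tl.toBool) P)) <$> S.randomKey n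

theorem entry (S : CertSKE) (hf : FP fun v => .unary (f v)) {R : Val → Slot} {E : Val → Val}
    (hR : FP fun v => (R v).code) (hE : FP E) : FR fun v => entrySpecs S (f v) (R v) (E v) := by
  refine ((randomKey S hf).map (G := fun v P => codeSpecs ((R v).specs ((E v).hd.toBool,
    (E v).tl.toBool) P.toBits)) ?_).congr fun v φ => ?_
  · have h1 := hR.comp (g := Val.hd) (by fun_prop)
    have h2 := hE.comp (g := Val.hd) (by fun_prop)
    exact fp_specs h1 (by fun_prop) (by fun_prop) (by fun_prop)
  · simp [entrySpecs]

theorem ev_entrySpecs (S : CertSKE) (n : ℕ) (r : Slot) (γ : Bool × Bool → Bool × Bool)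
    (l : List (Bool × Bool)) (φ : List Val → ℂ) :
    (ev (l.mapM fun e => r.specs (γ e) <$> S.randomKey n) fun b _ _ => φ (b.map codeSpecs)) =
      ev ((l.map fun e => Val.cons (.ofBool (γ e).1) (.ofBool (γ e).2)).mapM
        (entrySpecs S n r)) fun b _ _ => φ b := by
  induction l generalizing φ with
  | nil => simp
  | cons a l ih =>
    rw [List.map_cons, ev_mapM_cons, ev_mapM_cons]
    simp only [ev_map, entrySpecs, Val.hd_cons, Val.tl_cons, Val.toBool_ofBool]
    exact ev_fun_congr fun P _ _ => ih fun b => φ (codeSpecs (r.specs (γ a) P) :: b)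

theorem memoryless_entrySpecs (S : CertSKE) (n : ℕ) (r : Slot) (e : Val) :
    Memoryless (entrySpecs S n r e) := (S.memoryless_randomKey _).map _

theorem entries (S : CertSKE) (hf : FP fun v => .unary (f v)) {R : Val → Slot}
    (hR : FP fun v => (R v).code) : FR fun w => (fun a => a.flatten) <$> Val.ofList <$>
      w.tl.toList.mapM (entrySpecs S (f w.hd) (R w.hd)) :=
  (mapM (g := fun w => entrySpecs S (f w.hd) (R w.hd)) (F := Val.tl)
    (entry S (hf.comp (g := fun w => w.hd.hd) (by fun_prop))
      (hR.comp (g := fun w => w.hd.hd) (by fun_prop)) (by fun_prop)) (by fun_prop)).map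
      (G := fun _ a => a.flatten) (by fun_prop)

theorem gate (S : CertSKE) (hf : FP fun v => .unary (f v)) {R : Val → Slot}
    (hR : FP fun v => (R v).code) : FR fun v => permCode >>= fun a =>
      (fun a => a.flatten) <$> Val.ofList <$> a.toList.mapM (entrySpecs S (f v) (R v)) := by
  have hb := entries S hf hR
  exact FR.bind (f := fun _ => permCode) perm hb

theorem sampleSlot (S : CertSKE) (hf : FP fun v => .unary (f v)) {R : Val → Slot}
    (hR : FP fun v => (R v).code) : FR fun v => codeSpecs <$> S.sampleSlot (f v) (R v) := by
  refine (gate S hf hR).congr fun v φ => ?_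
  rw [ev_map, (S.memoryless_sampleSlot (f v) (R v)).ev,
    S.ev_sampleSlot _ fun l => φ (codeSpecs l) [] []]
  simp only [ev_bind, permCode, ev_map, Val.toList_ofList]
  refine memoryless_uniform.ev_congr fun γ => ?_
  rw [(memoryless_mapM (memoryless_entrySpecs S (f v) (R v)) _).ev,
    ← ev_entrySpecs S (f v) (R v) γ _ fun l =>
      φ (Val.flatten (Val.ofList l)) ([] ++ []) ([] ++ [])]
  refine ev_fun_congr fun b _ _ => ?_
  simp [Val.flatten, codeSpecs, List.map_flatten, Function.comp_def]

theorem sampleSpecs (S : CertSKE) (hf : FP fun v => .unary (f v)) {R : Val → List Slot}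
    (hR : FP fun v => .ofList ((R v).map Slot.code)) :
    FR fun v => codeSpecs <$> S.sampleSpecs (f v) (R v) := by
  have hg : FR fun w => codeSpecs <$> S.sampleSlot (f w.hd) (Slot.ofVal w.tl) := by
    refine sampleSlot S (hf.comp (g := Val.hd) (by fun_prop)) ?_
    simp only [Slot.code, Slot.ofVal]
    fun_prop
  refine ((mapM (g := fun v x => codeSpecs <$> S.sampleSlot (f v) (Slot.ofVal x)) hg hR).map
    (G := fun _ a => a.flatten) (by fun_prop)).congr fun v φ => ?_
  simp only [CertSKE.sampleSpecs, ev_map, Val.toList_ofList]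
  generalize R v = l
  have h : ∀ φ : List Val → Bits → Bits → ℂ, (ev (l.mapM (S.sampleSlot (f v)))
      fun b => φ (b.map codeSpecs)) =
      ev ((l.map Slot.code).mapM fun x => codeSpecs <$> S.sampleSlot (f v) (Slot.ofVal x)) φ := by
    induction l with
    | nil => intro φ; simp
    | cons a l ih =>
      intro φ
      rw [List.map_cons, ev_mapM_cons, ev_mapM_cons]
      simp only [ev_map, Slot.ofVal_code]
      refine ev_fun_congr fun P _ _ => ?_
      rw [← ih]
      rfl
  rw [← h]
  refine ev_fun_congr fun b _ _ => ?_
  simp [Val.flatten, codeSpecs, List.map_flatten, Function.comp_def]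

end FR

theorem codeKeys_append (K K' : List (Bits × Bits)) :
    codeKeys (K ++ K') = (codeKeys K).append (codeKeys K') := by
  simp [codeKeys, Val.ofList_append]

theorem map_codeSpecs {g : Val → Val} {l : List Spec} {β : Type} {h : Spec → β} {c : β → Val}
    (hg : ∀ x ∈ l, g x.code = c (h x)) : (codeSpecs l).map g = .ofList ((l.map h).map c) := by
  simp only [codeSpecs, Val.map, Val.toList_ofList, List.map_map]
  congr 1
  exact List.map_congr_left hg

namespace CertSKE

variable (S : CertSKE) {n : ℕ}

/-! ### The simulator -/

/-- The descriptions of the ciphertexts and the keys that the simulator chooses. -/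
def simPlan (w : Val) : CQ Val := do
  let K₁ ← S.completePairs w.hd.toNat (w.tl.tl.tl.toList.map Val.toBits)
  let K₂ ← S.keyPairs w.hd.toNat (Topology.ofVal w.tl.hd).wires.length
  let l ← S.sampleSpecs w.hd.toNat (Topology.ofVal w.tl.hd).slots
  return .cons w (.cons (codeKeys (K₁ ++ K₂)) (codeSpecs l))

theorem fr_simPlan₁ : FR fun w =>
    codeKeys <$> S.completePairs w.hd.toNat (w.tl.tl.tl.toList.map Val.toBits) := by
  refine FR.completePairs S (by fun_prop) ?_
  have : FP fun w : Val => w.tl.tl.tl.map fun x => .ofBits x.toBits := by fun_prop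
  simpa [Val.map, Function.comp_def] using this

theorem fr_simPlan₂ : FR fun u =>
    codeKeys <$> S.keyPairs u.hd.hd.toNat (Topology.ofVal u.hd.tl.hd).wires.length := by
  refine FR.keyPairs S (by fun_prop) ?_
  have : FP fun u : Val => .unary u.hd.tl.hd.tl.hd.toNat := by fun_prop
  simpa [Topology.ofVal, Val.toNat] using this

theorem fr_simPlan₃ : FR fun z => codeSpecs <$>
    S.sampleSpecs z.hd.hd.hd.toNat (Topology.ofVal z.hd.hd.tl.hd).slots :=
  FR.sampleSpecs S (by fun_prop) (Topology.fp_slots.comp (g := fun z => z.hd.hd.tl.hd) (by fun_prop))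

/-- Each new choice is paired with what was known before, so the depth of `hd` counts the choices
made since. The sampler is assembled from the innermost choice outwards. -/
theorem fr_simPlan : FR S.simPlan := by
  have h3 : FR fun z => (fun c => .cons z.hd.hd (.cons (z.hd.tl.append z.tl) c)) <$> codeSpecs <$>
      S.sampleSpecs z.hd.hd.hd.toNat (Topology.ofVal z.hd.hd.tl.hd).slots :=
    S.fr_simPlan₃.map (G := fun z c => .cons z.hd.hd (.cons (z.hd.tl.append z.tl) c)) (by fun_prop)
  have h2 : FR fun u => (codeKeys <$> S.keyPairs u.hd.hd.toNat
      (Topology.ofVal u.hd.tl.hd).wires.length) >>= fun b =>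
      (fun c => .cons u.hd (.cons (u.tl.append b) c)) <$> codeSpecs <$>
      S.sampleSpecs u.hd.hd.toNat (Topology.ofVal u.hd.tl.hd).slots :=
    S.fr_simPlan₂.bind h3
  have h1 : FR fun w => (codeKeys <$> S.completePairs w.hd.toNat
      (w.tl.tl.tl.toList.map Val.toBits)) >>= fun a =>
      (codeKeys <$> S.keyPairs w.hd.toNat (Topology.ofVal w.tl.hd).wires.length) >>= fun b =>
      (fun c => .cons w (.cons (a.append b) c)) <$> codeSpecs <$>
      S.sampleSpecs w.hd.toNat (Topology.ofVal w.tl.hd).slots :=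
    S.fr_simPlan₁.bind h2
  refine h1.congr fun w φ => ?_
  simp [simPlan, codeKeys_append]

theorem fp_simTasks : FP fun P => .cons (P.tl.tl.map (Val.specTask P.tl.hd)) (.cons (.cons
    (.unary P.hd.hd.toNat) (P.tl.tl.map fun _ => .unary (S.ctLen.eval P.hd.hd.toNat)).flatten)
      .nil) := by
  have := FP.poly S.ctLen (f := fun w => w.hd.hd.hd) (by fun_prop)
  have h := FP.map (G := fun P _ => .unary (S.ctLen.eval P.hd.hd.toNat)) (F := fun P => P.tl.tl)
    (by fun_prop) this
  fun_prop

theorem fp_simOutput : FP fun z => .cons (Val.tables z.hd.hd.tl.hd z.hd.hd.tl.tl.hd z.hd.tl.hd)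
    z.tl.tl.rev := by fun_prop

/-- The simulator garbles the constant function `0`, on the given labels. -/
def sim : Prog :=
  .seq S.fr_simPlan.prog (.seq (.pair .skip (.seq S.fp_simTasks.prog (S.encAll .nil)))
    fp_simOutput.prog)

theorem qpt_sim : S.sim.QPT :=
  ⟨⟨S.fr_simPlan.queryFree, ⟨trivial, S.fp_simTasks.queryFree, S.queryFree_encAll trivial⟩,
    fp_simOutput.queryFree⟩, S.fr_simPlan.polyTime.seq ((Prog.polyTime_skip.pair
      (S.fp_simTasks.polyTime.seq (S.polyTime_encAll Prog.polyTime_nil))).seq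
        fp_simOutput.polyTime)⟩

theorem memoryless_completePairs (n : ℕ) (l : List Bits) : Memoryless (S.completePairs n l) :=
  memoryless_mapM (fun _ => (S.memoryless_keyGen n).bind fun _ => memoryless_pure _) _

theorem supp_completePairs {l : List Bits} (hl : ∀ k ∈ l, k.length = S.keyLen.eval n) :
    Supp (S.completePairs n l) fun K _ _ => K.map Prod.fst = l ∧ S.FitKeys n K := by
  have := supp_mapM_forall₂ (f := fun k => do
      let k' ← S.keyGen n
      return (k, k')) (Q := fun k p => p.1 = k ∧ p.1.length = S.keyLen.eval n ∧
    p.2.length = S.keyLen.eval n) (l := l) fun k hk => supp_bind (S.supp_keyGen n)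
      fun k' _ _ h => supp_pure ⟨rfl, hl k hk, h⟩
  refine this.mono fun K _ _ h => ?_
  clear this
  induction h with
  | nil => exact ⟨rfl, by simp [FitKeys]⟩
  | @cons k p l K hp h ih =>
    obtain ⟨h1, h2⟩ := ih fun k hk => hl k (by simp [hk])
    refine ⟨by simp [hp.1, h1], fun q hq => ?_⟩
    rcases List.mem_cons.1 hq with rfl | hq
    · exact hp.2
    · exact h2 q hq

theorem FitKeys.append {S : CertSKE} {K K' : List (Bits × Bits)} (h : S.FitKeys n K)
    (h' : S.FitKeys n K') : S.FitKeys n (K ++ K') :=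
  fun k hk => (List.mem_append.1 hk).elim (h k) (h' k)

/-- The choices of the simulator have no quantum part, so the program for the encryptions starts
with empty memory; regularity of the gates provides the lengths of all keys and plaintexts. -/
theorem ev_simulate {T : Topology} (hT : Slot.Regular T T.slots) (y : Bits) {labels : List Bits}
    (hl : ∀ k ∈ labels, k.length = S.keyLen.eval n) (hl' : labels.length = T.inputs)
    (φ : Val × Val → Bits → Bits → ℂ) :
    ev (GarblingScheme.simulate S.sim n T y labels) φ =
      ev (S.completePairs n labels) fun K₁ _ _ => ev (S.keyPairs n T.wires.length) fun K₂ _ _ =>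
        ev (S.sampleSpecs n T.slots) fun l _ _ => ev (S.encList n (l.map (Spec.task (K₁ ++ K₂))))
          fun vks => φ (garbledTables T y (K₁ ++ K₂), .ofList (vks.map .ofBits)) := by
  rw [GarblingScheme.simulate, ev_map, Prog.run, sim, Prog.ev_seq, S.fr_simPlan.den, simPlan]
  simp only [ev_bind, ev_pure, Val.hd_cons, Val.tl_cons, Val.toNat_unary, Topology.ofVal_toVal,
    Val.toList_ofList, List.map_map, Function.comp_def, Val.toBits_ofBits, List.map_id']
  refine ((S.memoryless_completePairs n labels).ev _).trans
    (ev_congr (S.supp_completePairs hl) fun K₁ _ _ hK₁ => ?_)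
  refine ((S.memoryless_keyPairs n _).ev _).trans
    (ev_congr (S.supp_keyPairs n _) fun K₂ _ _ hK₂ => ?_)
  refine ((S.memoryless_sampleSpecs n _).ev _).trans
    (ev_congr (S.supp_sampleSpecs hT) fun l _ _ hl => ?_)
  have hK := hK₁.2.append hK₂.2
  have hlen : (K₁ ++ K₂).length = T.inputs + T.wires.length := by
    rw [List.length_append, hK₂.1, ← hl', ← hK₁.1, List.length_map]
  rw [Prog.ev_seq, Prog.ev_pair]
  simp only [Prog.den, ev_ket, List.append_nil, S.fp_simTasks.ev_den, Val.hd_cons, Val.tl_cons,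
    Val.toNat_unary, ev_apply]
  rw [map_codeSpecs (h := fun x => (some (x.task (K₁ ++ K₂)).1, (x.task (K₁ ++ K₂)).2))
    (c := codeTask) fun x _ => Val.specTask_eq _ x,
    -- All tasks of the simulator come with a key, so the unknown key is an irrelevant default.
    S.ev_encAll (sk := []) ?_ ?_ rfl ?_]
  · simp only [fp_simOutput.ev_den, Val.hd_cons, Val.tl_cons]
    simp only [List.map_map, Function.comp_def, Option.getD_some, List.nil_append, Val.tables_eq,
      Val.rev, Val.toList_ofList, Val.toList_nil, List.append_nil, List.reverse_reverse]
  · rintro _ h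
    obtain ⟨x, hx, rfl⟩ := List.mem_map.1 h
    exact (hl.fits hK hlen hx).1
  · rintro _ hx h
    obtain ⟨x, hx, rfl⟩ := List.mem_map.1 hx
    simp at h
  · simp [Val.flatten, Val.map, codeSpecs, Val.toNat, Function.comp_def]

/-- The simulated experiment, up to the point where the adversary obtains the garbled circuit. -/
theorem ev_simulate_keyPairs {T : Topology} (hT : Slot.Regular T T.slots) (y : Bits) {x : Bits}
    (hx : x.length = T.inputs) (φ : List Bits → Val → Val → Bits → Bits → ℂ) :
    (ev (S.keyPairs n T.inputs) fun labels _ _ =>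
      ev (GarblingScheme.simulate S.sim n T y (GarblingScheme.activeLabels labels x)) fun g s t =>
        φ (GarblingScheme.activeLabels labels x) g.1 g.2 s t) =
    S.hybrid n T y T.slots 0 fun act c vks => φ act c (.ofList (vks.map .ofBits)) := by
  -- The input pairs of the hybrid are replaced by completions of active labels: the inactive labels
  -- from `Setup` are never used, and the simulator chooses new ones with the same distribution.
  rw [hybrid, ev_keyPairs_add, ← hx, ← S.ev_keyPairs_complete x fun K₁ =>
    ev (S.keyPairs n T.wires.length) fun K₂ _ _ => ev (S.sampleSpecs n T.slots) fun l _ _ =>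
      ev (S.encList n (((l.take 0).map Spec.zero ++ l.drop 0).map (Spec.task (K₁ ++ K₂))))
        fun vks => φ (inputKeys x.length (K₁ ++ K₂)) (garbledTables T y (K₁ ++ K₂))
          (.ofList (vks.map .ofBits))]
  refine ev_congr (S.supp_keyPairs n _) fun labels _ _ hL => ?_
  have h1 : ∀ k ∈ GarblingScheme.activeLabels labels x, k.length = S.keyLen.eval n := by
    intro k hk
    obtain ⟨i, hi, rfl⟩ := List.getElem_of_mem hk
    simp only [GarblingScheme.activeLabels, List.length_zipWith] at hi
    have := hL.2 labels[i] (List.getElem_mem _)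
    simp only [GarblingScheme.activeLabels, List.getElem_zipWith, sel]
    split
    · exact this.2
    · exact this.1
  rw [S.ev_simulate hT y h1 (by simp [GarblingScheme.activeLabels, hL.1, hx])]
  refine ev_congr (S.supp_completePairs h1) fun K₁ _ _ hK₁ => ev_fun_congr fun K₂ _ _ =>
    ev_fun_congr fun l _ _ => ?_
  have h2 : inputKeys x.length (K₁ ++ K₂) = GarblingScheme.activeLabels labels x := by
    have : x.length = K₁.length := by
      rw [← List.length_map (f := Prod.fst) (as := K₁), hK₁.1]
      simp [GarblingScheme.activeLabels, hL.1]
    rw [inputKeys, this, List.take_left, hK₁.1]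
  simp [h2]

end CertSKE

/-! ### The reduction -/

theorem hd_nth_codeSpecs (l : List Spec) (j : Val) :
    ((codeSpecs l).nth j).hd = .unary (wireAt l j.toNat) := by
  simp only [Val.nth, codeSpecs, Val.toList_ofList, List.getD_eq_getElem?_getD, List.getElem?_map,
    wireAt]
  cases l[j.toNat]?
  · rfl
  · simp [Spec.code]

theorem nth_codeSpecs {l : List Spec} {j : ℕ} (hj : j < l.length) :
    (codeSpecs l).nth (.unary j) = (l[j]).code := by
  simp [Val.nth, codeSpecs, List.getD_eq_getElem?_getD, hj]

theorem codeKeys_holeKeys (K₁ : List (Bits × Bits)) (k : Bits) (K₂ : List (Bits × Bits)) :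
    codeKeys (holeKeys K₁ k K₂) =
      (codeKeys K₁).append (.cons (.cons (.ofBits k) .nil) (codeKeys K₂)) := by
  rw [holeKeys, codeKeys_append]
  rfl

namespace CertSKE

variable (S : CertSKE) {n : ℕ}

/-- The circuit that the adversary chooses. -/
def chosen (w : Val) : Circuit := .ofVal w.tl.hd.hd

/-- The input that the adversary chooses. -/
def chosenInput (w : Val) : Bits := Circuit.input w.tl.hd

/-- The gates of the circuit, relative to the values of the wires. -/
def chosenSlots (w : Val) : List Slot :=
  (chosen w).slots ((chosen w).wireValues (chosenInput w))

/-- The number of wires. -/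
def chosenSize (w : Val) : ℕ := (chosen w).inputs + (chosen w).gates.length

/-- The descriptions of the ciphertexts, the index of the challenge, and the keys, which are chosen
by the reduction. -/
def redPlan (N : Polynomial ℕ) (w : Val) : CQ Val := do
  let l ← S.sampleSpecs w.hd.toNat (chosenSlots w)
  let j ← Val.rand (.ofList ((List.range (N.eval w.hd.toNat)).map .unary))
  let K₁ ← S.keyPairs w.hd.toNat (wireAt l j.toNat)
  let k ← S.keyGen w.hd.toNat
  let K₂ ← S.keyPairs w.hd.toNat (chosenSize w - (wireAt l j.toNat + 1))
  return .cons w (.cons (codeSpecs l) (.cons j (codeKeys (holeKeys K₁ k K₂))))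

theorem fr_redSpecs : FR fun w => codeSpecs <$> S.sampleSpecs w.hd.toNat (chosenSlots w) :=
  FR.sampleSpecs S (by fun_prop) (Circuit.fp_slots.comp (g := fun w => w.tl.hd) (by fun_prop))

theorem fp_poly_security (P : Polynomial ℕ) : FP fun w => .unary (P.eval w.hd.toNat) :=
  FP.poly P (by fun_prop)

theorem fr_redIndex (N : Polynomial ℕ) :
    FR fun z => Val.rand (.ofList ((List.range (N.eval z.hd.hd.toNat)).map .unary)) := by
  have h := (fp_poly_security N).comp (g := Val.hd) (by fun_prop)
  have : FP fun z => (Val.unary (N.eval z.hd.hd.toNat)).zipIdx.map fun x => x.tl := by fun_prop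
  refine FR.rand ?_
  convert this using 2 with z
  simp only [Val.map, Val.zipIdx, Val.toList_ofList, List.map_map, Function.comp_def, Val.tl_cons]
  congr 1
  rw [show (fun x : Val × ℕ => Val.unary x.2) = Val.unary ∘ Prod.snd from rfl, ← List.map_map,
    List.zipIdx_map_snd]
  simp [List.range_eq_range']

theorem fr_redKeys₁ : FR fun z =>
    codeKeys <$> S.keyPairs z.hd.hd.hd.toNat (z.hd.tl.nth z.tl).hd.toNat :=
  FR.keyPairs S (by fun_prop) (by fun_prop)

theorem fr_redKey : FR fun z => Val.ofBits <$> S.keyGen z.hd.hd.hd.hd.toNat :=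
  FR.keyGen S (by fun_prop)

theorem fr_redKeys₂ : FR fun z => codeKeys <$> S.keyPairs z.hd.hd.hd.hd.hd.toNat
    (chosenSize z.hd.hd.hd.hd - ((z.hd.hd.hd.tl.nth z.hd.hd.tl).hd.toNat + 1)) := by
  refine FR.keyPairs S (by fun_prop) ?_
  have : FP fun z : Val => ((Val.unary z.hd.hd.hd.hd.tl.hd.hd.hd.toNat).append
    (.unary z.hd.hd.hd.hd.tl.hd.hd.tl.hd.toNat)).drop
      (.cons .nil (.unary (z.hd.hd.hd.tl.nth z.hd.hd.tl).hd.toNat)) := by fun_prop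
  convert this using 2 with z
  rw [← Val.unary_add, ← Val.unary_succ, Val.drop_unary]
  simp [chosenSize, chosen, Circuit.ofVal, Val.toNat]

/-- The result of the choices of the reduction. -/
def redCombine (z c : Val) : Val :=
  .cons z.hd.hd.hd.hd (.cons z.hd.hd.hd.tl (.cons z.hd.hd.tl
    (z.hd.tl.append (.cons (.cons z.tl .nil) c))))

/-- The environment is a nested pair that grows to the left with each choice; `h5` to `h1` add the
choices from the last to the first. The wire of the challenge is read off from the code of the
description with index `j`. -/
theorem fr_redPlan (N : Polynomial ℕ) : FR (S.redPlan N) := by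
  have h5 : FR fun z => redCombine z <$> codeKeys <$> S.keyPairs z.hd.hd.hd.hd.hd.toNat
      (chosenSize z.hd.hd.hd.hd - ((z.hd.hd.hd.tl.nth z.hd.hd.tl).hd.toNat + 1)) :=
    S.fr_redKeys₂.map (G := redCombine) (by unfold redCombine; fun_prop)
  have h4 : FR fun z => (Val.ofBits <$> S.keyGen z.hd.hd.hd.hd.toNat) >>= fun k =>
      redCombine (.cons z k) <$> codeKeys <$> S.keyPairs z.hd.hd.hd.hd.toNat
        (chosenSize z.hd.hd.hd - ((z.hd.hd.tl.nth z.hd.tl).hd.toNat + 1)) := by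
    refine S.fr_redKey.bind (g := fun z k => redCombine (.cons z k) <$> codeKeys <$>
      S.keyPairs z.hd.hd.hd.hd.toNat
        (chosenSize z.hd.hd.hd - ((z.hd.hd.tl.nth z.hd.tl).hd.toNat + 1))) ?_
    exact h5
  have h3 : FR fun z => (codeKeys <$> S.keyPairs z.hd.hd.hd.toNat (z.hd.tl.nth z.tl).hd.toNat) >>=
      fun K => (Val.ofBits <$> S.keyGen z.hd.hd.hd.toNat) >>= fun k =>
      redCombine (.cons (.cons z K) k) <$> codeKeys <$> S.keyPairs z.hd.hd.hd.toNat
        (chosenSize z.hd.hd - ((z.hd.tl.nth z.tl).hd.toNat + 1)) := by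
    refine S.fr_redKeys₁.bind (g := fun z K => (Val.ofBits <$> S.keyGen z.hd.hd.hd.toNat) >>=
      fun k => redCombine (.cons (.cons z K) k) <$> codeKeys <$> S.keyPairs z.hd.hd.hd.toNat
        (chosenSize z.hd.hd - ((z.hd.tl.nth z.tl).hd.toNat + 1))) ?_
    exact h4
  have h2 : FR fun z => Val.rand (.ofList ((List.range (N.eval z.hd.hd.toNat)).map .unary)) >>=
      fun j => (codeKeys <$> S.keyPairs z.hd.hd.toNat (z.tl.nth j).hd.toNat) >>=
      fun K => (Val.ofBits <$> S.keyGen z.hd.hd.toNat) >>= fun k =>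
      redCombine (.cons (.cons (.cons z j) K) k) <$> codeKeys <$> S.keyPairs z.hd.hd.toNat
        (chosenSize z.hd - ((z.tl.nth j).hd.toNat + 1)) := by
    refine (fr_redIndex N).bind (g := fun z j => (codeKeys <$> S.keyPairs z.hd.hd.toNat
      (z.tl.nth j).hd.toNat) >>= fun K => (Val.ofBits <$> S.keyGen z.hd.hd.toNat) >>= fun k =>
      redCombine (.cons (.cons (.cons z j) K) k) <$> codeKeys <$> S.keyPairs z.hd.hd.toNat
        (chosenSize z.hd - ((z.tl.nth j).hd.toNat + 1))) ?_
    exact h3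
  have h1 : FR fun w => (codeSpecs <$> S.sampleSpecs w.hd.toNat (chosenSlots w)) >>= fun l =>
      Val.rand (.ofList ((List.range (N.eval w.hd.toNat)).map .unary)) >>=
      fun j => (codeKeys <$> S.keyPairs w.hd.toNat (l.nth j).hd.toNat) >>=
      fun K => (Val.ofBits <$> S.keyGen w.hd.toNat) >>= fun k =>
      redCombine (.cons (.cons (.cons (.cons w l) j) K) k) <$> codeKeys <$> S.keyPairs w.hd.toNat
        (chosenSize w - ((l.nth j).hd.toNat + 1)) := by
    refine S.fr_redSpecs.bind (g := fun w l => Val.rand (.ofList ((List.range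
      (N.eval w.hd.toNat)).map .unary)) >>=
      fun j => (codeKeys <$> S.keyPairs w.hd.toNat (l.nth j).hd.toNat) >>=
      fun K => (Val.ofBits <$> S.keyGen w.hd.toNat) >>= fun k =>
      redCombine (.cons (.cons (.cons (.cons w l) j) K) k) <$> codeKeys <$> S.keyPairs w.hd.toNat
        (chosenSize w - ((l.nth j).hd.toNat + 1))) ?_
    exact h2
  refine h1.congr fun w φ => ?_
  simp only [redPlan, ev_bind, ev_map, ev_pure, redCombine, Val.hd_cons, Val.tl_cons,
    hd_nth_codeSpecs, Val.toNat_unary, codeKeys_holeKeys, List.append_nil]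

theorem fp_redTasks₁ (M : Polynomial ℕ) : FP fun P => .cons
    (((P.tl.hd.take P.tl.tl.hd).map Val.zeroSpec).map
      (Val.holeTask P.tl.tl.tl (P.tl.hd.nth P.tl.tl.hd).hd))
    (.cons (.cons (.unary P.hd.hd.toNat) (.unary (M.eval P.hd.hd.toNat))) .nil) := by
  have := (fp_poly_security M).comp (g := Val.hd) (by fun_prop)
  fun_prop

theorem fp_redMessages : FP fun z => .cons
    (.cons (Val.plain z.hd.tl.tl.tl (z.hd.tl.hd.nth z.hd.tl.tl.hd))
      (Val.plain z.hd.tl.tl.tl (Val.zeroSpec (z.hd.tl.hd.nth z.hd.tl.tl.hd))))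
    (.cons z.hd z.tl.tl.rev) := by fun_prop

theorem fp_redFrame (T : Polynomial ℕ) : FP fun w => .cons (.unary (T.eval w.hd.toNat)) w := by
  have := fp_poly_security T
  fun_prop

/-- The first stage of the reduction: everything up to the challenge. The polynomials bound the
number of qubits of the adversary, the number of ciphertexts and the number of all qubits. -/
def redA (A : Prog) (T N M : Polynomial ℕ) : Prog :=
  .seq (.pair .skip A) (.seq (fp_redFrame T).prog (.frame (.seq (S.fr_redPlan N).prog
    (.seq (.pair .skip (.seq (fp_redTasks₁ M).prog (S.encAll .query))) fp_redMessages.prog))))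

theorem polyTime_redA {A : Prog} (hA : A.PolyTime) (T N M : Polynomial ℕ) :
    (S.redA A T N M).PolyTime :=
  (Prog.polyTime_skip.pair hA).seq ((fp_redFrame T).polyTime.seq
    ((S.fr_redPlan N).polyTime.seq ((Prog.polyTime_skip.pair ((fp_redTasks₁ M).polyTime.seq
      (S.polyTime_encAll Prog.polyTime_query))).seq fp_redMessages.polyTime)).frame)

theorem fp_redTasks₂ (M : Polynomial ℕ) : FP fun u => .cons
    ((u.tl.hd.tl.hd.drop (.cons .nil u.tl.hd.tl.tl.hd)).map
      (Val.holeTask u.tl.hd.tl.tl.tl (u.tl.hd.tl.hd.nth u.tl.hd.tl.tl.hd).hd))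
    (.cons (.cons (.unary u.hd.toNat) (.unary (M.eval u.hd.toNat))) .nil) := by
  have := fp_poly_security M
  fun_prop

/-- The input of the second stage of the adversary, for a plan. -/
def redInput (w K : Val) : Val :=
  .cons w.hd (.cons w.tl.tl (.cons (Val.tables (chosen w).topology.toVal
    (.ofBits ((chosen w).output (chosenInput w))) K)
      ((K.take (.unary (chosen w).inputs)).map Val.hd)))

theorem fp_redInput : FP fun z => redInput z.hd z.tl := by
  have h1 := Circuit.fp_topology.comp (g := fun z => z.hd.tl.hd.hd) (by fun_prop)
  have h2 := Circuit.fp_output.comp (g := fun z => z.hd.tl.hd) (by fun_prop)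
  have h3 := Circuit.fp_inputs.comp (g := fun z => z.hd.tl.hd.hd) (by fun_prop)
  unfold redInput chosen chosenInput
  fun_prop

theorem fp_redInput' : FP fun z => redInput z.hd.tl.hd.hd z.hd.tl.hd.tl.tl.tl :=
  fp_redInput.comp (g := fun z => .cons z.hd.tl.hd.hd z.hd.tl.hd.tl.tl.tl) (by fun_prop)

theorem fp_redMem (M : Polynomial ℕ) : FP fun z => .unary (M.eval z.hd.hd.hd.toNat) :=
  FP.poly M (by fun_prop)

/-- The context for the verification of the certificates from position `o` on. -/
def vrfyContext (n o : ℕ) : Val :=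
  .cons (.unary n) (.cons (.unary (S.certLen.eval n)) (.cons (.unary o)
    (.unary (S.vrfyBound.eval n))))

theorem fp_redVrfy₁ : FP fun z => .cons z.hd.hd.hd.tl.tl
    (.cons (S.vrfyContext z.hd.hd.hd.hd.toNat 0) (.cons z.tl (.ofBool true))) := by
  have h1 := FP.poly S.certLen (f := fun z => z.hd.hd.hd.hd) (by fun_prop)
  have h2 := FP.poly S.vrfyBound (f := fun z => z.hd.hd.hd.hd) (by fun_prop)
  unfold vrfyContext
  fun_prop

/-- After the first loop the certificate of the challenge is at the front and has to stay there, so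
the second loop works from position `certLen` on. The number of qubits has decreased by `certLen`
for each certificate verified before. -/
theorem fp_redVrfy₂ : FP fun z => .cons z.hd.hd.hd.tl.tl.rev
    (.cons (S.vrfyContext z.hd.hd.hd.hd.hd.toNat (S.certLen.eval z.hd.hd.hd.hd.hd.toNat))
      (.cons (z.hd.tl.drop (z.hd.hd.hd.hd.tl.tl.map
        fun _ => .unary (S.certLen.eval z.hd.hd.hd.hd.hd.toNat)).flatten) (.ofBool true))) := by
  have h1 := FP.poly S.certLen (f := fun z => z.hd.hd.hd.hd.hd) (by fun_prop)
  have h2 := FP.poly S.vrfyBound (f := fun z => z.hd.hd.hd.hd.hd) (by fun_prop)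
  have h3 := FP.poly S.certLen (f := fun z => z.hd.hd.hd.hd.hd.hd) (by fun_prop)
  have h4 := FP.map (G := fun z _ => .unary (S.certLen.eval z.hd.hd.hd.hd.hd.toNat))
    (F := fun z => z.hd.hd.hd.hd.tl.tl) (by fun_prop) h3
  unfold vrfyContext
  fun_prop

/-- The second stage of the reduction: the certificates other than that for the challenge are
verified and removed. It returns all of its classical data. -/
def redB (B : Prog) (M M' : Polynomial ℕ) : Prog :=
  .seq (.pair .skip (.seq (fp_redTasks₂ M).prog (S.encAll .query)))
    (.seq (.pair .skip (.seq fp_redInput'.prog B))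
      (.seq (.pair .skip (.seq (fp_redMem M').prog .memLen))
        (.seq (.pair .skip (.seq S.fp_redVrfy₁.prog S.vrfyLoop))
          (.pair .skip (.seq S.fp_redVrfy₂.prog S.vrfyLoop)))))

theorem polyTime_redB {B : Prog} (hB : B.PolyTime) (M M' : Polynomial ℕ) :
    (S.redB B M M').PolyTime :=
  (Prog.polyTime_skip.pair ((fp_redTasks₂ M).polyTime.seq
    (S.polyTime_encAll Prog.polyTime_query))).seq
    ((Prog.polyTime_skip.pair (fp_redInput'.polyTime.seq hB)).seq
      ((Prog.polyTime_skip.pair ((fp_redMem M').polyTime.seq Prog.polyTime_memLen)).seq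
        ((Prog.polyTime_skip.pair (S.fp_redVrfy₁.polyTime.seq S.polyTime_vrfyLoop)).seq
          (Prog.polyTime_skip.pair (S.fp_redVrfy₂.polyTime.seq S.polyTime_vrfyLoop)))))

end CertSKE

/-! ### The second stage of the reduction -/

namespace CertSKE

variable (S : CertSKE) {n : ℕ}

/-- The continuation of the experiment after the second stage of the adversary. -/
def accept (n : ℕ) (k vk : Bits) (E : Bits × Val → Matrix Bits Bits ℂ) (z : Val) (s t : Bits) : ℂ :=
  let c := S.certLen.eval n
  if c ≤ s.length ∧ c ≤ t.length then
    (ev (S.vrfy n vk (s.take c) (t.take c)) fun ok _ _ => if ok then 1 else 0) *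
      E (k, z) (t.drop c) (s.drop c)
  else 0

/-- The result of the verification is classical and independent of the remaining qubits of a basis
state, so acceptance is a scalar factor in front of the final effect. -/
theorem acceptProb_experiment (A B : Prog) (n : ℕ) (b : Bool)
    (E : Bits × Val → Matrix Bits Bits ℂ) :
    (S.experiment A B n b).acceptProb E = (ev (S.keyGen n) fun k _ _ =>
      ev (A.den (S.encOracle n k) (.unary n) [] []) fun v s t =>
        ev (S.enc n k (fitBits (S.keyLen.eval n)
          (if b then v.hd.tl.toBits else v.hd.hd.toBits))) fun vk s' t' =>
          ev (B.den (S.encOracle n k) (.cons (.unary n) v.tl) (s ++ s') (t ++ t'))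
            (S.accept n k vk E)).re := by
  rw [acceptProb_eq, experiment]
  simp only [ev_apply, ev_bind, ev_pure, List.append_nil]
  refine congrArg Complex.re ?_
  rw [(S.memoryless_keyGen n).ev]
  refine ev_fun_congr fun k _ _ => ev_fun_congr fun v s t => ev_fun_congr fun vk s' t' => ?_
  simp only [List.nil_append]
  refine ev_fun_congr fun z s t => ?_
  simp only [accept]
  split
  · simp only [ev_apply, ev_ket]
    rw [← ev_mul_right]
    refine ev_fun_congr fun ok _ _ => ?_
    cases ok <;> simp
  · simp

/-- The conditions that the reduction needs on its choices. -/
def redGood (P : Val) : Prop :=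
  (chosen P.hd).Valid ∧
    ((P.tl.hd.nth P.tl.tl.hd).tl.tl.tl.tl.hd.toBool && (P.tl.hd.nth P.tl.tl.hd).tl.tl.tl.tl.tl.toBool)

/-- The number of qubits of the certificates of a garbled circuit. -/
def garbledCertLen (n : ℕ) (w : Val) : ℕ := 8 * (chosen w).gates.length * S.certLen.eval n

open Classical in
/-- The unbounded stage of the reduction. -/
def redEffect (A₂ : ℕ → Val → Matrix Bits Bits ℂ) (n : ℕ) (x : Bits × Val) : Matrix Bits Bits ℂ :=
  if redGood x.2.hd.hd.hd.hd.hd.tl.hd ∧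
    S.garbledCertLen n x.2.hd.hd.hd.hd.hd.tl.hd.hd ≤ x.2.hd.hd.tl.toNat ∧
    x.2.hd.tl.tl.tl.toBool ∧ x.2.tl.tl.tl.toBool then A₂ n x.2.hd.hd.hd.tl else 0

open scoped ComplexOrder in
-- The reduction hands all of its classical data to the unbounded stage, which rejects with the
-- effect `0` unless the guess was useful, the memory long enough and both loops successful.
-- Otherwise it measures as the given adversary, without using the revealed key.
theorem isEffect_redEffect {A₂ : ℕ → Val → Matrix Bits Bits ℂ} (h : ∀ n z, IsEffect (A₂ n z))
    (n : ℕ) (x : Bits × Val) : IsEffect (S.redEffect A₂ n x) := by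
  unfold redEffect
  split
  · exact h _ _
  · exact ⟨Matrix.PosSemidef.zero, by simpa using Matrix.PosSemidef.one⟩

theorem ev_redB (B : Prog) (M M' : Polynomial ℕ) (O : Val → CQ Val) (u : Val) (s t : Bits)
    (φ : Val → Bits → Bits → ℂ) :
    ev ((S.redB B M M').den O u s t) φ =
      ev ((S.encAll .query).den O (.cons
        ((u.tl.hd.tl.hd.drop (.cons .nil u.tl.hd.tl.tl.hd)).map
          (Val.holeTask u.tl.hd.tl.tl.tl (u.tl.hd.tl.hd.nth u.tl.hd.tl.tl.hd).hd))
        (.cons (.cons (.unary u.hd.toNat) (.unary (M.eval u.hd.toNat))) .nil)) s t) fun e s t =>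
      ev (B.den O (redInput u.tl.hd.hd u.tl.hd.tl.tl.tl) s t) fun st s t =>
      ev (Prog.memLen.den O (.unary (M'.eval u.hd.toNat)) s t) fun m s t =>
      ev (S.vrfyLoop.den O (.cons u.tl.tl
        (.cons (S.vrfyContext u.hd.toNat 0) (.cons m (.ofBool true)))) s t) fun r₁ s t =>
      ev (S.vrfyLoop.den O (.cons e.tl.rev
        (.cons (S.vrfyContext u.hd.toNat (S.certLen.eval u.hd.toNat))
          (.cons (m.drop (u.tl.tl.map fun _ => .unary (S.certLen.eval u.hd.toNat)).flatten)
            (.ofBool true)))) s t) fun r₂ s t =>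
      φ (.cons (.cons (.cons (.cons (.cons u e) st) m) r₁) r₂) s t := by
  simp only [redB, Prog.ev_seq, Prog.ev_pair, (fp_redTasks₂ M).ev_den, fp_redInput'.ev_den,
    (fp_redMem M').ev_den, S.fp_redVrfy₁.ev_den, S.fp_redVrfy₂.ev_den]
  simp only [Prog.den, ev_ket, Val.hd_cons, Val.tl_cons]

theorem ev_redB_of_not_good {B : Prog} {M M' : Polynomial ℕ} {O : Val → CQ Val} {u : Val}
    (hu : ¬ redGood u.tl.hd) (A₂ : ℕ → Val → Matrix Bits Bits ℂ) (k vk s t : Bits) :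
    ev ((S.redB B M M').den O u s t) (S.accept n k vk (S.redEffect A₂ n)) = 0 := by
  rw [ev_redB]
  simp [accept, redEffect, hu, ev_fun_zero]

end CertSKE

namespace CertSKE

variable (S : CertSKE) {n : ℕ}

/-- The verification of `c` qubits of certificates, and the measurement of the other qubits. -/
def finish (n c : ℕ) (E : Val → Matrix Bits Bits ℂ) (vks : List Bits) (st : Val) (s t : Bits) : ℂ :=
  if c ≤ s.length ∧ c ≤ t.length then S.vrfyProd n vks s t * E st (t.drop c) (s.drop c) else 0

theorem toNat_flatten_map (l : Val) (c : ℕ) :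
    ((l.map fun _ => .unary c).flatten) = .unary (l.toNat * c) := by
  have : ∀ (l : List Val), (l.map fun _ => List.replicate c Val.nil).flatten =
      List.replicate (l.length * c) Val.nil := by
    intro l
    induction l with
    | nil => simp
    | cons a l ih =>
      rw [List.map_cons, List.flatten_cons, ih, List.length_cons, ← List.replicate_add]
      congr 1
      ring
  simp only [Val.flatten, Val.map, Val.toList_ofList, List.map_map, Function.comp_def,
    Val.toList_unary, this]
  rfl

/-- Verification of the earlier certificates by the reduction, of the challenge by the experiment,
and of the later ones by the reduction multiply to the verification of all certificates in their
original order. -/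
theorem finish_split {c q : ℕ} (hc : c = S.certLen.eval n) {vks₁ vks₂ : List Bits} (vk : Bits)
    (hq : vks₁.length + 1 + vks₂.length = q) (E : Val → Matrix Bits Bits ℂ) (st : Val)
    {s t : Bits} (hs : q * c ≤ s.length) (hst : s.length = t.length) :
    S.vrfyProd n vks₁ s t * (S.vrfyProd n vks₂ ((s.drop (vks₁.length * c)).drop c)
        ((t.drop (vks₁.length * c)).drop c) *
      ((ev (S.vrfy n vk ((s.drop (vks₁.length * c)).take c) ((t.drop (vks₁.length * c)).take c))
        fun ok _ _ => if ok then 1 else 0) * E st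
          (((t.drop (vks₁.length * c)).drop c).drop (vks₂.length * c))
          (((s.drop (vks₁.length * c)).drop c).drop (vks₂.length * c)))) =
      S.finish n (q * c) E (vks₁ ++ vk :: vks₂) st s t := by
  have h1 : vks₁.length * c + c + vks₂.length * c = q * c := by rw [← hq]; ring
  rw [finish, if_pos ⟨hs, hst ▸ hs⟩, vrfyProd_append, vrfyProd]
  simp only [List.drop_drop, ← hc, h1]
  ring

theorem redEffect_of_good {A₂ : ℕ → Val → Matrix Bits Bits ℂ} {x : Bits × Val}
    (h : redGood x.2.hd.hd.hd.hd.hd.tl.hd ∧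
      S.garbledCertLen n x.2.hd.hd.hd.hd.hd.tl.hd.hd ≤ x.2.hd.hd.tl.toNat ∧
      x.2.hd.tl.tl.tl.toBool ∧ x.2.tl.tl.tl.toBool) :
    S.redEffect A₂ n x = A₂ n x.2.hd.hd.hd.tl := if_pos h

theorem redEffect_of_not_good {A₂ : ℕ → Val → Matrix Bits Bits ℂ} {x : Bits × Val}
    (h : ¬ (redGood x.2.hd.hd.hd.hd.hd.tl.hd ∧
      S.garbledCertLen n x.2.hd.hd.hd.hd.hd.tl.hd.hd ≤ x.2.hd.hd.tl.toNat ∧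
      x.2.hd.tl.tl.tl.toBool ∧ x.2.tl.tl.tl.toBool)) :
    S.redEffect A₂ n x = 0 := if_neg h

/-- The first loop removes the certificates before that of the challenge, the second those behind
it. What remains is the certificate of the challenge, followed by the internal state, as the IND-CPA
experiment expects it. -/
theorem ev_verification {O : Val → CQ Val} {M' : Polynomial ℕ} {P e st : Val} {k vk : Bits}
    {vks₁ vks₂ : List Bits} (hP : redGood P)
    (h₁ : ∀ vk ∈ vks₁, vk.length = S.vkLen.eval n) (h₂ : ∀ vk ∈ vks₂, vk.length = S.vkLen.eval n)
    (hq : vks₁.length + 1 + vks₂.length = 8 * (chosen P.hd).gates.length)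
    (he : e.tl = .ofList (vks₂.map .ofBits).reverse) (A₂ : ℕ → Val → Matrix Bits Bits ℂ)
    {s t : Bits} (hst : s.length = t.length) (hM : s.length ≤ M'.eval n) :
    (ev (Prog.memLen.den O (.unary (M'.eval n)) s t) fun m s t =>
      ev (S.vrfyLoop.den O (.cons (.ofList (vks₁.map .ofBits))
        (.cons (S.vrfyContext n 0) (.cons m (.ofBool true)))) s t) fun r₁ s t =>
      ev (S.vrfyLoop.den O (.cons e.tl.rev
        (.cons (S.vrfyContext n (S.certLen.eval n))
          (.cons (m.drop ((Val.ofList (vks₁.map .ofBits)).map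
            fun _ => .unary (S.certLen.eval n)).flatten) (.ofBool true)))) s t) fun r₂ s t =>
      S.accept n k vk (S.redEffect A₂ n) (.cons (.cons (.cons (.cons (.cons (.cons (.unary n)
        (.cons P (.ofList (vks₁.map .ofBits)))) e) st) m) r₁) r₂) s t) =
      S.finish n (S.garbledCertLen n P.hd) (A₂ n) (vks₁ ++ vk :: vks₂) st s t := by
  rw [Prog.ev_memLen hst (by simpa using hM)]
  set c := S.certLen.eval n with hc
  by_cases hs : S.garbledCertLen n P.hd ≤ s.length
  · have hs' : vks₁.length * c + c + vks₂.length * c ≤ s.length := by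
      refine le_trans (le_of_eq ?_) hs
      rw [garbledCertLen, ← hq, ← hc]
      ring
    let φ₂ : Bits → Bits → ℂ := fun s t => if c ≤ s.length ∧ c ≤ t.length then
      (ev (S.vrfy n vk (s.take c) (t.take c)) fun ok _ _ => if ok then 1 else 0) *
      A₂ n st (t.drop c) (s.drop c) else 0
    have e2 : e.tl.rev = .ofList (vks₂.map .ofBits) := by simp [he, Val.rev]
    have e3 : (Val.unary s.length).drop ((Val.ofList (vks₁.map .ofBits)).map
        fun _ => .unary c).flatten = .unary (s.drop (vks₁.length * c)).length := by
      rw [toNat_flatten_map, Val.drop_unary]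
      simp [Val.toNat]
    rw [e2, e3]
    have hloop := S.ev_vrfyLoop (O := O) h₁ (o := 0) (m := s.length) true (s₁ := []) (t₁ := [])
      (s₂ := s) (t₂ := t) rfl rfl hst (by rw [← hc]; omega) (by simp)
      (fun s' t' => ev (S.vrfyLoop.den O (.cons (.ofList (vks₂.map .ofBits))
        (.cons (S.vrfyContext n c) (.cons (.unary (s.drop (vks₁.length * c)).length)
          (.ofBool true)))) s' t') fun r₂ s t => if r₂.tl.tl.toBool then φ₂ s t else 0)
      (fun r₁ s' t' => ev (S.vrfyLoop.den O (.cons (.ofList (vks₂.map .ofBits))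
        (.cons (S.vrfyContext n c) (.cons (.unary (s.drop (vks₁.length * c)).length)
          (.ofBool true)))) s' t') fun r₂ a b => S.accept n k vk (S.redEffect A₂ n)
            (.cons (.cons (.cons (.cons (.cons (.cons (.unary n)
        (.cons P (.ofList (vks₁.map .ofBits)))) e) st) (.unary s.length)) r₁) r₂) a b) ?_
    · refine hloop.trans ?_
      simp only [if_true, List.nil_append, ← hc]
      have hd : s.drop (vks₁.length * c) = (s.drop (vks₁.length * c)).take c ++
        (s.drop (vks₁.length * c)).drop c := by rw [List.take_append_drop]
      have hd' : t.drop (vks₁.length * c) = (t.drop (vks₁.length * c)).take c ++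
        (t.drop (vks₁.length * c)).drop c := by rw [List.take_append_drop]
      have hl : ((s.drop (vks₁.length * c)).take c).length = c := by simp; omega
      have hl' : ((t.drop (vks₁.length * c)).take c).length = c := by simp; omega
      have hloop₂ := S.ev_vrfyLoop (O := O) h₂ (o := c)
        (m := (s.drop (vks₁.length * c)).length) true
        (s₁ := (s.drop (vks₁.length * c)).take c) (t₁ := (t.drop (vks₁.length * c)).take c)
        (s₂ := (s.drop (vks₁.length * c)).drop c) (t₂ := (t.drop (vks₁.length * c)).drop c)
        hl hl' (by simp [hst]) (by rw [← hc]; simp; omega)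
        (by rw [List.take_append_drop]) φ₂ (fun r₂ s t => if r₂.tl.tl.toBool then φ₂ s t else 0)
        (fun _ _ ok _ _ => by simp)
      simp only [List.take_append_drop] at hloop₂
      refine (congrArg _ hloop₂).trans ?_
      rw [if_pos trivial]
      have hφ : ∀ a b : Bits, φ₂ ((s.drop (vks₁.length * c)).take c ++ a)
          ((t.drop (vks₁.length * c)).take c ++ b) =
          (ev (S.vrfy n vk ((s.drop (vks₁.length * c)).take c) ((t.drop (vks₁.length * c)).take c))
          fun ok _ _ => if ok then 1 else 0) * A₂ n st b a := by
        intro a b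
        simp only [φ₂]
        rw [if_pos ⟨by rw [List.length_append, hl]; omega, by rw [List.length_append, hl']; omega⟩,
          List.take_left' hl, List.take_left' hl', List.drop_left' hl, List.drop_left' hl']
      rw [hφ, garbledCertLen, ← hc]
      exact S.finish_split hc vk hq (A₂ n) st hs hst
    · intro a m ok s' t'
      cases ok
      -- After a rejection in the first loop the final effect is `0`, whatever the second loop does.
      · simp [accept, redEffect, Val.ofBool, ev_fun_zero]
      · simp only [if_true]
        refine ev_fun_congr fun r₂ s' t' => ?_
        by_cases h : r₂.tl.tl.toBool = true
        · rw [if_pos h, accept, redEffect_of_good]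
          · rfl
          · exact ⟨hP, by simpa using hs, by simp, h⟩
        · rw [if_neg h, accept, redEffect_of_not_good]
          · simp
          · exact fun h' => h h'.2.2.2
  -- With too few qubits the garbling experiment aborts; the loops may then do anything, because the
  -- final effect checks the recorded number of qubits.
  · rw [finish, if_neg (fun h => hs h.1)]
    simp [accept, redEffect, hs, ev_fun_zero]

end CertSKE

/-! ### The reduction realizes the experiment with a challenge ciphertext -/

namespace CertSKE

variable (S : CertSKE) {n : ℕ}

theorem take_codeSpecs (l : List Spec) (j : ℕ) :
    (codeSpecs l).take (.unary j) = codeSpecs (l.take j) := by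
  simp [codeSpecs, Val.take]

theorem drop_codeSpecs (l : List Spec) (j : ℕ) :
    (codeSpecs l).drop (.cons .nil (.unary j)) = codeSpecs (l.drop (j + 1)) := by
  rw [← Val.unary_succ]
  simp [codeSpecs, Val.drop]

theorem map_zeroSpec (l : List Spec) :
    (codeSpecs l).map Val.zeroSpec = codeSpecs (l.map Spec.zero) := by
  simp [codeSpecs, Val.map, Val.zeroSpec_code, Function.comp_def]

/-- Encryption of ciphertexts with the help of an oracle for the missing key. -/
theorem ev_encAll_hole {K₁ K₂ : List (Bits × Bits)} {k k' : Bits} {l : List Spec} {M : ℕ}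
    (hl : ∀ x ∈ l, S.Fits n (x.task (K₁ ++ (k, k') :: K₂)))
    (ho : ∀ x ∈ l, x.bit = true → x.out ≠ K₁.length) {s t : Bits} (hst : s.length = t.length)
    (hM : s.length + l.length * S.ctLen.eval n ≤ M) (φ : Val → Bits → Bits → ℂ) :
    ev ((S.encAll .query).den (S.encOracle n k') (.cons ((codeSpecs l).map
      (Val.holeTask (codeKeys (holeKeys K₁ k K₂)) (.unary K₁.length)))
        (.cons (.cons (.unary n) (.unary M)) .nil)) s t) φ =
      ev (S.encList n (l.map (Spec.task (K₁ ++ (k, k') :: K₂)))) fun vks s' t' =>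
        φ (.cons (.cons (.unary n) (.unary M)) (.ofList (vks.map .ofBits).reverse))
          (s ++ s') (t ++ t') := by
  have h : ∀ x ∈ l, _ := fun x hx => Spec.holeTask_getD (K₂ := K₂) (k := k) (k' := k') (ho x hx)
  rw [map_codeSpecs (h := Spec.holeTask (holeKeys K₁ k K₂) K₁.length) (c := codeTask)
    fun x _ => Val.holeTask_eq _ _ x, S.ev_encAll (sk := k') ?_ ?_ hst ?_]
  · rw [List.map_map, List.map_congr_left (g := Spec.task (K₁ ++ (k, k') :: K₂)) fun x hx => ?_]
    · simp
    · exact h x hx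
  · rintro _ hy
    obtain ⟨x, hx, rfl⟩ := List.mem_map.1 hy
    rw [h x hx]
    exact hl x hx
  · rintro _ hy h' s t φ
    obtain ⟨x, hx, rfl⟩ := List.mem_map.1 hy
    refine S.ev_query ?_ s t φ
    have := (hl x hx).2
    rwa [← h x hx] at this
  · simpa using hM

/-- The choices of the reduction. -/
def planVal (w : Val) (l : List Spec) (j : ℕ) (K : List (Bits × Bits)) : Val :=
  .cons w (.cons (codeSpecs l) (.cons (.unary j) (codeKeys K)))

theorem redGood_planVal (w : Val) (l : List Spec) (j : ℕ) (K : List (Bits × Bits)) :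
    redGood (planVal w l j K) ↔ (chosen w).Valid ∧ useful l j = true := by
  simp only [redGood, planVal, Val.hd_cons, Val.tl_cons, useful, Val.nth, codeSpecs,
    Val.toList_ofList, Val.toNat_unary, List.getD_eq_getElem?_getD, List.getElem?_map]
  cases l[j]? <;> simp [Spec.code]

/-- The input of the second stage of the adversary. -/
theorem redInput_codeKeys (w : Val) (K : List (Bits × Bits)) : redInput w (codeKeys K) =
    .cons w.hd (.cons w.tl.tl (.cons (garbledTables (chosen w).topology
      ((chosen w).output (chosenInput w)) K)
        (.ofList ((inputKeys (chosen w).inputs K).map .ofBits)))) := by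
  rw [redInput, Val.tables_eq, map_take_codeKeys]

/-- The part of the reduction after the choices, where the challenge is an encryption of `m`. -/
def redRun (B : Prog) (M M' : Polynomial ℕ) (A₂ : ℕ → Val → Matrix Bits Bits ℂ) (n : ℕ)
    (k' : Bits) (P : Val) (b : Bool) (s₀ t₀ : Bits) : ℂ :=
  ev ((S.encAll .query).den (S.encOracle n k') (.cons
    (((P.tl.hd.take P.tl.tl.hd).map Val.zeroSpec).map
      (Val.holeTask P.tl.tl.tl (P.tl.hd.nth P.tl.tl.hd).hd))
    (.cons (.cons (.unary n) (.unary (M.eval n))) .nil)) [] []) fun e s t =>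
    ev (S.enc n k' (fitBits (S.keyLen.eval n) (if b
      then (Val.plain P.tl.tl.tl (Val.zeroSpec (P.tl.hd.nth P.tl.tl.hd))).toBits
      else (Val.plain P.tl.tl.tl (P.tl.hd.nth P.tl.tl.hd)).toBits))) fun vk s' t' =>
      ev ((S.redB B M M').den (S.encOracle n k') (.cons (.unary n) (.cons P e.tl.rev))
        (s₀ ++ s ++ s') (t₀ ++ t ++ t')) (S.accept n k' vk (S.redEffect A₂ n))

theorem redRun_of_not_good {B : Prog} {M M' : Polynomial ℕ}
    {A₂ : ℕ → Val → Matrix Bits Bits ℂ} {k' : Bits} {P : Val} (hP : ¬ redGood P) (b : Bool)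
    (s₀ t₀ : Bits) : S.redRun B M M' A₂ n k' P b s₀ t₀ = 0 := by
  have h : ∀ e : Val, ¬ redGood (Val.cons (.unary n) (.cons P e)).tl.hd := fun _ => hP
  simp only [redRun, S.ev_redB_of_not_good (h _), ev_fun_zero]

/-- The part of the garbling experiment after the garbling. -/
def garbledRun (B : Prog) (A₂ : ℕ → Val → Matrix Bits Bits ℂ) (n : ℕ) (w : Val) (s₀ t₀ : Bits)
    (act : List Bits) (c : Val) (vks : List Bits) (s t : Bits) : ℂ :=
  ev (B.run (.cons w.hd (.cons w.tl.tl (.cons c (.ofList (act.map .ofBits))))) (s₀ ++ s) (t₀ ++ t))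
    (S.finish n (S.garbledCertLen n w) (A₂ n) vks)

/-- The adversary makes no queries, so it behaves the same with the oracle of the reduction. Its
running time bounds the memory in which the marker for counting qubits is searched. -/
theorem ev_adversary {B : Prog} (hB : B.QueryFree) {O : Val → CQ Val} {M' : Polynomial ℕ}
    {P e : Val} {K : List (Bits × Bits)} {k vk : Bits} {vks₁ vks₂ : List Bits} (hP : redGood P)
    (h₁ : ∀ vk ∈ vks₁, vk.length = S.vkLen.eval n) (h₂ : ∀ vk ∈ vks₂, vk.length = S.vkLen.eval n)
    (hq : vks₁.length + 1 + vks₂.length = 8 * (chosen P.hd).gates.length)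
    (he : e.tl = .ofList (vks₂.map .ofBits).reverse) (A₂ : ℕ → Val → Matrix Bits Bits ℂ)
    {s₀ t₀ s t : Bits} (hst : (s₀ ++ s).length = (t₀ ++ t).length)
    (hM : ∀ z ∈ B.traces 0 (redInput P.hd (codeKeys K)), (s₀ ++ s).length + z.2 ≤ M'.eval n) :
    (ev (B.den O (redInput P.hd (codeKeys K)) (s₀ ++ s) (t₀ ++ t)) fun st s t =>
      ev (Prog.memLen.den O (.unary (M'.eval n)) s t) fun m s t =>
      ev (S.vrfyLoop.den O (.cons (.ofList (vks₁.map .ofBits))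
        (.cons (S.vrfyContext n 0) (.cons m (.ofBool true)))) s t) fun r₁ s t =>
      ev (S.vrfyLoop.den O (.cons e.tl.rev
        (.cons (S.vrfyContext n (S.certLen.eval n))
          (.cons (m.drop ((Val.ofList (vks₁.map .ofBits)).map
            fun _ => .unary (S.certLen.eval n)).flatten) (.ofBool true)))) s t) fun r₂ s t =>
      S.accept n k vk (S.redEffect A₂ n) (.cons (.cons (.cons (.cons (.cons (.cons (.unary n)
        (.cons P (.ofList (vks₁.map .ofBits)))) e) st) m) r₁) r₂) s t) =
      S.garbledRun B A₂ n P.hd s₀ t₀ (inputKeys (chosen P.hd).inputs K)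
        (garbledTables (chosen P.hd).topology ((chosen P.hd).output (chosenInput P.hd)) K)
        (vks₁ ++ vk :: vks₂) s t := by
  rw [garbledRun, Prog.run_eq_den hB O, ← redInput_codeKeys]
  refine ev_congr (Prog.supp_den hB 0 _ hst) fun st a a' ha => ?_
  obtain ⟨haa, c, hc, hle⟩ := ha
  exact S.ev_verification hP h₁ h₂ hq he A₂ haa (hle.trans (hM _ hc))

/-- Ciphertexts before the challenge are encrypted in the first stage, the challenge is appended by
the experiment, and later ones are encrypted in the second stage. So all ciphertexts stand behind
the adversary's memory in the right order. -/
theorem redRun_eq {B : Prog} (hB : B.QueryFree) {M M' : Polynomial ℕ}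
    {A₂ : ℕ → Val → Matrix Bits Bits ℂ} {v : Val} {l : List Spec} {j : ℕ}
    {K₁ K₂ : List (Bits × Bits)} {k k' : Bits} (b : Bool) {s₀ t₀ : Bits}
    (hv : (chosen (.cons (.unary n) v)).Valid)
    (hl : Spec.Regular (S.keyLen.eval n) (chosen (.cons (.unary n) v)).topology l)
    (hj : useful l j = true) (hK : S.FitKeys n (K₁ ++ (k, k') :: K₂))
    (hlen : (K₁ ++ (k, k') :: K₂).length = chosenSize (.cons (.unary n) v))
    (hw : wireAt l j = K₁.length) (hst : s₀.length = t₀.length)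
    (hM : s₀.length + 8 * (chosen (.cons (.unary n) v)).gates.length * S.ctLen.eval n ≤ M.eval n)
    (hM' : ∀ z ∈ B.traces 0 (redInput (.cons (.unary n) v) (codeKeys (holeKeys K₁ k K₂))),
      M.eval n + z.2 ≤ M'.eval n) :
    S.redRun B M M' A₂ n k' (planVal (.cons (.unary n) v) l j (holeKeys K₁ k K₂)) b s₀ t₀ =
      S.challenge n (chosen (.cons (.unary n) v)).topology
        ((chosen (.cons (.unary n) v)).output (chosenInput (.cons (.unary n) v))) l j b K₁ k k' K₂
        (S.garbledRun B A₂ n (.cons (.unary n) v) s₀ t₀) := by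
  generalize hw' : Val.cons (.unary n) v = w at *
  have hn : w.hd = .unary n := by rw [← hw']; rfl
  set C := chosen w
  have hP := (redGood_planVal w l j (holeKeys K₁ k K₂)).2 ⟨hv, hj⟩
  have hsize : (K₁ ++ (k, k') :: K₂).length = C.topology.inputs + C.topology.wires.length := by
    rw [hlen]; simp [chosenSize, Circuit.topology, C]
  obtain ⟨l₁, x, l₂, rfl, rfl, hc, hb, hx⟩ := exists_of_useful hj
  have hxl : x ∈ l₁ ++ x :: l₂ := by simp
  have h1 := hl.wire_lt x hxl
  have hside := hl.side_eq x hxl hc hb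
  have hq := hl.length_eq
  have hq' : C.topology.wires.length = C.gates.length := by simp [Circuit.topology]
  rw [hq'] at hq
  simp only [List.length_append, List.length_cons] at hq
  have hfit : ∀ y ∈ l₁ ++ x :: l₂, _ := fun y hy => hl.fits hK hsize hy
  -- Later ciphertexts have an outgoing wire at least that of the challenge, which is larger than
  -- the wire of the missing key.
  have hout : ∀ y ∈ l₂, y.bit = true → y.out ≠ K₁.length := by
    intro y hy _
    have h2 := (List.pairwise_append.1 hl.sorted).2.1
    have := (List.pairwise_cons.1 h2).1 y hy
    omega
  have htask : ∀ y : Spec, y.wire = x.wire → y.out = x.out → y.side = true →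
      y.task (K₁ ++ (k, k') :: K₂) = (k', (y.task (holeKeys K₁ k K₂)).2) :=
    fun y h1' h2' h3' => Spec.task_hole (by rw [h1', ← hw, hx]) (by rw [h2', ← hw, hx]; omega) h3'
  have hmsg : fitBits (S.keyLen.eval n) (if b
      then (Val.plain (codeKeys (holeKeys K₁ k K₂)) x.zero.code).toBits
      else (Val.plain (codeKeys (holeKeys K₁ k K₂)) x.code).toBits) =
      (Spec.task (holeKeys K₁ k K₂) (if b then x.zero else x)).2 := by
    cases b
    · have := (hfit x hxl).1.2
      rw [htask x rfl rfl hside] at this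
      simp [Val.plain_eq, fitBits_self this]
    · have := (hfit x hxl).2.2
      rw [htask x.zero rfl rfl hside] at this
      simp [Val.plain_eq, fitBits_self this]
  have hx₁ : (codeSpecs (l₁ ++ x :: l₂)).nth (.unary l₁.length) = x.code := by
    rw [nth_codeSpecs (by simp)]; simp
  have hcode : x.code.hd = .unary K₁.length := by rw [← hw, hx]; rfl
  have hfit₁ : ∀ y ∈ l₁.map Spec.zero, S.Fits n (y.task (K₁ ++ (k, k') :: K₂)) := by
    rintro _ hz
    obtain ⟨y, hy, rfl⟩ := List.mem_map.1 hz
    exact (hfit y (by simp [hy])).2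
  have hfit₂ : ∀ y ∈ l₂, S.Fits n (y.task (K₁ ++ (k, k') :: K₂)) :=
    fun y hy => (hfit y (by simp [hy])).1
  have hlen₁ : (l₁.length + 1 + l₂.length) * S.ctLen.eval n =
      8 * C.gates.length * S.ctLen.eval n := by rw [← hq]; ring
  simp only [add_mul, one_mul] at hlen₁
  have hmsg_len : (Spec.task (holeKeys K₁ k K₂) (if b then x.zero else x)).2.length =
      S.keyLen.eval n := by rw [← hmsg]; simp [fitBits]
  have hk' : k'.length = S.keyLen.eval n := (hK (k, k') (by simp)).2
  rw [redRun, challenge]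
  simp only [planVal, Val.hd_cons, Val.tl_cons, hx₁, hcode,
    Val.zeroSpec_code, hmsg, take_codeSpecs, map_zeroSpec, List.take_left]
  -- Earlier ciphertexts are simulated, so their `bit` is `false` and the missing key cannot occur
  -- in their plaintexts.
  rw [S.ev_encAll_hole hfit₁ (by simp [Spec.zero]) rfl (by simp; omega)]
  refine ev_congr (S.supp_encList (by simpa using hfit₁)) fun vks₁ s t hvks₁ => ?_
  have e1 : (((l₁ ++ x :: l₂)[l₁.length]?).map fun y => (Spec.task (holeKeys K₁ k K₂)
      (if b then y.zero else y)).2).getD [] =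
        (Spec.task (holeKeys K₁ k K₂) (if b then x.zero else x)).2 := by simp
  rw [e1]
  refine ev_congr (S.supp_enc hk' hmsg_len) fun vk s' t' hvk => ?_
  rw [S.ev_redB]
  simp only [Val.hd_cons, Val.tl_cons, Val.toNat_unary, hx₁, hcode, drop_codeSpecs]
  have hdrop : (l₁ ++ x :: l₂).drop (l₁.length + 1) = l₂ := by
    rw [← List.drop_drop, List.drop_left]; rfl
  rw [hdrop]
  simp only [List.length_map] at hvks₁
  have hs : (s₀ ++ ([] ++ s) ++ s').length = s₀.length + l₁.length * S.ctLen.eval n +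
    S.ctLen.eval n := by simp [hvks₁, hvk]; omega
  have ht : (t₀ ++ ([] ++ t) ++ t').length = s₀.length + l₁.length * S.ctLen.eval n +
    S.ctLen.eval n := by simp [hvks₁, hvk, hst]; omega
  have hrev : (Val.ofList (vks₁.map Val.ofBits).reverse).rev = .ofList (vks₁.map .ofBits) := by
    simp [Val.rev]
  rw [S.ev_encAll_hole hfit₂ hout (hs.trans ht.symm) (by rw [hs]; omega), hrev]
  refine ev_congr (S.supp_encList (by simpa using hfit₂)) fun vks₂ s'' t'' hvks₂ => ?_
  simp only [List.length_map] at hvks₂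
  have es : s₀ ++ ([] ++ s) ++ s' ++ s'' = s₀ ++ (s ++ s' ++ s'') := by simp
  have et : t₀ ++ ([] ++ t) ++ t' ++ t'' = t₀ ++ (t ++ t' ++ t'') := by simp
  rw [es, et]
  have hs' : (s₀ ++ (s ++ s' ++ s'')).length = s₀.length + l₁.length * S.ctLen.eval n +
    S.ctLen.eval n + l₂.length * S.ctLen.eval n := by simp [hvks₁, hvk, hvks₂]; omega
  have ht' : (t₀ ++ (t ++ t' ++ t'')).length = s₀.length + l₁.length * S.ctLen.eval n +
    S.ctLen.eval n + l₂.length * S.ctLen.eval n := by simp [hvks₁, hvk, hvks₂, hst]; omega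
  exact S.ev_adversary hB (P := planVal w (l₁ ++ x :: l₂) l₁.length (holeKeys K₁ k K₂)) hP
    hvks₁.1.2 hvks₂.1.2 (by rw [hvks₁.1.1, hvks₂.1.1, planVal, Val.hd_cons]; change _ = 8 * C.gates.length; omega)
    (by simp) A₂ (hs'.trans ht'.symm) (fun z hz => by have := hM' z hz; omega)

end CertSKE

/-! ### The garbling experiments as hybrids -/

namespace CertSKE

variable (S : CertSKE) {n : ℕ}

theorem hybrid_congr {T : Topology} {rs : List Slot} (h : Slot.Regular T rs) (y : Bits) (j : ℕ)
    {φ ψ : List Bits → Val → List Bits → Bits → Bits → ℂ}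
    (hφ : ∀ act c vks s t, vks.length = 8 * T.wires.length → φ act c vks s t = ψ act c vks s t) :
    S.hybrid n T y rs j φ = S.hybrid n T y rs j ψ := by
  refine ev_congr (S.supp_keyPairs n _) fun K _ _ hK => ev_congr (S.supp_sampleSpecs h)
    fun l _ _ hl => ev_congr (S.supp_encList ?_) fun vks s t hvks => hφ _ _ _ _ _ ?_
  · intro x hx
    obtain ⟨x, hx', rfl⟩ := List.mem_map.1 hx
    rcases List.mem_append.1 hx' with hx' | hx'
    · obtain ⟨x, hx'', rfl⟩ := List.mem_map.1 hx'
      exact (hl.fits hK.2 hK.1 (List.mem_of_mem_take hx'')).2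
    · exact (hl.fits hK.2 hK.1 (List.mem_of_mem_drop hx')).1
  · rw [hvks.1.1, ← hl.length_eq]
    simp
    omega

theorem memoryless_vrfyAll (vks : List Bits) (s t : Bits) : Memoryless (S.vrfyAll n vks s t) := by
  induction vks generalizing s t with
  | nil => exact memoryless_pure _
  | cons vk vks ih =>
    exact (S.memoryless_vrfy _ _ _).bind fun ok => (ih _ _).bind fun _ => memoryless_pure _

/-- The number of verification keys agrees with the number of certificates, so the length check of
the scheme succeeds and its verification is the product of the single ones. -/
theorem ev_garbling_vrfy {vks : List Bits} {c : ℕ} (hc : vks.length * S.certLen.eval n = c)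
    (st : Val) (E : Val → Matrix Bits Bits ℂ) (s t : Bits) :
    (if c ≤ s.length ∧ c ≤ t.length then
      ev (S.garblingScheme.vrfy n (.ofList (vks.map .ofBits)) (s.take c) (t.take c)).traceOut
        fun ok _ _ => if ok then E st (t.drop c) (s.drop c) else 0
      else 0) = S.finish n c E vks st s t := by
  rw [finish]
  split
  case isTrue h =>
    have hv : (Val.ofList (vks.map .ofBits)).toList.map Val.toBits = vks := by
      simp [Function.comp_def]
    rw [garblingScheme]
    simp only [hv]
    rw [if_pos (by simp [hc, h])]
    simp only [ev_traceOut]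
    rw [← S.vrfyProd_take vks hc.le, ← S.ev_vrfyAll]
    exact (S.memoryless_vrfyAll vks _ _).ev_congr fun ok => by simp
  case isFalse => rfl

open Classical in
/-- The garbling experiment in terms of hybrids. -/
theorem acceptProb_garbling (A B : Prog) (A₂ : ℕ → Val → Matrix Bits Bits ℂ) (n : ℕ) (b : Bool) :
    (S.garblingScheme.experiment S.sim A B n b).acceptProb (A₂ n) =
      (ev (A.run (.unary n) [] []) fun v s₀ t₀ =>
        let w := Val.cons (.unary n) v
        if (chosen w).Valid then S.hybrid n (chosen w).topology
          ((chosen w).output (chosenInput w)) (if b then (chosen w).topology.slots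
            else chosenSlots w) 0 (S.garbledRun B A₂ n w s₀ t₀) else 0).re := by
  rw [acceptProb_eq, GarblingScheme.experiment]
  simp only [ev_apply, ev_bind]
  refine congrArg Complex.re (ev_fun_congr fun v s₀ t₀ => ?_)
  refine ((S.memoryless_keyPairs n _).ev _).trans ?_
  set w := Val.cons (.unary n) v
  have hC : Circuit.ofVal v.hd.hd = chosen w := rfl
  have hx : fitBits (chosen w).inputs v.hd.tl.toBits = chosenInput w := rfl
  simp only [hC, hx, List.nil_append]
  by_cases hv : (chosen w).Valid
  swap
  · rw [if_neg hv]
    cases b <;> simp [hv, ev_fun_zero]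
  rw [if_pos hv]
  set φ : List Bits → Val → Val → Bits → Bits → ℂ := fun act c vk s t =>
    ev (B.run (.cons (.unary n) (.cons v.tl (.cons c (.ofList (act.map .ofBits)))))
      (s₀ ++ s) (t₀ ++ t)) fun st s t =>
      let c := S.garblingScheme.certLen n (chosen w)
      if c ≤ s.length ∧ c ≤ t.length then
        ev (S.garblingScheme.vrfy n vk (s.take c) (t.take c)).traceOut
          fun ok _ _ => if ok then A₂ n st (t.drop c) (s.drop c) else 0 else 0 with hφ
  have hlen : (chosenInput w).length = (chosen w).inputs := Circuit.length_input _
  have hreg := (chosen w).regular_slots hv hlen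
  have hreg' : Slot.Regular (chosen w).topology (chosen w).topology.slots := by
    rw [← (chosen w).slots_map_zero ((chosen w).wireValues (chosenInput w))]
    exact hreg.map_zero
  have key : ∀ rs, Slot.Regular (chosen w).topology rs → S.hybrid n (chosen w).topology
      ((chosen w).output (chosenInput w)) rs 0
        (fun act c vks => φ act c (.ofList (vks.map .ofBits))) =
      S.hybrid n (chosen w).topology ((chosen w).output (chosenInput w)) rs 0
        (S.garbledRun B A₂ n w s₀ t₀) := by
    -- The number of verification keys is known only on the support of the hybrid, and the length
    -- check of the verification depends on it.
    refine fun rs hrs => S.hybrid_congr hrs _ _ fun act c vks s t hvks => ?_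
    refine ev_fun_congr fun st s t => ?_
    simp only [Circuit.topology, List.length_map] at hvks
    exact S.ev_garbling_vrfy (by rw [hvks]; rfl) st (A₂ n) s t
  cases b
  · simp only [Bool.false_eq_true, if_false]
    refine Eq.trans ?_ ((S.ev_garble hv hlen φ).trans (key _ hreg))
    refine ev_fun_congr fun labels _ _ => ?_
    simp only [ev_bind, ev_pure, List.append_nil, hv, if_true, ev_apply]
    refine ev_fun_congr fun g s t => ev_fun_congr fun st s t => ?_
    by_cases h : S.garblingScheme.certLen n (chosen w) ≤ s.length ∧
      S.garblingScheme.certLen n (chosen w) ≤ t.length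
    · simp only [if_pos h, ev_apply, ev_ket]
    · simp only [if_neg h, ev_zero]
  · simp only [if_true]
    refine Eq.trans ?_ ((S.ev_simulate_keyPairs hreg' _ hlen φ).trans (key _ hreg'))
    refine ev_fun_congr fun labels _ _ => ?_
    simp only [ev_bind, ev_pure, List.append_nil, hv, if_true, ev_apply]
    refine ev_fun_congr fun g s t => ev_fun_congr fun st s t => ?_
    by_cases h : S.garblingScheme.certLen n (chosen w) ≤ s.length ∧
      S.garblingScheme.certLen n (chosen w) ≤ t.length
    · simp only [if_pos h, ev_apply, ev_ket]
    · simp only [if_neg h, ev_zero]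

end CertSKE

/-! ### The reduction experiment as an average of gaps -/

namespace CertSKE

variable (S : CertSKE) {n : ℕ}

theorem ev_redPlan {N : Polynomial ℕ} (hN : N.eval n ≠ 0) (v : Val)
    (φ : Val → Bits → Bits → ℂ) :
    ev (S.redPlan N (.cons (.unary n) v)) φ =
      ev (S.sampleSpecs n (chosenSlots (.cons (.unary n) v))) fun l _ _ =>
        ((N.eval n : ℕ) : ℂ)⁻¹ * ∑ j ∈ Finset.range (N.eval n),
          ev (S.keyPairs n (wireAt l j)) fun K₁ _ _ => ev (S.keyGen n) fun k _ _ =>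
            ev (S.keyPairs n (chosenSize (.cons (.unary n) v) - (wireAt l j + 1))) fun K₂ _ _ =>
              φ (planVal (.cons (.unary n) v) l j (holeKeys K₁ k K₂)) [] [] := by
  simp only [redPlan, ev_bind, ev_pure, Val.hd_cons, Val.toNat_unary]
  refine (S.memoryless_sampleSpecs n _).ev_congr fun l => ?_
  rw [Val.ev_rand (by simpa using hN)]
  simp only [List.map_map, List.length_map, List.length_range]
  refine congrArg _ ?_
  rw [Finset.sum_eq_multiset_sum, Finset.range_val, ← Multiset.coe_range, Multiset.map_coe,
    Multiset.sum_coe]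
  refine congrArg List.sum (List.map_congr_left fun j _ => ?_)
  simp only [Function.comp_apply, Val.toNat_unary, List.nil_append]
  refine (S.memoryless_keyPairs n _).ev_congr fun K₁ => (S.memoryless_keyGen n).ev_congr fun k =>
    (S.memoryless_keyPairs n _).ev_congr fun K₂ => ?_
  rfl

/-- The frame has the length of the time bound of `A`, so all qubits of the adversary are skipped
and the choices and encryptions take place on an empty memory behind them. -/
theorem ev_redA {A : Prog} (hA : A.QueryFree) {T : Polynomial ℕ} (N M : Polynomial ℕ)
    (hT : ∀ z ∈ A.traces 0 (.unary n), z.2 ≤ T.eval n) (O : Val → CQ Val)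
    (φ : Val → Bits → Bits → ℂ) :
    ev ((S.redA A T N M).den O (.unary n) [] []) φ =
      ev (A.run (.unary n) [] []) fun v s₀ t₀ =>
        ev (S.redPlan N (.cons (.unary n) v)) fun P _ _ =>
          ev ((S.encAll .query).den O (.cons
            (((P.tl.hd.take P.tl.tl.hd).map Val.zeroSpec).map
              (Val.holeTask P.tl.tl.tl (P.tl.hd.nth P.tl.tl.hd).hd))
            (.cons (.cons (.unary P.hd.hd.toNat) (.unary (M.eval P.hd.hd.toNat))) .nil)) [] [])
            fun e s t => φ (.cons (.cons (Val.plain P.tl.tl.tl (P.tl.hd.nth P.tl.tl.hd))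
              (Val.plain P.tl.tl.tl (Val.zeroSpec (P.tl.hd.nth P.tl.tl.hd))))
                (.cons P e.tl.rev)) (s₀ ++ s) (t₀ ++ t) := by
  simp only [redA, Prog.ev_seq, Prog.ev_pair]
  rw [Prog.run_eq_den hA O, Prog.den, ev_ket]
  refine ev_congr (Prog.supp_den hA 0 _ rfl) fun v s₀ t₀ h => ?_
  obtain ⟨hst, c, hc, hle⟩ := h
  have := hT _ hc
  simp only [List.length_nil] at hle this
  rw [(fp_redFrame T).ev_den, Prog.ev_frame]
  simp only [Val.hd_cons, Val.tl_cons, Val.toNat_unary]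
  rw [List.drop_eq_nil_of_le (by omega), List.drop_eq_nil_of_le (by omega),
    List.take_of_length_le (by omega), List.take_of_length_le (by omega), Prog.ev_seq,
    (S.fr_redPlan N).den]
  refine ((S.fr_redPlan N).memoryless _).ev_congr fun P => ?_
  rw [Prog.ev_seq, Prog.ev_pair, Prog.den, ev_ket, Prog.ev_seq, (fp_redTasks₁ M).ev_den]
  refine ev_fun_congr fun e s t => ?_
  rw [fp_redMessages.ev_den]
  simp only [Val.hd_cons, Val.tl_cons]

open Classical in
/-- The experiment with the reduction, in terms of the gaps between the hybrids. -/
theorem acceptProb_reduction {A B : Prog} (hA : A.QueryFree) (hB : B.QueryFree)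
    {T N M M' : Polynomial ℕ} (hN : N.eval n ≠ 0)
    (hT : ∀ z ∈ A.traces 0 (.unary n), z.2 ≤ T.eval n)
    (hM : ∀ z ∈ A.traces 0 (.unary n), z.2 + 8 * (chosen (.cons (.unary n) z.1)).gates.length *
      S.ctLen.eval n ≤ M.eval n)
    (hM' : ∀ x ∈ A.traces 0 (.unary n), ∀ K : List (Bits × Bits),
      K.length ≤ chosenSize (.cons (.unary n) x.1) →
      (∀ k ∈ K, k.1.length ≤ S.keyLen.eval n ∧ k.2.length ≤ S.keyLen.eval n) →
      ∀ z ∈ B.traces 0 (redInput (.cons (.unary n) x.1) (codeKeys K)),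
        M.eval n + z.2 ≤ M'.eval n)
    (A₂ : ℕ → Val → Matrix Bits Bits ℂ) (b : Bool) :
    (S.experiment (S.redA A T N M) (S.redB B M M') n b).acceptProb (S.redEffect A₂ n) =
      (ev (A.run (.unary n) [] []) fun v s₀ t₀ =>
        let w := Val.cons (.unary n) v
        ((N.eval n : ℕ) : ℂ)⁻¹ * ∑ j ∈ Finset.range (N.eval n), if (chosen w).Valid then
          S.gap n (chosen w).topology ((chosen w).output (chosenInput w)) (chosenSlots w) j b
            (S.garbledRun B A₂ n w s₀ t₀) else 0).re := by
  rw [acceptProb_experiment]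
  refine congrArg Complex.re ?_
  simp only [S.ev_redA hA N M hT, Val.hd_cons, Val.tl_cons, S.ev_redPlan hN]
  -- The first stage of the adversary makes no queries, so it can be run before the key of the
  -- experiment is chosen.
  rw [ev_comm]
  rw [Prog.run_eq_den hA fun _ => pure Val.nil]
  refine ev_congr (Prog.supp_den hA 0 _ rfl) fun v s₀ t₀ h => ?_
  obtain ⟨hst, c, hc, hle⟩ := h
  set w := Val.cons (.unary n) v with hw
  have hred : ∀ (l : List Spec) (j : ℕ) (K : List (Bits × Bits)),
      (planVal w l j K).hd.hd.toNat = n := fun l j K => by simp [planVal, hw]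
  simp only [hred]
  change (ev (S.keyGen n) fun k' _ _ => ev (S.sampleSpecs n (chosenSlots w)) fun l _ _ =>
    ((N.eval n : ℕ) : ℂ)⁻¹ * ∑ j ∈ Finset.range (N.eval n),
      ev (S.keyPairs n (wireAt l j)) fun K₁ _ _ => ev (S.keyGen n) fun k _ _ =>
        ev (S.keyPairs n (chosenSize w - (wireAt l j + 1))) fun K₂ _ _ =>
          S.redRun B M M' A₂ n k' (planVal w l j (holeKeys K₁ k K₂)) b s₀ t₀) = _
  simp only [ev_mul_left, ev_fun_sum]
  refine congrArg _ (Finset.sum_congr rfl fun j _ => ?_)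
  by_cases hv : (chosen w).Valid
  swap
  · have hP : ∀ l K, ¬ redGood (planVal w l j K) :=
      fun l K => fun h => hv ((redGood_planVal w l j K).1 h).1
    simp only [S.redRun_of_not_good (hP _ _), ev_fun_zero, if_neg hv]
  have hreg : Slot.Regular (chosen w).topology (chosenSlots w) :=
    (chosen w).regular_slots hv (Circuit.length_input _)
  have hsize : (chosen w).topology.inputs + (chosen w).topology.wires.length = chosenSize w := by
    simp [chosenSize, Circuit.topology]
  rw [if_pos hv, S.gap_eq hreg, hsize]
  refine ev_congr (S.supp_keyGen n) fun k' _ _ hk' => ev_congr (S.supp_sampleSpecs hreg)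
    fun l _ _ hl => ?_
  by_cases hj : useful l j = true
  swap
  · have hP : ∀ K, ¬ redGood (planVal w l j K) :=
      fun K => fun h => hj ((redGood_planVal w l j K).1 h).2
    simp only [S.redRun_of_not_good (hP _), ev_fun_zero, if_neg hj]
  refine ev_congr (S.supp_keyPairs n _) fun K₁ _ _ hK₁ => ev_congr (S.supp_keyGen n)
    fun k _ _ hk => ev_congr (S.supp_keyPairs n _) fun K₂ _ _ hK₂ => ?_
  rw [if_pos hj]
  -- For a useful index the wire of the challenge exists in the circuit, so the subtraction in the
  -- number of remaining pairs is not truncated.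
  have hlen : K₁.length + (K₂.length + 1) = chosenSize w := by
    obtain ⟨l₁, x, l₂, rfl, rfl, -, -, hx⟩ := exists_of_useful hj
    have h1 := hl.wire_lt x (by simp)
    have h2 := hl.out_lt x (by simp)
    rw [hK₁.1, hK₂.1, hx]
    omega
  refine S.redRun_eq hB b hv hl hj ?_ (by simpa using hlen) hK₁.1.symm hst ?_ ?_
  · intro x hx
    rcases List.mem_append.1 hx with hx | hx
    · exact hK₁.2 x hx
    rcases List.mem_cons.1 hx with rfl | hx
    · exact ⟨hk, hk'⟩
    · exact hK₂.2 x hx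
  · have := hM _ hc
    simp only [List.length_nil, zero_add] at hle this ⊢
    omega
  · refine hM' _ hc _ (by simpa [holeKeys] using hlen.le) fun x hx => ?_
    rcases List.mem_append.1 hx with hx | hx
    · exact ⟨(hK₁.2 x hx).1.le, (hK₁.2 x hx).2.le⟩
    rcases List.mem_cons.1 hx with rfl | hx
    · exact ⟨hk.le, by simp⟩
    · exact ⟨(hK₂.2 x hx).1.le, (hK₂.2 x hx).2.le⟩

end CertSKE

/-! ### Polynomial loss and conclusion -/

theorem Polynomial.eval_nat_le (P : Polynomial ℕ) {n : ℕ} (hn : 1 ≤ n) :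
    P.eval n ≤ P.eval 1 * n ^ P.natDegree := by
  rw [eval_eq_sum_range, eval_eq_sum_range, Finset.sum_mul]
  refine Finset.sum_le_sum fun i hi => ?_
  rw [one_pow, mul_one]
  exact Nat.mul_le_mul_left _ (Nat.pow_le_pow_right hn (by simp at hi; omega))

theorem Negligible.of_le_mul {f g : ℕ → ℝ} (hf : Negligible f) (hf0 : ∀ n, 0 ≤ f n)
    (P : Polynomial ℕ) (hg : ∀ n, g n ≤ (P.eval n : ℕ) * f n) : Negligible g := by
  intro c
  -- For `n` above `P(1)` the factor `P(n) ≤ P(1) * n ^ deg P` is at most `n ^ (deg P + 1)`, which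
  -- the increased exponent compensates.
  obtain ⟨n₀, hn₀⟩ := hf (c + P.natDegree + 1)
  refine ⟨max n₀ (P.eval 1), fun n hn => ?_⟩
  have h1 := hn₀ n (lt_of_le_of_lt (le_max_left _ _) hn)
  have h2 := lt_of_le_of_lt (le_max_right _ _) hn
  have hpos : (0 : ℝ) < n := by exact_mod_cast (by omega : 0 < n)
  have h3 : P.eval n ≤ n ^ (P.natDegree + 1) := by
    rw [pow_succ, mul_comm]
    exact (P.eval_nat_le (by omega)).trans (Nat.mul_le_mul_right _ h2.le)
  have h3' : ((P.eval n : ℕ) : ℝ) ≤ (n : ℝ) ^ (P.natDegree + 1) := by exact_mod_cast h3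
  calc g n ≤ (P.eval n : ℕ) * f n := hg n
    _ ≤ (n : ℝ) ^ (P.natDegree + 1) * f n := mul_le_mul_of_nonneg_right h3' (hf0 n)
    _ < (n : ℝ) ^ (P.natDegree + 1) * ((n : ℝ) ^ (c + P.natDegree + 1))⁻¹ :=
        mul_lt_mul_of_pos_left h1 (by positivity)
    _ = ((n : ℝ) ^ c)⁻¹ := by
        rw [add_assoc, pow_add]
        field_simp
        ring

theorem size_codeKeys_le {m : ℕ} {K : List (Bits × Bits)}
    (h : ∀ k ∈ K, k.1.length ≤ m ∧ k.2.length ≤ m) :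
    (codeKeys K).size ≤ 1 + K.length * (4 + 8 * m) := by
  induction K with
  | nil => simp [codeKeys, Val.ofList, Val.size]
  | cons k K ih =>
    have h1 := ih fun x hx => h x (by simp [hx])
    have h2 := h k (by simp)
    have h3 := Val.size_ofBits_le k.1
    have h4 := Val.size_ofBits_le k.2
    simp only [codeKeys, List.map_cons, Val.ofList, Val.size, List.length_cons, add_mul] at h1 ⊢
    omega

namespace CertSKE

variable (S : CertSKE) {n : ℕ}

theorem length_gates_chosen_le (v : Val) :
    (chosen (.cons (.unary n) v)).gates.length ≤ v.size := by
  have h1 := v.hd.hd.tl.hd.length_toList_le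
  have h2 := v.size_hd_le
  have h3 := v.hd.size_hd_le
  have h4 := v.hd.hd.tl.size_hd_le
  have h5 := v.hd.hd.size_tl_le
  simp only [chosen, Circuit.ofVal, Val.tl_cons, List.length_map]
  omega

theorem chosenSize_le (v : Val) : chosenSize (.cons (.unary n) v) ≤ 2 * v.size := by
  have h0 := length_gates_chosen_le (n := n) v
  have h1 := v.hd.hd.hd.length_toList_le
  have h2 := v.size_hd_le
  have h3 := v.hd.size_hd_le
  have h4 := v.hd.hd.size_hd_le
  have h5 : (chosen (.cons (.unary n) v)).inputs = v.hd.hd.hd.toList.length := rfl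
  rw [chosenSize]
  omega

open Classical in
/-- The reduction loses a factor of the number of hybrids. -/
theorem acceptProb_sub {A B : Prog} (hA : A.QueryFree) (hB : B.QueryFree)
    {T N M M' : Polynomial ℕ} (hN : N.eval n ≠ 0)
    (hT : ∀ z ∈ A.traces 0 (.unary n), z.2 ≤ T.eval n)
    (hM : ∀ z ∈ A.traces 0 (.unary n), z.2 + 8 * (chosen (.cons (.unary n) z.1)).gates.length *
      S.ctLen.eval n ≤ M.eval n)
    (hM' : ∀ x ∈ A.traces 0 (.unary n), ∀ K : List (Bits × Bits),
      K.length ≤ chosenSize (.cons (.unary n) x.1) →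
      (∀ k ∈ K, k.1.length ≤ S.keyLen.eval n ∧ k.2.length ≤ S.keyLen.eval n) →
      ∀ z ∈ B.traces 0 (redInput (.cons (.unary n) x.1) (codeKeys K)),
        M.eval n + z.2 ≤ M'.eval n)
    (hN' : ∀ z ∈ A.traces 0 (.unary n),
      8 * (chosen (.cons (.unary n) z.1)).gates.length ≤ N.eval n)
    (A₂ : ℕ → Val → Matrix Bits Bits ℂ) :
    (S.garblingScheme.experiment S.sim A B n false).acceptProb (A₂ n) -
      (S.garblingScheme.experiment S.sim A B n true).acceptProb (A₂ n) =
    (N.eval n : ℕ) *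
      ((S.experiment (S.redA A T N M) (S.redB B M M') n false).acceptProb (S.redEffect A₂ n) -
      (S.experiment (S.redA A T N M) (S.redB B M M') n true).acceptProb (S.redEffect A₂ n)) := by
  have hN0 : ((N.eval n : ℕ) : ℂ) ≠ 0 := by exact_mod_cast hN
  rw [acceptProb_garbling, acceptProb_garbling, S.acceptProb_reduction hA hB hN hT hM hM',
    S.acceptProb_reduction hA hB hN hT hM hM', ← Complex.sub_re, ← Complex.sub_re,
    ← ev_fun_sub, ← ev_fun_sub, ← Complex.re_ofReal_mul, Complex.ofReal_natCast, ← ev_mul_left]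
  refine congrArg Complex.re ?_
  rw [Prog.run_eq_den hA fun _ => pure Val.nil]
  refine ev_congr (Prog.supp_den hA 0 _ rfl) fun v s₀ t₀ h => ?_
  obtain ⟨hst, c, hc, hle⟩ := h
  set w := Val.cons (.unary n) v
  simp only
  rw [← mul_sub, mul_inv_cancel_left₀ hN0, ← Finset.sum_sub_distrib]
  by_cases hv : (chosen w).Valid
  · simp only [if_pos hv, ← hybrid_sub, Bool.false_eq_true, if_false, if_true]
    -- The gaps telescope to the difference of the hybrids with indices 0 and `N`. The latter is
    -- fully simulated, since `N` bounds the number of ciphertexts; any larger index gives the same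
    -- hybrid.
    rw [Finset.sum_range_sub', chosenSlots, 
      ← S.hybrid_eq_of_le hv (x := chosenInput w) (Circuit.length_input _) (hN' _ hc)]
  · simp [hv]

end CertSKE

theorem mainTheorem8 (S : CertSKE) (hS : S.CertEverlastingINDCPA) :
    S.garblingScheme.SelectiveCertEverlasting := by
  refine ⟨S.sim, S.qpt_sim, fun A B hA hB A₂ hA₂ => ?_⟩
  obtain ⟨PA, hPA⟩ := hA.2
  obtain ⟨PB, hPB⟩ := hB.2
  obtain ⟨R, hR⟩ := CertSKE.fp_redInput.size_le
  -- `T` bounds time, memory and output of the first stage; adding one makes the range of the guess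
  -- nonempty. Each gate has eight ciphertexts, hence `N`. The memory is bounded by `M` before the
  -- second stage of the adversary and by `M'` after it, where the argument of `R` bounds the data
  -- from which the input of that stage is computed.
  let T : Polynomial ℕ := PA.comp (2 * X + 1) + 1
  let N : Polynomial ℕ := 8 * T
  let M : Polynomial ℕ := T + 8 * T * S.ctLen
  let M' : Polynomial ℕ := M + PB.comp (R.comp
    (1 + (1 + (2 * X + 1) + T) + (1 + 2 * T * (4 + 8 * S.keyLen))))
  have hTn (n : ℕ) : T.eval n = PA.eval (2 * n + 1) + 1 := by simp [T]
  have hT : ∀ n, ∀ z ∈ A.traces 0 (.unary n), z.2 ≤ T.eval n := by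
    intro n z hz
    have := hPA 0 _ z hz
    rw [Val.size_unary, add_zero] at this
    rw [hTn]
    omega
  have hsize : ∀ n, ∀ z ∈ A.traces 0 (.unary n), z.1.size ≤ T.eval n := fun n z hz =>
    (Prog.size_le_cost _ hz).trans (hT n z hz)
  have hgates : ∀ n, ∀ z ∈ A.traces 0 (.unary n),
      (CertSKE.chosen (.cons (.unary n) z.1)).gates.length ≤ T.eval n := fun n z hz =>
    (CertSKE.length_gates_chosen_le _).trans (hsize n z hz)
  have key := fun n => S.acceptProb_sub (n := n) hA.1 hB.1 (T := T) (N := N) (M := M) (M' := M')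
    (by simp [N, hTn]) (hT n) ?_ ?_ ?_ A₂
  · refine Negligible.of_le_mul (hS (S.redA A T N M) (S.redB B M M') (S.polyTime_redA hA.2 _ _ _)
      (S.polyTime_redB hB.2 _ _) (S.redEffect A₂) (S.isEffect_redEffect hA₂))
      (fun n => abs_nonneg _) N fun n => ?_
    rw [key, abs_mul, Nat.abs_cast]
  · intro z hz
    have h1 := hT n z hz
    have h2 := Nat.mul_le_mul_right (S.ctLen.eval n) (Nat.mul_le_mul_left 8 (hgates n z hz))
    simp only [M, eval_add, eval_mul, eval_ofNat]
    omega
  · intro x hx K hK hK' z hz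
    have h1 := hPB 0 _ z hz
    have h2 := hR (.cons (.cons (.unary n) x.1) (codeKeys K))
    have h3 := size_codeKeys_le hK'
    have h4 := hsize n x hx
    have h5 := hK.trans (CertSKE.chosenSize_le x.1)
    have h6 := Nat.mul_le_mul_right (4 + 8 * S.keyLen.eval n)
      (show K.length ≤ 2 * T.eval n by omega)
    have h7 := R.eval_nat_mono (show (Val.cons (.cons (.unary n) x.1) (codeKeys K)).size ≤
      1 + (1 + (2 * n + 1) + T.eval n) + (1 + 2 * T.eval n * (4 + 8 * S.keyLen.eval n)) by
        simp only [Val.size, Val.size_unary]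
        omega)
    have h8 := PB.eval_nat_mono (h2.trans h7)
    simp only [M', eval_add, eval_mul, eval_comp, eval_ofNat, eval_X, eval_one]
    exact Nat.add_le_add_left (h1.trans h8) _
  · intro z hz
    simp only [N, eval_mul, eval_ofNat]
    exact Nat.mul_le_mul_left 8 (hgates n z hz)

end
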